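/- Theorem (Nonlinear uniform boundedness principle). Let $m\in\mathbb N$, $m\ge 1$, $s\in(0,1]$, $p\in[1,+\infty)$, and let $\mathcal N$ be a connected (finite-dimensional, smooth, second countable, boundaryless) Riemannian manifold with geodesic distance $d_{\mathcal N}$, which is compact if either $sp>m$ or $s=p=m=1$. "Measurable" means Lebesgue measurable, and maps are defined everywhere on their domain. For an open set $A\subseteq\mathbb R^m$ and a measurable map $u:A\to\mathcal N$ set, if $s<1$, \[ \mathcal E_{s,p}(u,A)=\int_A\int_A\frac{d_{\mathcal N}(u(x),u(y))^p}{|x-y|^{m+sp}}\,\mathrm dx\,\mathrm dy\in[0,+\infty]; \] if $s=1$, let $\iota:\mathcal N\to\mathbb R^\nu$ be a smooth isometric (Riemannian) embedding, by means of which $\mathcal N$ is identified with a subset of $\mathbb R^\nu$ (one exists by Nash's theorem; any one may be taken), and set \[ \mathcal E_{1,p}(u,A)=\int_A|D(\iota\circ u)|^p\in[0,+\infty], \] where $|\cdot|$ is the Euclidean (Frobenius) norm, $D$ is the weak derivative, and the value is $+\infty$ if $\iota\circ u$ is not weakly differentiable. Let $\mathcal G$ be an energy over $\mathbb R^m$ with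 state space $\mathcal N$: it assigns to every open set $A\subseteq\mathbb R^m$ and every measurable $u:A\to\mathcal N$ a value $\mathcal G(u,A)\in[0,+\infty]$, such that $\mathcal G(u|_A,A)\le\mathcal G(u,B)$ whenever $A\subseteq B$ are open and $u:B\to\mathcal N$ is measurable. For a map $u$ defined on a larger set write $\mathcal G(u,A)=\mathcal G(u|_A,A)$. Assume that for every measurable $u:\mathbb R^m\to\mathcal N$: (i) (superadditivity) if $A,B\subseteq\mathbb R^m$ are open and $\overline A\cap\overline B=\emptyset$, then $\mathcal G(u,A\cup B)\ge\mathcal G(u,A)+\mathcal G(u,B)$; (ii) (scaling) for all $\lambda>0$, $h\in\mathbb R^m$ and every open $A\subseteq\mathbb R^m$, $\mathcal G(u,h+\lambda A)=\lambda^{m-sp}\,\mathcal G(u(h+\lambda\,\cdot),A)$. Let $\mathbb B^m$ be the open unit ball of $\mathbb R^m$. Suppose that for every measurable $u:\mathbb B^m\to\mathcal N$, $\mathcal E_{s,p}(u,\mathbb B^m)<+\infty$ implies $\mathcal G(u,\mathbb B^m)<+\infty$, and $\mathcal E_{s,p}(u,\mathbb B^m)=0$ implies $\mathcal G(u,\mathbb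 B^m)=0$. Then there is a constant $C\in[0,+\infty)$ such that for every measurable $u:\mathbb B^m\to\mathcal N$ with either $sp<m$ or $\mathcal E_{s,p}(u,\mathbb B^m)\le 1/C$ (where $1/0=+\infty$), \[ \mathcal G(u,\mathbb B^m)\le C\,\mathcal E_{s,p}(u,\mathbb B^m). \] -/

import Mathlib

open MeasureTheory Set Bundle
open scoped ENNReal NNReal Manifold ContDiff

/-! Subsets of `ℝ^m` carry the restriction of Lebesgue measure. -/
attribute [local instance] MeasureTheory.Measure.Subtype.measureSpace

noncomputable section

/-- An energy over `ℝ^m` with state space `N`: it assigns a value in `[0, ∞]` to every open set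
`A` and every (Lebesgue) measurable map `u : A → N`, and it does not increase under restriction.
The values of `toFun` at sets that are not open or at maps that are not measurable are irrelevant:
neither the axiom below nor anything else refers to them.
`NullMeasurable` is Lebesgue measurability: preimages of Borel sets are Lebesgue measurable. -/
structure MapEnergy (m : ℕ) (N : Type*) [MeasurableSpace N] where
  toFun : ∀ A : Set (EuclideanSpace ℝ (Fin m)), (A → N) → ℝ≥0∞
  mono' : ∀ (A B : Set (EuclideanSpace ℝ (Fin m))), IsOpen A → IsOpen B → ∀ hAB : A ⊆ B,
    ∀ u : B → N, NullMeasurable u volume → toFun A (u ∘ Set.inclusion hAB) ≤ toFun B u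

namespace MapEnergy

variable {m : ℕ} {N : Type*} [MeasurableSpace N]

/-- `G (u, A)` for a map `u` defined on all of `ℝ^m`, that is `G (u|_A, A)`. -/
def restr (G : MapEnergy m N) (u : EuclideanSpace ℝ (Fin m) → N)
    (A : Set (EuclideanSpace ℝ (Fin m))) : ℝ≥0∞ :=
  G.toFun A (fun x => u x)

/-- Superadditivity on open sets with disjoint closures. -/
def Superadditive (G : MapEnergy m N) : Prop :=
  ∀ u : EuclideanSpace ℝ (Fin m) → N, NullMeasurable u volume →
    ∀ A B : Set (EuclideanSpace ℝ (Fin m)), IsOpen A → IsOpen B →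
      closure A ∩ closure B = ∅ → G.restr u A + G.restr u B ≤ G.restr u (A ∪ B)

/-- Scaling with exponent `α`: `G (u, h + t A) = t ^ α G (u (h + t ·), A)`. -/
def ScalesWith (G : MapEnergy m N) (α : ℝ) : Prop :=
  ∀ u : EuclideanSpace ℝ (Fin m) → N, NullMeasurable u volume →
    ∀ t : ℝ, 0 < t → ∀ h : EuclideanSpace ℝ (Fin m),
      ∀ A : Set (EuclideanSpace ℝ (Fin m)), IsOpen A →
        G.restr u ((fun x => h + t • x) '' A)
          = ENNReal.ofReal (t ^ α) * G.restr (fun x => u (h + t • x)) A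

end MapEnergy

/-- The Gagliardo energy `∫_A ∫_A d(u(x), u(y))^p / |x - y|^(m + s p) dx dy`. -/
def gagliardoEnergy {m : ℕ} {N : Type*} [EDist N] (s p : ℝ)
    (A : Set (EuclideanSpace ℝ (Fin m))) (u : A → N) : ℝ≥0∞ :=
  ∫⁻ x : A, ∫⁻ y : A, edist (u x) (u y) ^ p / edist x y ^ ((m : ℝ) + s * p)

/-- The locally integrable functions `D 0, …, D (m-1)` are the weak partial derivatives on the
open set `A` of the locally integrable function `f`. -/
structure HasWeakPartials {m ν : ℕ} (A : Set (EuclideanSpace ℝ (Fin m)))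
    (f : A → EuclideanSpace ℝ (Fin ν)) (D : Fin m → A → EuclideanSpace ℝ (Fin ν)) : Prop where
  locallyIntegrable : LocallyIntegrable f volume
  locallyIntegrable_deriv : ∀ i, LocallyIntegrable (D i) volume
  integral_eq : ∀ φ : EuclideanSpace ℝ (Fin m) → ℝ, ContDiff ℝ ∞ φ → HasCompactSupport φ →
    tsupport φ ⊆ A → ∀ i : Fin m,
      ∫ x : A, fderiv ℝ φ x (EuclideanSpace.single i 1) • f x = - ∫ x : A, φ x • D i x

/-- The energy `∫_A |Df|^p` of a vector-valued map, with `|Df|² = ∑ i |∂_i f|²`; it is `∞` if `f`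
is not weakly differentiable. (Weak derivatives are unique almost everywhere, so that the infimum
is over at most one value.) -/
def dirichletEnergy {m ν : ℕ} (p : ℝ) (A : Set (EuclideanSpace ℝ (Fin m)))
    (f : A → EuclideanSpace ℝ (Fin ν)) : ℝ≥0∞ :=
  ⨅ (D : Fin m → A → EuclideanSpace ℝ (Fin ν)) (_ : HasWeakPartials A f D),
    ∫⁻ x : A, (∑ i, ‖D i x‖ₑ ^ 2) ^ (p / 2)

/-- `ι` is a smooth isometric embedding (in the Riemannian sense) of `N` into `ℝ^ν`: it is smooth,
a homeomorphism onto its image, and its differential preserves the lengths of tangent vectors. -/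
structure IsIsometricEmbedding {d ν : ℕ} {N : Type*} [TopologicalSpace N]
    [ChartedSpace (EuclideanSpace ℝ (Fin d)) N]
    [RiemannianBundle (fun x : N => TangentSpace (𝓡 d) x)]
    (ι : N → EuclideanSpace ℝ (Fin ν)) : Prop where
  isEmbedding : Topology.IsEmbedding ι
  contMDiff : ContMDiff (𝓡 d) 𝓘(ℝ, EuclideanSpace ℝ (Fin ν)) ∞ ι
  norm_mfderiv : ∀ (x : N) (v : TangentSpace (𝓡 d) x),
    ‖mfderiv (𝓡 d) 𝓘(ℝ, EuclideanSpace ℝ (Fin ν)) ι x v‖ = ‖v‖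

/-- The Sobolev energy `E_{s,p}(u, A)`, `0 < s ≤ 1`: the Gagliardo energy for the distance of `N`
if `s ≠ 1`, and `∫_A |D(ι ∘ u)|^p` if `s = 1`, where `N` is seen as a subset of `ℝ^ν` by means of
`ι` (which plays no role if `s ≠ 1`). -/
def sobolevEnergy {m ν : ℕ} {N : Type*} [EDist N] (ι : N → EuclideanSpace ℝ (Fin ν)) (s p : ℝ)
    (A : Set (EuclideanSpace ℝ (Fin m))) (u : A → N) : ℝ≥0∞ :=
  if s = 1 then dirichletEnergy p A (ι ∘ u) else gagliardoEnergy s p A u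

end

/-!
The argument is by contradiction. If no constant works, there are maps `u n` of the unit ball with
`G (u n) > n * E (u n)`, where `E` is the Sobolev energy. Out of rescaled copies of these maps one
builds a single map of finite energy at which `G` is infinite, which is excluded by assumption.

Each `u n` is first extended to a map of `ℝ^m` that is constant, equal to some `b n`, outside a ball,
with an energy bounded by a multiple of `E (u n)`. The extension is `u n ∘ foldToward a`, where
`foldToward a` folds an annulus back into the ball towards a point `a`. A fixed `a` would not do, as
the map could concentrate its energy near `a`; on average over `a`, however, composition with
`foldToward a` is bounded on `L¹` (`exists_lintegral_foldToward_le`), so that some `a` is suitable.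
For the fractional energy the points `x` and `y` are compared through intermediate points of the ball
(`exists_foldToward_gagliardoOn_le`); for the first-order energy the chain rule holds for almost
every `a`, by approximation with smooth functions (`exists_foldToward_weakEnergy_le`).

By the scaling property, a copy of the extension at scale `t` has energy and value of `G` multiplied
by `t ^ (m - s * p)`. Many copies on a grid of a small ball (`exists_packing`, `exists_packed_map`)
have a total energy that is as small as desired and, by superadditivity, a large total value of `G`.
Outside the copies the map equals `b n`, which has to be joined to a value `b'` that does not depend
on `n`, again at a small cost in energy (`exists_transition_of_logCutoff`). If `s * p < m`, or
`s * p = m` and `p > 1`, points have zero capacity (`tendsto_capacity`), and a Lipschitz path from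
`b'` to `b n`, composed with a logarithmic cutoff function, has arbitrarily small energy. Otherwise
`N` is compact, `b'` is taken as a cluster point of the `b n`, and the path itself is short
(`eventually_exists_lipschitzWith_path`). The maps obtained in this way are equal to `b'` outside the
unit ball, have summable energies and unbounded values of `G`; placing them on disjoint balls that
shrink to the origin gives the map of finite energy (`exists_finite_energy_restr_eq_top`).

The scheme is carried out in `uniform_boundedness_of_gluing` for any energy that behaves well when
maps are glued along disjoint balls (`IsGluingEnergy`). The fractional energy does by the triangle
inequality (`isGluingEnergy_gagliardoOn`). For the first-order energy (`isGluingEnergy_weakEnergy`)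
the point is that infinitely many weakly differentiable functions, each constant outside its ball,
glue to a weakly differentiable function (`HasWeakFDeriv.glueBalls`), the sum being controlled by a
Poincaré inequality. The energy `dirichletEnergy`, defined by partial derivatives, and `weakEnergy`,
defined by the operator norm, agree up to a factor, a power of `m`.
-/

/-! ### Gluing maps on disjoint balls -/

/-- The map equal to `w j` on `U j` and to `h₀` off `⋃ j, U j`, for disjoint sets `U j`. -/
noncomputable def glue {J X Y : Type*} (U : J → Set X) (w : J → X → Y) (h₀ : X → Y) (x : X) : Y :=
  open Classical in if h : ∃ j, x ∈ U j then w h.choose x else h₀ x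

theorem glue_of_mem {J X Y : Type*} {U : J → Set X}
    (hU : Pairwise (fun i j => Disjoint (U i) (U j)))
    (w : J → X → Y) (h₀ : X → Y) {x : X} {j : J} (hx : x ∈ U j) : glue U w h₀ x = w j x := by
  have h : ∃ j, x ∈ U j := ⟨j, hx⟩
  have : h.choose = j := by
    by_contra hne
    exact (Set.disjoint_left.1 (hU hne)) h.choose_spec hx
  rw [glue, dif_pos h, this]

theorem glue_of_notMem {J X Y : Type*} {U : J → Set X}
    (w : J → X → Y) (h₀ : X → Y) {x : X} (hx : ∀ j, x ∉ U j) : glue U w h₀ x = h₀ x := by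
  rw [glue, dif_neg (by push Not; exact hx)]

theorem nullMeasurable_glue {J X Y : Type*} [Countable J] [MeasurableSpace X] [MeasurableSpace Y]
    {μ : Measure X} {U : J → Set X} (hU : Pairwise (fun i j => Disjoint (U i) (U j)))
    (hUm : ∀ j, MeasurableSet (U j)) {w : J → X → Y} {h₀ : X → Y}
    (hw : ∀ j, NullMeasurable (w j) μ) (hh : NullMeasurable h₀ μ) :
    NullMeasurable (glue U w h₀) μ := by
  intro s hs
  have : glue U w h₀ ⁻¹' s = (⋃ j, (U j ∩ w j ⁻¹' s)) ∪ ((⋃ j, U j)ᶜ ∩ h₀ ⁻¹' s) := by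
    ext x
    by_cases hx : ∃ j, x ∈ U j
    · obtain ⟨j, hj⟩ := hx
      simp only [mem_preimage, glue_of_mem hU w h₀ hj, mem_union, mem_iUnion, mem_inter_iff,
        mem_compl_iff]
      constructor
      · exact fun h => Or.inl ⟨j, hj, h⟩
      · rintro (⟨i, hi, h⟩ | ⟨h, -⟩)
        · by_cases hij : i = j
          · exact hij ▸ h
          · exact absurd hj (Set.disjoint_left.1 (hU hij) hi)
        · exact absurd ⟨j, hj⟩ h
    · push Not at hx
      simp [glue_of_notMem w h₀ hx, hx]
  rw [this]
  exact (NullMeasurableSet.iUnion fun j => (hUm j).nullMeasurableSet.inter (hw j hs)).union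
    ((MeasurableSet.iUnion hUm).compl.nullMeasurableSet.inter (hh hs))

/-- The closed balls of centres `c j` and radii `ρ j` are disjoint and lie in the unit ball. -/
structure DisjointBalls {m : ℕ} {J : Type} (c : J → EuclideanSpace ℝ (Fin m)) (ρ : J → ℝ) :
    Prop where
  pos : ∀ j, 0 < ρ j
  subset : ∀ j, Metric.closedBall (c j) (ρ j) ⊆ Metric.ball 0 1
  disjoint : Pairwise fun i j =>
    Disjoint (Metric.closedBall (c i) (ρ i)) (Metric.closedBall (c j) (ρ j))

theorem DisjointBalls.disjoint_ball {m : ℕ} {J : Type} {c : J → EuclideanSpace ℝ (Fin m)}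
    {ρ : J → ℝ} (h : DisjointBalls c ρ) : Pairwise fun i j =>
    Disjoint (Metric.ball (c i) (ρ i)) (Metric.ball (c j) (ρ j)) :=
  fun _ _ hij => (h.disjoint hij).mono Metric.ball_subset_closedBall Metric.ball_subset_closedBall

/-- The map equal to `w j` on the ball `B (c j, ρ j)` and to `h₀` off these balls. -/
noncomputable abbrev glueBalls {m : ℕ} {N : Type*} {J : Type} (c : J → EuclideanSpace ℝ (Fin m))
    (ρ : J → ℝ) (w : J → EuclideanSpace ℝ (Fin m) → N) (h₀ : EuclideanSpace ℝ (Fin m) → N) :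
    EuclideanSpace ℝ (Fin m) → N :=
  glue (fun j => Metric.ball (c j) (ρ j)) w h₀

/-- What the uniform boundedness argument needs from an energy of maps defined on `ℝ^m`: it
scales with exponent `α`, it vanishes at constants, and it is subadditive up to a factor when maps
are glued along disjoint balls on the boundaries of which they are locally constant. -/
structure IsGluingEnergy {m : ℕ} {N : Type*} [MeasurableSpace N] (α : ℝ)
    (𝓔 : (EuclideanSpace ℝ (Fin m) → N) → ℝ≥0∞) : Prop where
  scale : ∀ w, NullMeasurable w volume → ∀ t : ℝ, 0 < t → ∀ h,
    𝓔 (fun x => w (t⁻¹ • (x - h))) ≤ ENNReal.ofReal (t ^ α) * 𝓔 w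
  const : ∀ b, 𝓔 (fun _ => b) = 0
  glue : ∃ C : ℝ≥0, 1 ≤ C ∧ ∀ {J : Type} [Countable J] (c : J → EuclideanSpace ℝ (Fin m))
      (ρ : J → ℝ),
    DisjointBalls c ρ → ∀ (w : J → EuclideanSpace ℝ (Fin m) → N) (h₀ : EuclideanSpace ℝ (Fin m) → N)
      (b : J → N), (∀ j, NullMeasurable (w j) volume) → NullMeasurable h₀ volume →
      (∀ j, ∀ x ∉ Metric.ball (c j) (ρ j), w j x = b j) →
      (∀ j, ∀ x ∈ Metric.ball (c j) (ρ j), h₀ x = b j) →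
      𝓔 (glueBalls c ρ w h₀) ≤ C * (𝓔 h₀ + ∑' j, 𝓔 (w j))

/-! ### Packing many rescaled copies of a map into a ball -/

theorem exists_packing_pos {m : ℕ} (hm : 0 < m) {α : ℝ} (hα : 0 < α) (hαm : α < m) {e η τ : ℝ}
    (he : 0 < e) (hη : 0 < η) (hτ : 0 < τ) :
    ∃ (q : ℕ) (t : ℝ), 1 ≤ q ∧ 0 < t ∧ q * t ≤ τ ∧ (q : ℝ) ^ m * t ^ α * e = η := by
  have hm' : (0 : ℝ) < m := by exact_mod_cast hm
  have hlim : Filter.Tendsto (fun q : ℕ => (η / e) ^ (1 / α) * (q : ℝ) ^ (-(m / α - 1)))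
      Filter.atTop (nhds 0) := by
    have h1 : 0 < m / α - 1 := by
      rw [sub_pos, lt_div_iff₀ hα]; linarith
    simpa using ((tendsto_rpow_neg_atTop h1).comp tendsto_natCast_atTop_atTop).const_mul
      ((η / e) ^ (1 / α))
  obtain ⟨q, hq1, hq⟩ := ((Filter.eventually_ge_atTop 1).and
    (hlim.eventually (gt_mem_nhds hτ))).exists
  have hq0 : (0 : ℝ) < q := by exact_mod_cast hq1
  refine ⟨q, (η / e) ^ (1 / α) * (q : ℝ) ^ (-(m / α)), hq1, by positivity, ?_, ?_⟩
  · refine le_of_eq_of_le ?_ hq.le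
    have : (q : ℝ) ^ (-(m / α - 1)) = q * (q : ℝ) ^ (-(m / α)) := by
      rw [show -(m / α - 1) = 1 + -(m / α) by ring, Real.rpow_add hq0, Real.rpow_one]
    rw [this]; ring
  · rw [Real.mul_rpow (by positivity) (by positivity), ← Real.rpow_mul (by positivity),
      ← Real.rpow_mul hq0.le, one_div_mul_cancel hα.ne', Real.rpow_one, neg_mul,
      div_mul_cancel₀ _ hα.ne', Real.rpow_neg hq0.le, Real.rpow_natCast]
    field_simp

theorem exists_packing_zero {m : ℕ} (hm : 0 < m) {e η τ : ℝ}
    (he : 0 < e) (hη : 0 < η) (hτ : 0 < τ) (hle : e ≤ η) :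
    ∃ (q : ℕ) (t : ℝ), 1 ≤ q ∧ 0 < t ∧ q * t ≤ τ ∧ (q : ℝ) ^ m * e ≤ η ∧
      η ≤ 2 ^ m * ((q : ℝ) ^ m * e) := by
  have hm' : (0 : ℝ) < m := by exact_mod_cast hm
  set X : ℝ := (η / e) ^ (1 / (m : ℝ)) with hX
  have hX1 : 1 ≤ X := Real.one_le_rpow ((one_le_div he).2 hle) (by positivity)
  have hXm : X ^ m = η / e := by
    rw [hX, one_div, Real.rpow_inv_natCast_pow (by positivity) hm.ne']
  have hq1 : 1 ≤ ⌊X⌋₊ := Nat.le_floor (by exact_mod_cast hX1)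
  have hqX : (⌊X⌋₊ : ℝ) ≤ X := Nat.floor_le (by linarith)
  have hXq : X < ⌊X⌋₊ + 1 := Nat.lt_floor_add_one X
  have hq1' : (1 : ℝ) ≤ ⌊X⌋₊ := by exact_mod_cast hq1
  refine ⟨⌊X⌋₊, τ / ⌊X⌋₊, hq1, by positivity, by field_simp; exact le_rfl, ?_, ?_⟩
  · rw [← le_div_iff₀ he, ← hXm]
    gcongr
  · rw [← mul_assoc, ← div_le_iff₀ he, ← hXm, ← mul_pow]
    gcongr
    linarith

theorem exists_packing_neg {α : ℝ} (hα : α < 0) {e η τ : ℝ}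
    (he : 0 < e) (hη : 0 < η) (hτ : 0 < τ) (hle : e ≤ η * τ ^ (-α)) :
    ∃ t : ℝ, 0 < t ∧ t ≤ τ ∧ t ^ α * e = η := by
  refine ⟨(η / e) ^ (1 / α), by positivity, ?_, ?_⟩
  · have : τ = (τ ^ α) ^ (1 / α) := by
      rw [← Real.rpow_mul hτ.le, mul_one_div_cancel hα.ne, Real.rpow_one]
    rw [this]
    refine Real.rpow_le_rpow_of_nonpos (by positivity) ?_
        (by rw [one_div]; exact (inv_lt_zero.2 hα).le)
    rw [le_div_iff₀ he]
    calc τ ^ α * e ≤ τ ^ α * (η * τ ^ (-α)) := by gcongr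
      _ = η := by rw [Real.rpow_neg hτ.le]; field_simp
  · rw [← Real.rpow_mul (by positivity), one_div_mul_cancel hα.ne, Real.rpow_one]
    field_simp

/-- Numbers `q` and `t` such that `q ^ m` copies at scale `t` of a map of energy `e` fit into a
ball of radius comparable to `τ` and have total energy comparable to `η`. -/
theorem exists_packing {m : ℕ} (hm : 0 < m) {α : ℝ} (hαm : α < m) {e η τ : ℝ}
    (he : 0 < e) (hη : 0 < η) (hτ : 0 < τ) (h0 : α = 0 → e ≤ η) (hneg : α < 0 → e ≤ η * τ ^ (-α)) :
    ∃ (q : ℕ) (t : ℝ), 1 ≤ q ∧ 0 < t ∧ q * t ≤ τ ∧ (q : ℝ) ^ m * t ^ α * e ≤ η ∧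
      η ≤ 2 ^ m * ((q : ℝ) ^ m * t ^ α * e) := by
  have h2 : (1 : ℝ) ≤ 2 ^ m := one_le_pow₀ (by norm_num)
  rcases lt_trichotomy α 0 with hα | rfl | hα
  · obtain ⟨t, ht, htτ, h⟩ := exists_packing_neg hα he hη hτ (hneg hα)
    refine ⟨1, t, le_rfl, ht, by simpa using htτ, by simpa using h.le, ?_⟩
    simp only [Nat.cast_one, one_pow, one_mul, h]
    nlinarith
  · obtain ⟨q, t, hq, ht, hqt, h, h'⟩ := exists_packing_zero hm he hη hτ (h0 rfl)
    exact ⟨q, t, hq, ht, hqt, by simpa using h, by simpa using h'⟩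
  · obtain ⟨q, t, hq, ht, hqt, h⟩ := exists_packing_pos hm hα hαm he hη hτ
    refine ⟨q, t, hq, ht, hqt, h.le, ?_⟩
    rw [h]; nlinarith

/-- The point `δ k` of the grid of mesh `δ`. -/
noncomputable def gridPoint {m : ℕ} (q : ℕ) (δ : ℝ) (k : Fin m → Fin q) :
    EuclideanSpace ℝ (Fin m) :=
  WithLp.toLp 2 fun i => δ * (k i : ℕ)

theorem norm_gridPoint_le {m q : ℕ} {δ : ℝ} (hδ : 0 ≤ δ) (k : Fin m → Fin q) :
    ‖gridPoint q δ k‖ ≤ m * q * δ := by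
  have hsum : gridPoint q δ k = ∑ i, EuclideanSpace.single i (δ * (k i : ℕ)) := by
    ext j
    simp [gridPoint, Finset.sum_apply, Pi.single_apply]
  rw [hsum]
  refine (norm_sum_le _ _).trans ?_
  calc ∑ i, ‖EuclideanSpace.single i (δ * ((k i : ℕ) : ℝ))‖ ≤ ∑ _i : Fin m, q * δ := by
        refine Finset.sum_le_sum fun i _ => ?_
        rw [PiLp.norm_single, Real.norm_of_nonneg (by positivity), mul_comm]
        have : ((k i : ℕ) : ℝ) ≤ q := by exact_mod_cast (k i).2.le
        gcongr
    _ = m * q * δ := by simp; ring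

theorem le_dist_gridPoint {m q : ℕ} {δ : ℝ} (hδ : 0 ≤ δ) {k l : Fin m → Fin q} (hkl : k ≠ l) :
    δ ≤ dist (gridPoint q δ k) (gridPoint q δ l) := by
  obtain ⟨i, hi⟩ := Function.ne_iff.1 hkl
  have h1 : ‖(gridPoint q δ k - gridPoint q δ l) i‖ ≤ ‖gridPoint q δ k - gridPoint q δ l‖ :=
    PiLp.norm_apply_le _ i
  rw [dist_eq_norm]
  refine le_trans ?_ h1
  have h2 : (1 : ℝ) ≤ |((k i : ℕ) : ℝ) - ((l i : ℕ) : ℝ)| := by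
    have : (1 : ℤ) ≤ |((k i : ℕ) : ℤ) - ((l i : ℕ) : ℤ)| := by
      apply Int.one_le_abs
      rw [sub_ne_zero]
      exact_mod_cast fun h => hi (Fin.ext h)
    exact_mod_cast this
  simp only [gridPoint, PiLp.sub_apply, ← mul_sub, norm_mul, Real.norm_eq_abs, abs_of_nonneg hδ]
  nlinarith

theorem disjointBalls_gridPoint {m q : ℕ} (hm : 0 < m) (hq : 1 ≤ q) {r t : ℝ} (ht : 0 < t)
    (hr : r ≤ 1) (hqt : q * t ≤ r / (16 * m)) :
    DisjointBalls (gridPoint (m := m) q (r / (2 * m * q))) (fun _ => 2 * t) ∧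
    ∀ k : Fin m → Fin q,
      Metric.ball (gridPoint q (r / (2 * m * q)) k) (2 * t) ⊆ Metric.ball 0 r := by
  have hm' : (1 : ℝ) ≤ m := by exact_mod_cast hm
  have hq' : (1 : ℝ) ≤ q := by exact_mod_cast hq
  rw [le_div_iff₀ (by positivity)] at hqt
  have hr0 : 0 < r := lt_of_lt_of_le (by positivity) hqt
  have hδ : 0 ≤ r / (2 * m * q) := by positivity
  have hn : ∀ k : Fin m → Fin q, ‖gridPoint q (r / (2 * m * q)) k‖ ≤ r / 2 := fun k => by
    refine (norm_gridPoint_le hδ k).trans (le_of_eq ?_)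
    field_simp
  have ht8 : 16 * t ≤ r := by
    have : 1 * t * (16 * 1) ≤ q * t * (16 * m) := by gcongr
    linarith
  have hin : ∀ k : Fin m → Fin q, Metric.closedBall (gridPoint q (r / (2 * m * q)) k) (2 * t) ⊆
      Metric.ball 0 r := fun k => by
    refine Metric.closedBall_subset_ball' ?_
    rw [dist_zero_right]
    linarith [hn k]
  refine ⟨⟨fun _ => by positivity, fun k => (hin k).trans (Metric.ball_subset_ball hr), ?_⟩,
    fun k => Metric.ball_subset_closedBall.trans (hin k)⟩
  intro k l hkl
  refine Metric.closedBall_disjoint_closedBall (lt_of_lt_of_le ?_ (le_dist_gridPoint hδ hkl))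
  rw [lt_div_iff₀ (by positivity)]
  nlinarith

/-! ### Elementary properties of energies -/

namespace MapEnergy

variable {m : ℕ} {N : Type*} [MeasurableSpace N] {G : MapEnergy m N}

theorem restr_congr {u v : EuclideanSpace ℝ (Fin m) → N} {A : Set (EuclideanSpace ℝ (Fin m))}
    (h : EqOn u v A) : G.restr u A = G.restr v A := by
  unfold restr
  congr 1
  ext x
  exact h x.2

theorem restr_mono {u : EuclideanSpace ℝ (Fin m) → N} (hu : NullMeasurable u volume)
    {A B : Set (EuclideanSpace ℝ (Fin m))} (hA : IsOpen A) (hB : IsOpen B) (hAB : A ⊆ B) :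
    G.restr u A ≤ G.restr u B := by
  have hq : Measure.QuasiMeasurePreserving (Subtype.val : B → EuclideanSpace ℝ (Fin m)) :=
    ⟨measurable_subtype_coe, by
      rw [show (volume : Measure B) = Measure.comap Subtype.val volume from rfl,
        map_comap_subtype_coe hB.measurableSet]
      exact Measure.absolutelyContinuous_of_le Measure.restrict_le_self⟩
  exact G.mono' A B hA hB hAB (fun x => u x) (hu.comp_quasiMeasurePreserving hq)

theorem Superadditive.sum_le (hG : G.Superadditive) {u : EuclideanSpace ℝ (Fin m) → N}
    (hu : NullMeasurable u volume) {J : Type*} {U : J → Set (EuclideanSpace ℝ (Fin m))}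
    (hU : ∀ j, IsOpen (U j)) (hd : Pairwise fun i j => Disjoint (closure (U i)) (closure (U j)))
    (s : Finset J) : ∑ j ∈ s, G.restr u (U j) ≤ G.restr u (⋃ j ∈ s, U j) := by
  classical
  induction s using Finset.induction_on with
  | empty => simp
  | insert a s ha ih =>
    rw [Finset.sum_insert ha, Finset.set_biUnion_insert]
    refine (add_le_add le_rfl ih).trans (hG u hu _ _ (hU a) (isOpen_biUnion fun j _ => hU j) ?_)
    rw [s.closure_biUnion, ← Set.disjoint_iff_inter_eq_empty, Set.disjoint_iUnion₂_right]
    exact fun j hj => hd fun h => ha (h ▸ hj)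

theorem ScalesWith.restr_ball {α : ℝ} (hG : G.ScalesWith α) {u : EuclideanSpace ℝ (Fin m) → N}
    (hu : NullMeasurable u volume) {t : ℝ} (ht : 0 < t) (h : EuclideanSpace ℝ (Fin m)) :
    G.restr u (Metric.ball h t)
      = ENNReal.ofReal (t ^ α) * G.restr (fun x => u (h + t • x)) (Metric.ball 0 1) := by
  rw [← hG u hu t ht h _ Metric.isOpen_ball]
  congr 1
  ext x
  simp only [mem_image, Metric.mem_ball, dist_eq_norm, sub_zero]
  constructor
  · intro hx
    refine ⟨t⁻¹ • (x - h), ?_, ?_⟩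
    · rw [norm_smul, norm_inv, Real.norm_of_nonneg ht.le, inv_mul_lt_iff₀ ht, mul_one]
      exact hx
    · rw [smul_inv_smul₀ ht.ne', add_sub_cancel]
  · rintro ⟨y, hy, rfl⟩
    rw [add_sub_cancel_left, norm_smul, Real.norm_of_nonneg ht.le]
    nlinarith

end MapEnergy

theorem nullMeasurable_comp_rescale {m : ℕ} {N : Type*} [MeasurableSpace N]
    {w : EuclideanSpace ℝ (Fin m) → N} (hw : NullMeasurable w volume) {t : ℝ} (ht : 0 < t)
    (h : EuclideanSpace ℝ (Fin m)) : NullMeasurable (fun x => w (t⁻¹ • (x - h))) volume := by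
  refine hw.comp_quasiMeasurePreserving (f := fun x => t⁻¹ • (x - h)) ?_
  exact (Measure.quasiMeasurePreserving_smul _ (inv_ne_zero ht.ne')).comp
    (measurePreserving_sub_right volume h).quasiMeasurePreserving

theorem rescale_eq_of_notMem {m : ℕ} {N : Type*} {w : EuclideanSpace ℝ (Fin m) → N} {b : N} {R : ℝ}
    (hw : ∀ x ∉ Metric.ball 0 R, w x = b) {t : ℝ} (ht : 0 < t)
    (h : EuclideanSpace ℝ (Fin m)) : ∀ x ∉ Metric.ball h (R * t), w (t⁻¹ • (x - h)) = b := by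
  intro x hx
  refine hw _ fun hx' => hx ?_
  rw [mem_ball_zero_iff, norm_smul, norm_inv, Real.norm_of_nonneg ht.le, inv_mul_lt_iff₀ ht] at hx'
  rwa [Metric.mem_ball, dist_eq_norm, mul_comm]

/-! ### The uniform boundedness argument -/

section

variable {m : ℕ} {N : Type*} [MeasurableSpace N] {G : MapEnergy m N} {α : ℝ}
  {𝓔 : (EuclideanSpace ℝ (Fin m) → N) → ℝ≥0∞}

/-- Many copies of `v` at scale `t` are inserted into the ball `B (0, r)`, on which `w₀` is
constant. By superadditivity the values of `G` at the copies add up. -/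
theorem exists_packed_map (hm : 0 < m) (h𝓔 : IsGluingEnergy α 𝓔) (hsuper : G.Superadditive)
    (hscale : G.ScalesWith α) : ∃ C : ℝ≥0, 1 ≤ C ∧
    ∀ (v w₀ : EuclideanSpace ℝ (Fin m) → N) (b : N) (e r t : ℝ) (q : ℕ),
      NullMeasurable v volume → NullMeasurable w₀ volume → (∀ x ∉ Metric.ball 0 2, v x = b) →
      (∀ x ∈ Metric.ball 0 r, w₀ x = b) → 𝓔 v ≤ ENNReal.ofReal e → r ≤ 1 → 1 ≤ q → 0 < t →
      q * t ≤ r / (16 * m) → ∃ h, NullMeasurable h volume ∧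
        (∀ x ∉ Metric.ball 0 r, h x = w₀ x) ∧
        𝓔 h ≤ C * (𝓔 w₀ + ENNReal.ofReal ((q : ℝ) ^ m * t ^ α * e)) ∧
        ENNReal.ofReal ((q : ℝ) ^ m * t ^ α) * G.restr v (Metric.ball 0 1)
          ≤ G.restr h (Metric.ball 0 1) := by
  obtain ⟨C, hC1, hC⟩ := h𝓔.glue
  refine ⟨C, hC1, fun v w₀ b e r t q hv hw₀ hvb hw₀b he hr hq ht hqt => ?_⟩
  obtain ⟨hballs, hsub⟩ := disjointBalls_gridPoint hm hq ht hr hqt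
  set c : (Fin m → Fin q) → EuclideanSpace ℝ (Fin m) := gridPoint q (r / (2 * m * q)) with hc
  set w : (Fin m → Fin q) → EuclideanSpace ℝ (Fin m) → N :=
      fun k x => v (t⁻¹ • (x - c k)) with hwdef
  have hw : ∀ k, NullMeasurable (w k) volume := fun k => nullMeasurable_comp_rescale hv ht _
  set h := glueBalls c (fun _ => 2 * t) w w₀ with hh
  have hhm : NullMeasurable h volume :=
    nullMeasurable_glue hballs.disjoint_ball (fun _ => measurableSet_ball) hw hw₀
  have hqm : (Fintype.card (Fin m → Fin q) : ℝ) = (q : ℝ) ^ m := by simp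
  refine ⟨h, hhm, fun x hx => glue_of_notMem _ _ fun k hk => hx (hsub k hk), ?_, ?_⟩
  · refine (hC c _ hballs w w₀ (fun _ => b) hw hw₀ (fun k => rescale_eq_of_notMem hvb ht (c k))
      fun k x hx => hw₀b x (hsub k hx)).trans ?_
    gcongr
    rw [tsum_fintype]
    calc ∑ k, 𝓔 (w k) ≤ ∑ _k : Fin m → Fin q, ENNReal.ofReal (t ^ α) * ENNReal.ofReal e :=
          Finset.sum_le_sum fun k _ => (h𝓔.scale v hv t ht _).trans (by gcongr)
      _ = ENNReal.ofReal ((q : ℝ) ^ m * t ^ α * e) := by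
          rw [Finset.sum_const, Finset.card_univ, nsmul_eq_mul, mul_assoc,
            ENNReal.ofReal_mul (by positivity), ENNReal.ofReal_mul (by positivity), ← hqm,
            ENNReal.ofReal_natCast]
  · have hopen : ∀ k, IsOpen (Metric.ball (c k) t) := fun k => Metric.isOpen_ball
    have hsub1 : ∀ k, Metric.ball (c k) t ⊆ Metric.ball (c k) (2 * t) := fun k =>
      Metric.ball_subset_ball (by linarith)
    have hsum := hsuper.sum_le hhm (U := fun k => Metric.ball (c k) t) hopen (fun k l hkl =>
      (hballs.disjoint hkl).mono
        (Metric.closure_ball_subset_closedBall.trans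
            (Metric.closedBall_subset_closedBall (by linarith)))
        (Metric.closure_ball_subset_closedBall.trans
            (Metric.closedBall_subset_closedBall (by linarith))))
      Finset.univ
    refine le_trans (le_of_eq ?_) (hsum.trans (MapEnergy.restr_mono hhm
      (isOpen_biUnion fun k _ => hopen k) Metric.isOpen_ball (iUnion₂_subset fun k _ =>
        (hsub1 k).trans ((hsub k).trans (Metric.ball_subset_ball hr)))))
    have hk : ∀ k, G.restr h (Metric.ball (c k) t)
        = ENNReal.ofReal (t ^ α) * G.restr v (Metric.ball 0 1) := fun k => by
      rw [hscale.restr_ball hhm ht]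
      congr 1
      refine MapEnergy.restr_congr fun x hx => ?_
      rw [hh, glueBalls, glue_of_mem hballs.disjoint_ball (j := k)]
      · simp only [hwdef, add_sub_cancel_left, inv_smul_smul₀ ht.ne']
      · rw [Metric.mem_ball, dist_eq_norm, add_sub_cancel_left, norm_smul,
          Real.norm_of_nonneg ht.le]
        rw [mem_ball_zero_iff] at hx
        nlinarith
    rw [Finset.sum_congr rfl fun k _ => hk k, Finset.sum_const, Finset.card_univ, nsmul_eq_mul,
      ← mul_assoc, ENNReal.ofReal_mul (by positivity), ← hqm, ENNReal.ofReal_natCast]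

/-- The centre `2⁻⁽ʲ⁺¹⁾ e` of the `j`-th ball of a sequence of disjoint balls shrinking to `0`. -/
noncomputable def dyadicCenter {m : ℕ} (i : Fin m) (j : ℕ) : EuclideanSpace ℝ (Fin m) :=
  EuclideanSpace.single i ((1 / 2 : ℝ) ^ (j + 1))

theorem disjointBalls_dyadicCenter {m : ℕ} (i : Fin m) :
    DisjointBalls (dyadicCenter i) (fun j => (1 / 2 : ℝ) ^ (j + 4)) := by
  have hle : ∀ {j k : ℕ}, j < k → (1 / 2 : ℝ) ^ k ≤ (1 / 2 : ℝ) ^ j / 2 := fun {j k} h => by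
    calc (1 / 2 : ℝ) ^ k ≤ (1 / 2 : ℝ) ^ (j + 1) :=
          pow_le_pow_of_le_one (by norm_num) (by norm_num) h
      _ = (1 / 2 : ℝ) ^ j / 2 := by rw [pow_succ]; ring
  have key : ∀ {j k : ℕ}, j < k → Disjoint
      (Metric.closedBall (dyadicCenter i j) ((1 / 2 : ℝ) ^ (j + 4)))
      (Metric.closedBall (dyadicCenter i k) ((1 / 2 : ℝ) ^ (k + 4))) := fun {j k} h => by
    refine Metric.closedBall_disjoint_closedBall ?_
    have hd : dist (dyadicCenter i j) (dyadicCenter i k)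
        = |(1 / 2 : ℝ) ^ (j + 1) - (1 / 2 : ℝ) ^ (k + 1)| := by
      rw [dyadicCenter, dyadicCenter, PiLp.dist_single_same, Real.dist_eq]
    rw [hd]
    refine lt_of_lt_of_le ?_ (le_abs_self _)
    have := hle h
    have h0 : (0 : ℝ) < (1 / 2) ^ j := by positivity
    rw [pow_add, pow_add _ k, pow_succ _ j, pow_succ _ k]
    norm_num
    nlinarith
  refine ⟨fun j => by positivity, fun j => Metric.closedBall_subset_ball' ?_, fun j k hjk => ?_⟩
  · have : (1 / 2 : ℝ) ^ j ≤ 1 := pow_le_one₀ (by norm_num) (by norm_num)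
    rw [dist_zero_right, dyadicCenter, PiLp.norm_single, norm_pow, pow_add, pow_add _ j 1]
    norm_num
    linarith
  · rcases lt_or_gt_of_ne hjk with h | h
    · exact key h
    · exact (key h).symm

/-- Concentrating maps along a sequence of disjoint balls yields a map of finite energy at which
`G` is infinite. -/
theorem exists_finite_energy_restr_eq_top (hm : 0 < m) (h𝓔 : IsGluingEnergy α 𝓔)
    (hscale : G.ScalesWith α) {b : N}
    (hconc : ∀ η : ℝ, 0 < η → ∀ M : ℝ, ∃ w : EuclideanSpace ℝ (Fin m) → N,
      NullMeasurable w volume ∧ (∀ x ∉ Metric.ball 0 1, w x = b) ∧ 𝓔 w ≤ ENNReal.ofReal η ∧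
      ENNReal.ofReal M ≤ G.restr w (Metric.ball 0 1)) :
    ∃ w : EuclideanSpace ℝ (Fin m) → N, NullMeasurable w volume ∧ 𝓔 w < ⊤ ∧
      G.restr w (Metric.ball 0 1) = ⊤ := by
  obtain ⟨C, -, hC⟩ := h𝓔.glue
  set ρ : ℕ → ℝ := fun j => (1 / 2 : ℝ) ^ (j + 4) with hρ
  have hρ0 : ∀ j, 0 < ρ j := fun j => by positivity
  have hρα : ∀ j, 0 < ρ j ^ α := fun j => Real.rpow_pos_of_pos (hρ0 j) _
  choose w hwm hwb hwE hwG using fun j : ℕ =>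
    hconc ((ρ j ^ α)⁻¹ * (1 / 2) ^ j) (by have := hρα j; positivity) ((ρ j ^ α)⁻¹ * j)
  set c := dyadicCenter (⟨0, hm⟩ : Fin m) with hc
  have hballs : DisjointBalls c ρ := disjointBalls_dyadicCenter _
  set h := glueBalls c ρ (fun j x => w j ((ρ j)⁻¹ • (x - c j))) (fun _ => b) with hh
  have hw' := fun j => nullMeasurable_comp_rescale (hwm j) (hρ0 j) (c j)
  have hcm : NullMeasurable (fun _ : EuclideanSpace ℝ (Fin m) => b) volume :=
    measurable_const.nullMeasurable
  have hhm : NullMeasurable h volume :=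
    nullMeasurable_glue hballs.disjoint_ball (fun _ => measurableSet_ball) hw' hcm
  refine ⟨h, hhm, ?_, ?_⟩
  · have h1 := hC c ρ hballs (fun j x => w j ((ρ j)⁻¹ • (x - c j))) (fun _ => b)
      (fun _ => b) hw' hcm
      (fun j => by simpa using rescale_eq_of_notMem (hwb j) (hρ0 j) (c j)) (fun _ _ _ => rfl)
    refine lt_of_le_of_lt h1 (ENNReal.mul_lt_top ENNReal.coe_lt_top ?_)
    rw [h𝓔.const, zero_add]
    refine lt_of_le_of_lt (ENNReal.tsum_le_tsum (g := fun j => ENNReal.ofReal ((1 / 2) ^ j))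
      fun j => ?_) ?_
    · refine (h𝓔.scale _ (hwm j) _ (hρ0 j) _).trans ((mul_le_mul_right (hwE j) _).trans_eq ?_)
      rw [← ENNReal.ofReal_mul (hρα j).le, mul_inv_cancel_left₀ (hρα j).ne']
    · rw [← ENNReal.ofReal_tsum_of_nonneg (fun _ => by positivity) summable_geometric_two]
      exact ENNReal.ofReal_lt_top
  · refine ENNReal.eq_top_of_forall_nnreal_le fun M => ?_
    obtain ⟨j, hj⟩ := exists_nat_ge M
    calc (M : ℝ≥0∞) ≤ (j : ℝ≥0∞) := by exact_mod_cast hj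
      _ = ENNReal.ofReal (ρ j ^ α) * ENNReal.ofReal ((ρ j ^ α)⁻¹ * j) := by
          rw [← ENNReal.ofReal_mul (hρα j).le, mul_inv_cancel_left₀ (hρα j).ne',
            ENNReal.ofReal_natCast]
      _ ≤ ENNReal.ofReal (ρ j ^ α) * G.restr (fun x => h (c j + ρ j • x)) (Metric.ball 0 1) := by
          refine mul_le_mul_right ((hwG j).trans_eq (MapEnergy.restr_congr fun x hx => ?_)) _
          rw [hh, glueBalls, glue_of_mem hballs.disjoint_ball (j := j)]
          · simp only [add_sub_cancel_left, inv_smul_smul₀ (hρ0 j).ne']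
          · rw [Metric.mem_ball, dist_eq_norm, add_sub_cancel_left, norm_smul,
              Real.norm_of_nonneg (hρ0 j).le]
            rw [mem_ball_zero_iff] at hx
            nlinarith [hρ0 j]
      _ = G.restr h (Metric.ball (c j) (ρ j)) := (hscale.restr_ball hhm (hρ0 j) _).symm
      _ ≤ G.restr h (Metric.ball 0 1) := MapEnergy.restr_mono hhm Metric.isOpen_ball
          Metric.isOpen_ball (Metric.ball_subset_closedBall.trans (hballs.subset j))

/-- The uniform boundedness principle, for an energy `E` of maps defined on the unit ball that is
dominated by a gluing energy `𝓔` of maps defined on `ℝ^m`, under two assumptions: maps of the ball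
extend to maps that are constant outside a ball, with control of the energy (`hext`), and these
constants can be connected to a fixed one at a small cost (`htrans`). -/
theorem uniform_boundedness_of_gluing (hm : 0 < m) (hα : α < m) (h𝓔 : IsGluingEnergy α 𝓔)
    (hsuper : G.Superadditive) (hscale : G.ScalesWith α)
    (E : (Metric.ball (0 : EuclideanSpace ℝ (Fin m)) 1 → N) → ℝ≥0∞)
    (hE : ∀ w : EuclideanSpace ℝ (Fin m) → N, NullMeasurable w volume → E (fun x => w x) ≤ 𝓔 w)
    (hext : ∃ C : ℝ≥0, ∀ u : Metric.ball (0 : EuclideanSpace ℝ (Fin m)) 1 → N,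
      NullMeasurable u volume → E u ≠ 0 → E u ≠ ⊤ → ∃ (v : EuclideanSpace ℝ (Fin m) → N) (b : N),
        NullMeasurable v volume ∧ (∀ x : Metric.ball (0 : EuclideanSpace ℝ (Fin m)) 1, v x = u x) ∧
        (∀ x ∉ Metric.ball 0 2, v x = b) ∧ 𝓔 v ≤ C * E u)
    (htrans : ∀ b : ℕ → N, ∃ b' : N, ∀ η : ℝ, 0 < η → ∃ᶠ n in Filter.atTop, ∃ r : ℝ, 0 < r ∧ r ≤ 1 ∧
      (α < 0 → r = 1 / 2) ∧ ∃ w : EuclideanSpace ℝ (Fin m) → N, NullMeasurable w volume ∧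
        (∀ x ∈ Metric.ball 0 r, w x = b n) ∧ (∀ x ∉ Metric.ball 0 1, w x = b') ∧
        𝓔 w ≤ ENNReal.ofReal η)
    (hfin : ∀ u : Metric.ball (0 : EuclideanSpace ℝ (Fin m)) 1 → N, NullMeasurable u volume →
      E u < ⊤ → G.toFun (Metric.ball 0 1) u < ⊤)
    (hzero : ∀ u : Metric.ball (0 : EuclideanSpace ℝ (Fin m)) 1 → N, NullMeasurable u volume →
      E u = 0 → G.toFun (Metric.ball 0 1) u = 0) :
    ∃ C : ℝ≥0, ∀ u : Metric.ball (0 : EuclideanSpace ℝ (Fin m)) 1 → N, NullMeasurable u volume →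
      (0 < α ∨ E u ≤ (C : ℝ≥0∞)⁻¹) → G.toFun (Metric.ball 0 1) u ≤ C * E u := by
  by_contra! hcon
  -- the maps of a sequence along which the inequality fails, extended to `ℝ^m`
  choose u hum hsmall hlarge using fun n : ℕ => hcon ((n : ℝ≥0) + 1)
  have hE0 : ∀ n, E (u n) ≠ 0 := fun n h0 => by
    have := hlarge n
    rw [hzero _ (hum n) h0] at this
    exact not_lt_zero this
  have hEtop : ∀ n, E (u n) ≠ ⊤ := fun n htop => by
    have := hlarge n
    rw [htop, ENNReal.mul_top (by simp)] at this
    exact not_top_lt this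
  obtain ⟨C₁, hC₁⟩ := hext
  choose v b hvm hvu hvb hvE using fun n => hC₁ (u n) (hum n) (hE0 n) (hEtop n)
  obtain ⟨C₂, hC₂1, hC₂⟩ := exists_packed_map hm h𝓔 hsuper hscale
  obtain ⟨b', hb'⟩ := htrans b
  obtain ⟨w, hwm, hwE, hwG⟩ : ∃ w : EuclideanSpace ℝ (Fin m) → N, NullMeasurable w volume ∧
      𝓔 w < ⊤ ∧ G.restr w (Metric.ball 0 1) = ⊤ := by
    refine exists_finite_energy_restr_eq_top hm h𝓔 hscale (b := b') fun η hη M => ?_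
    -- half of the energy `η` is spent on the transition, half on the copies
    set η' : ℝ := η / (2 * C₂) with hη'
    have hC₂0 : (0 : ℝ) < C₂ := lt_of_lt_of_le one_pos (by exact_mod_cast hC₂1)
    have hη'0 : 0 < η' := by positivity
    set K : ℝ := C₁ + 1 with hK
    have hK0 : 0 < K := by positivity
    have hm' : (0 : ℝ) < m := by exact_mod_cast hm
    set τ₀ : ℝ := (1 / 2) / (16 * m) with hτ₀
    have hτ₀0 : 0 < τ₀ := by positivity
    have hτα : 0 < τ₀ ^ (-α) := Real.rpow_pos_of_pos hτ₀0 _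
    -- lower bounds for the index `n`
    obtain ⟨n, ⟨r, hr0, hr1, hr, w₀, hw₀m, hw₀b, hw₀b', hw₀E⟩, hnM, hn1, hn2⟩ :=
      ((hb' η' hη'0).and_eventually ((Filter.eventually_ge_atTop ⌈M * (2 ^ m * K / η')⌉₊).and
        ((Filter.eventually_ge_atTop ⌈K / η'⌉₊).and
          (Filter.eventually_ge_atTop ⌈K / (η' * τ₀ ^ (-α))⌉₊)))).exists
    have hnM := Nat.ceil_le.1 hnM
    have hn1 := Nat.ceil_le.1 hn1
    have hn2 := Nat.ceil_le.1 hn2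
    have hn0 : (0 : ℝ) < n := lt_of_lt_of_le (by positivity) hn1
    set ε : ℝ := (E (u n)).toReal with hε
    have hε0 : 0 < ε := ENNReal.toReal_pos (hE0 n) (hEtop n)
    have hεE : E (u n) = ENNReal.ofReal ε := (ENNReal.ofReal_toReal (hEtop n)).symm
    have hvε : 𝓔 (v n) ≤ ENNReal.ofReal (K * ε) := by
      refine (hvE n).trans ?_
      rw [hεE, ENNReal.ofReal_mul hK0.le]
      gcongr
      rw [← ENNReal.ofReal_coe_nnreal]
      exact ENNReal.ofReal_le_ofReal (by linarith)
    have hεn : α ≤ 0 → ε * n ≤ 1 := fun hα0 => by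
      have h1 := (hsmall n).resolve_left (not_lt.2 hα0)
      rw [hεE] at h1
      have h2 : ENNReal.ofReal ε ≤ ENNReal.ofReal ((n : ℝ) + 1)⁻¹ := by
        rw [ENNReal.ofReal_inv_of_pos (by positivity)]
        convert h1 using 2
        rw [← ENNReal.ofReal_coe_nnreal]; simp
      rw [ENNReal.ofReal_le_ofReal_iff (by positivity), le_inv_comm₀ hε0 (by positivity)] at h2
      rw [← le_div_iff₀' hε0, one_div]
      linarith
    have hbound : ∀ x : ℝ, 0 < x → K / x ≤ n → ε * n ≤ 1 → K * ε ≤ x := fun x hx h1 h2 => by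
      rw [div_le_iff₀ hx] at h1
      have : K * ε * n ≤ x * n := by
        calc K * ε * n = K * (ε * n) := by ring
          _ ≤ K * 1 := by gcongr
          _ ≤ x * n := by linarith
      exact le_of_mul_le_mul_right this hn0
    obtain ⟨q, t, hq, ht, hqt, hup, hlow⟩ := exists_packing hm hα (mul_pos hK0 hε0) hη'0
      (τ := r / (16 * m)) (by positivity) (fun h0 => hbound _ hη'0 hn1 (hεn h0.le))
      (fun hneg => by
        rw [hr hneg]
        exact hbound _ (by positivity) hn2 (hεn hneg.le))
    obtain ⟨h, hhm, hhw, hhE, hhG⟩ := hC₂ (v n) w₀ (b n) (K * ε) r t q (hvm n) hw₀m (hvb n) hw₀b hvε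
      hr1 hq ht hqt
    refine ⟨h, hhm, fun x hx => ?_, ?_, ?_⟩
    · rw [hhw x fun hx' => hx (Metric.ball_subset_ball hr1 hx'), hw₀b' x hx]
    · refine (hhE.trans (mul_le_mul_right (add_le_add hw₀E (ENNReal.ofReal_le_ofReal hup))
        _)).trans_eq ?_
      rw [← ENNReal.ofReal_add hη'0.le hη'0.le, ← ENNReal.ofReal_coe_nnreal,
        ← ENNReal.ofReal_mul (by positivity)]
      congr 1
      rw [hη']; field_simp; ring
    · refine le_trans ?_ hhG
      have hGv : ENNReal.ofReal (n * ε) ≤ G.restr (v n) (Metric.ball 0 1) := by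
        have h1 : G.restr (v n) (Metric.ball 0 1) = G.toFun (Metric.ball 0 1) (u n) := by
          unfold MapEnergy.restr
          congr 1
          ext x
          exact hvu n x
        rw [h1]
        refine le_trans ?_ (hlarge n).le
        rw [hεE, ENNReal.ofReal_mul (by positivity), ENNReal.ofReal_natCast]
        gcongr
        push_cast
        exact le_self_add
      refine le_trans ?_ (mul_le_mul_right hGv _)
      rw [← ENNReal.ofReal_mul (by positivity)]
      refine ENNReal.ofReal_le_ofReal ?_
      set Q := (q : ℝ) ^ m * t ^ α with hQ
      have hQ1 : η' / (2 ^ m * K) ≤ Q * ε := by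
        rw [div_le_iff₀ (by positivity)]
        linarith
      have hM : M ≤ n * (η' / (2 ^ m * K)) := by
        rwa [← div_le_iff₀ (by positivity), div_div_eq_mul_div, mul_div_assoc]
      calc M ≤ n * (η' / (2 ^ m * K)) := hM
        _ ≤ n * (Q * ε) := by gcongr
        _ = Q * (n * ε) := by ring
  have hq : Measure.QuasiMeasurePreserving
      (Subtype.val : Metric.ball (0 : EuclideanSpace ℝ (Fin m)) 1 → EuclideanSpace ℝ (Fin m)) :=
    ⟨measurable_subtype_coe, by
      rw [show (volume : Measure (Metric.ball (0 : EuclideanSpace ℝ (Fin m)) 1))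
          = Measure.comap Subtype.val volume from rfl,
        map_comap_subtype_coe measurableSet_ball]
      exact Measure.absolutelyContinuous_of_le Measure.restrict_le_self⟩
  exact (hfin _ (hwm.comp_quasiMeasurePreserving hq) ((hE w hwm).trans_lt hwE)).ne hwG

end

/-! ### Retraction of `ℝ^m` onto the unit ball -/

section Retraction

variable {m : ℕ}

/-- The function of `‖x‖` equal to `1` for `‖x‖ ≤ 1`, to `0` for `‖x‖ ≥ 3 / 2`, affine between. -/
noncomputable def ballCutoff (x : EuclideanSpace ℝ (Fin m)) : ℝ := max 0 (min 1 (3 - 2 * ‖x‖))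

/-- The map equal to the identity on the unit ball and to `a` outside the ball of radius `3 / 2`;
between, each half-line issued from `a` is folded back towards `a`. -/
noncomputable def foldToward (a x : EuclideanSpace ℝ (Fin m)) : EuclideanSpace ℝ (Fin m) :=
  a + ballCutoff x • (x - a)

theorem ballCutoff_nonneg (x : EuclideanSpace ℝ (Fin m)) : 0 ≤ ballCutoff x := le_max_left _ _

theorem ballCutoff_le_one (x : EuclideanSpace ℝ (Fin m)) : ballCutoff x ≤ 1 :=
  max_le zero_le_one (min_le_left _ _)

theorem ballCutoff_of_le {x : EuclideanSpace ℝ (Fin m)} (hx : ‖x‖ ≤ 1) : ballCutoff x = 1 := by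
  rw [ballCutoff, min_eq_left (by linarith), max_eq_right zero_le_one]

theorem ballCutoff_of_mid {x : EuclideanSpace ℝ (Fin m)} (hx : 1 ≤ ‖x‖) (hx' : ‖x‖ ≤ 3 / 2) :
    ballCutoff x = 3 - 2 * ‖x‖ := by
  rw [ballCutoff, min_eq_right (by linarith), max_eq_right (by linarith)]

theorem ballCutoff_of_ge {x : EuclideanSpace ℝ (Fin m)} (hx : 3 / 2 ≤ ‖x‖) : ballCutoff x = 0 := by
  rw [ballCutoff, min_eq_right (by linarith), max_eq_left (by linarith)]

theorem abs_ballCutoff_sub_le (x y : EuclideanSpace ℝ (Fin m)) :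
    |ballCutoff x - ballCutoff y| ≤ 2 * ‖x - y‖ := by
  have h1 : |ballCutoff x - ballCutoff y| ≤ |min 1 (3 - 2 * ‖x‖) - min 1 (3 - 2 * ‖y‖)| :=
    (abs_max_sub_max_le_max _ _ _ _).trans (by simp)
  have h2 : |min 1 (3 - 2 * ‖x‖) - min 1 (3 - 2 * ‖y‖)| ≤ |(3 - 2 * ‖x‖) - (3 - 2 * ‖y‖)| :=
    (abs_min_sub_min_le_max _ _ _ _).trans (by simp)
  have h3 : |(3 - 2 * ‖x‖) - (3 - 2 * ‖y‖)| = 2 * |‖x‖ - ‖y‖| := by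
    rw [show (3 - 2 * ‖x‖) - (3 - 2 * ‖y‖) = -2 * (‖x‖ - ‖y‖) by ring, abs_mul]
    norm_num
  linarith [abs_norm_sub_norm_le x y]

theorem continuous_ballCutoff : Continuous (ballCutoff (m := m)) := by
  unfold ballCutoff; fun_prop

theorem continuous_foldToward :
    Continuous fun z : EuclideanSpace ℝ (Fin m) × EuclideanSpace ℝ (Fin m) =>
      foldToward z.1 z.2 := by
  unfold foldToward
  have := continuous_ballCutoff (m := m)
  fun_prop

theorem foldToward_of_le (a : EuclideanSpace ℝ (Fin m)) {x : EuclideanSpace ℝ (Fin m)}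
    (hx : ‖x‖ ≤ 1) : foldToward a x = x := by
  rw [foldToward, ballCutoff_of_le hx, one_smul, add_sub_cancel]

theorem foldToward_of_ge (a : EuclideanSpace ℝ (Fin m)) {x : EuclideanSpace ℝ (Fin m)}
    (hx : 3 / 2 ≤ ‖x‖) : foldToward a x = a := by
  rw [foldToward, ballCutoff_of_ge hx, zero_smul, add_zero]

theorem foldToward_sub (a x y : EuclideanSpace ℝ (Fin m)) : foldToward a x - foldToward a y
    = ballCutoff x • (x - y) + (ballCutoff x - ballCutoff y) • (y - a) := by
  unfold foldToward; module

theorem norm_foldToward_lt {a x : EuclideanSpace ℝ (Fin m)} (ha : ‖a‖ < 1 / 4) (hx : ‖x‖ ≠ 1) :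
    ‖foldToward a x‖ < 1 := by
  rcases lt_or_gt_of_ne hx with h | h
  · rwa [foldToward_of_le a h.le]
  rcases le_or_gt (3 / 2) ‖x‖ with h' | h'
  · rw [foldToward_of_ge a h']; linarith
  have h0 := ballCutoff_of_mid h.le h'.le
  have : foldToward a x = (1 - ballCutoff x) • a + ballCutoff x • x := by
    unfold foldToward; module
  rw [this]
  refine (norm_add_le _ _).trans_lt ?_
  rw [norm_smul, norm_smul, Real.norm_of_nonneg (ballCutoff_nonneg x),
    Real.norm_of_nonneg (sub_nonneg.2 (ballCutoff_le_one x)), h0]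
  have : (1 - (3 - 2 * ‖x‖)) * ‖a‖ ≤ (1 - (3 - 2 * ‖x‖)) * (1 / 4) := by
    apply mul_le_mul_of_nonneg_left ha.le; linarith
  nlinarith

theorem norm_foldToward_le {a : EuclideanSpace ℝ (Fin m)} (ha : ‖a‖ < 1 / 4)
    (x : EuclideanSpace ℝ (Fin m)) : ‖foldToward a x‖ ≤ 1 := by
  by_cases hx : ‖x‖ = 1
  · rw [foldToward_of_le a hx.le, hx]
  · exact (norm_foldToward_lt ha hx).le

theorem lipschitzWith_foldToward {a : EuclideanSpace ℝ (Fin m)} (ha : ‖a‖ < 1 / 4) :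
    LipschitzWith 6 (foldToward a) := by
  have key : ∀ x y : EuclideanSpace ℝ (Fin m), ‖y‖ ≤ 3 / 2 →
      ‖foldToward a x - foldToward a y‖ ≤ 6 * ‖x - y‖ := fun x y hy => by
    rw [foldToward_sub]
    refine (norm_add_le _ _).trans ?_
    rw [norm_smul, norm_smul, Real.norm_of_nonneg (ballCutoff_nonneg x), Real.norm_eq_abs]
    have h1 : ‖y - a‖ ≤ 7 / 4 := (norm_sub_le _ _).trans (by linarith)
    have h2 := abs_ballCutoff_sub_le x y
    have h3 := ballCutoff_le_one x
    calc ballCutoff x * ‖x - y‖ + |ballCutoff x - ballCutoff y| * ‖y - a‖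
        ≤ 1 * ‖x - y‖ + (2 * ‖x - y‖) * (7 / 4) := by gcongr
      _ ≤ 6 * ‖x - y‖ := by nlinarith [norm_nonneg (x - y)]
  refine LipschitzWith.of_dist_le_mul fun x y => ?_
  rw [dist_eq_norm, dist_eq_norm, NNReal.coe_ofNat]
  rcases le_total ‖y‖ (3 / 2) with hy | hy
  · exact key x y hy
  rcases le_total ‖x‖ (3 / 2) with hx | hx
  · rw [norm_sub_rev, norm_sub_rev x]
    exact key y x hx
  · rw [foldToward_of_ge a hx, foldToward_of_ge a hy, sub_self, norm_zero]
    positivity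

/-- Moving outwards, the folded point moves inwards at a definite speed, so that the fold is
injective on the annulus, with a Lipschitz inverse. -/
theorem antilipschitzWith_foldToward {a : EuclideanSpace ℝ (Fin m)} (ha : ‖a‖ < 1 / 4) :
    AntilipschitzWith 16
      ((Metric.closedBall (0 : EuclideanSpace ℝ (Fin m)) (5 / 4) \ Metric.ball 0 1).domRestrict
        (foldToward a)) := by
  have key : ∀ x y : EuclideanSpace ℝ (Fin m), 1 ≤ ‖y‖ → ‖y‖ ≤ ‖x‖ → ‖x‖ ≤ 5 / 4 →
      ‖x - y‖ ≤ 16 * ‖foldToward a x - foldToward a y‖ := fun x y hy hyx hx => by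
    have hx1 := ballCutoff_of_mid (hy.trans hyx) (by linarith)
    have hy1 := ballCutoff_of_mid hy (by linarith)
    set δ := ‖x‖ - ‖y‖ with hδ
    have hδ0 : 0 ≤ δ := sub_nonneg.2 hyx
    have hsub : foldToward a x - foldToward a y = ballCutoff x • (x - y) - (2 * δ) • (y - a) := by
      rw [foldToward_sub, hx1, hy1, hδ]; module
    have hya : ‖y - a‖ ≤ 3 / 2 := (norm_sub_le _ _).trans (by linarith)
    -- the component along `y`
    have h1 : δ / 2 ≤ ‖foldToward a x - foldToward a y‖ := by
      have hcs := abs_real_inner_le_norm (foldToward a x - foldToward a y) y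
      have hxy : inner ℝ x y ≤ ‖x‖ * ‖y‖ := real_inner_le_norm x y
      have hay : inner ℝ a y ≤ ‖a‖ * ‖y‖ := real_inner_le_norm a y
      have hval : inner ℝ (foldToward a x - foldToward a y) y
          = (3 - 2 * ‖x‖) * (inner ℝ x y - ‖y‖ ^ 2) - 2 * δ * (‖y‖ ^ 2 - inner ℝ a y) := by
        rw [hsub, inner_sub_left, inner_smul_left, inner_smul_left, inner_sub_left, inner_sub_left,
          real_inner_self_eq_norm_sq, hx1]
        simp
      have h3 : (3 - 2 * ‖x‖) * (inner ℝ x y - ‖y‖ ^ 2) ≤ 1 * (δ * ‖y‖) := by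
        have h6 : inner ℝ x y - ‖y‖ ^ 2 ≤ δ * ‖y‖ := by rw [hδ]; nlinarith
        refine (mul_le_mul_of_nonneg_left h6 (by linarith)).trans ?_
        gcongr
        linarith
      have h4 : 2 * δ * (3 / 4 * ‖y‖) ≤ 2 * δ * (‖y‖ ^ 2 - inner ℝ a y) := by
        apply mul_le_mul_of_nonneg_left _ (by positivity)
        nlinarith
      have h5 : δ / 2 * ‖y‖ ≤ ‖foldToward a x - foldToward a y‖ * ‖y‖ := by
        refine le_trans ?_ ((neg_le_abs _).trans hcs)
        rw [hval]
        nlinarith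
      exact le_of_mul_le_mul_right h5 (by linarith)
    have h2 : 1 / 2 * ‖x - y‖ - 3 * δ ≤ ‖foldToward a x - foldToward a y‖ := by
      rw [hsub]
      refine le_trans ?_ (norm_sub_norm_le _ _)
      rw [norm_smul, norm_smul, hx1, Real.norm_of_nonneg (by linarith),
        Real.norm_of_nonneg (by positivity)]
      have : 1 / 2 * ‖x - y‖ ≤ (3 - 2 * ‖x‖) * ‖x - y‖ := by
        gcongr; linarith
      have : 2 * δ * ‖y - a‖ ≤ 2 * δ * (3 / 2) := by gcongr
      linarith
    linarith
  refine AntilipschitzWith.of_le_mul_dist fun x y => ?_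
  rw [Subtype.dist_eq, dist_eq_norm, dist_eq_norm, NNReal.coe_ofNat]
  have hx := x.2
  have hy := y.2
  simp only [mem_sdiff, Metric.mem_closedBall, dist_zero_right, Metric.mem_ball, not_lt] at hx hy
  rcases le_total ‖(y : EuclideanSpace ℝ (Fin m))‖ ‖(x : EuclideanSpace ℝ (Fin m))‖ with h | h
  · exact key x y hy.2 h hx.1
  · rw [norm_sub_rev, norm_sub_rev (domRestrict _ _ _)]
    exact key y x hx.2 h hy.1

/-- Change of variables, as an inequality, for maps whose inverse is Lipschitz. -/
theorem setLIntegral_comp_le_of_antilipschitz {S T : Set (EuclideanSpace ℝ (Fin m))}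
    {f : EuclideanSpace ℝ (Fin m) → EuclideanSpace ℝ (Fin m)}
    (hf : Measurable f) {K : ℝ≥0} (hK : AntilipschitzWith K (S.domRestrict f))
    (hST : MapsTo f S T) {g : EuclideanSpace ℝ (Fin m) → ℝ≥0∞} (hg : Measurable g) :
    ∫⁻ x in S, g (f x) ≤ (K : ℝ≥0∞) ^ m * ∫⁻ y in T, g y := by
  have hle : (volume.restrict S).map f ≤ ((K : ℝ≥0∞) ^ m) • volume.restrict T := by
    refine Measure.le_iff.2 fun s hs => ?_
    rw [Measure.map_apply hf hs, Measure.restrict_apply (hf hs), Measure.smul_apply, smul_eq_mul,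
      Measure.restrict_apply hs]
    have himg : f ⁻¹' s ∩ S = Subtype.val '' (S.domRestrict f ⁻¹' (s ∩ T)) := by
      ext x
      constructor
      · exact fun h => ⟨⟨x, h.2⟩, ⟨h.1, hST h.2⟩, rfl⟩
      · rintro ⟨⟨y, hy⟩, h, rfl⟩
        exact ⟨h.1, hy⟩
    have hH : (Measure.hausdorffMeasure (m : ℝ) : Measure (EuclideanSpace ℝ (Fin m)))
        (f ⁻¹' s ∩ S) ≤ (K : ℝ≥0∞) ^ m * Measure.hausdorffMeasure (m : ℝ) (s ∩ T) := by
      rw [himg, isometry_subtype_coe.hausdorffMeasure_image (Or.inl (by positivity))]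
      have := hK.hausdorffMeasure_preimage_le (d := (m : ℝ)) (by positivity) (s ∩ T)
      rwa [ENNReal.rpow_natCast] at this
    rw [Measure.isAddLeftInvariant_eq_smul (volume : Measure (EuclideanSpace ℝ (Fin m)))
      (Measure.hausdorffMeasure (m : ℝ)), Measure.smul_apply, Measure.smul_apply]
    simp only [ENNReal.smul_def, smul_eq_mul]
    rw [mul_left_comm]
    gcongr
  rw [← lintegral_map hg hf, ← smul_eq_mul, ← lintegral_smul_measure]
  exact lintegral_mono' hle le_rfl

/-- On average over `a`, composition with `foldToward a` is bounded on `L¹`. Near the unit sphere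
this is a change of variables in `x`, away from it one in `a`. -/
theorem exists_lintegral_foldToward_le (m : ℕ) (R : ℝ) : ∃ C : ℝ≥0,
    ∀ g : EuclideanSpace ℝ (Fin m) → ℝ≥0∞, Measurable g →
      ∫⁻ a in Metric.ball (0 : EuclideanSpace ℝ (Fin m)) (1 / 4), ∫⁻ x in Metric.ball 0 R,
        g (foldToward a x) ≤ C * ∫⁻ y in Metric.ball 0 1, g y := by
  set V : ℝ≥0 := (volume (Metric.ball (0 : EuclideanSpace ℝ (Fin m)) (1 / 4))).toNNReal with hV
  have hVe : volume (Metric.ball (0 : EuclideanSpace ℝ (Fin m)) (1 / 4)) = V :=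
    (ENNReal.coe_toNNReal measure_ball_lt_top.ne).symm
  set W : ℝ≥0 := (volume (Metric.ball (0 : EuclideanSpace ℝ (Fin m)) R)).toNNReal with hW
  have hWe : volume (Metric.ball (0 : EuclideanSpace ℝ (Fin m)) R) = W :=
    (ENNReal.coe_toNNReal measure_ball_lt_top.ne).symm
  refine ⟨(1 + 16 ^ m) * V + 2 ^ m * W, fun g hg => ?_⟩
  set I := ∫⁻ y in Metric.ball (0 : EuclideanSpace ℝ (Fin m)) 1, g y with hI
  have hmeas : Measurable fun z : EuclideanSpace ℝ (Fin m) × EuclideanSpace ℝ (Fin m) =>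
      g (foldToward z.1 z.2) := hg.comp continuous_foldToward.measurable
  have hsphere : volume (Metric.sphere (0 : EuclideanSpace ℝ (Fin m)) 1) = 0 :=
    Measure.addHaar_sphere_of_ne_zero _ _ one_ne_zero
  set S₂ : Set (EuclideanSpace ℝ (Fin m)) := Metric.closedBall 0 (5 / 4) \ Metric.closedBall 0 1
  set S₃ : Set (EuclideanSpace ℝ (Fin m)) := Metric.ball 0 R \ Metric.closedBall 0 (5 / 4)
  have hS₂ : MeasurableSet S₂ := measurableSet_closedBall.diff measurableSet_closedBall
  have hS₃ : MeasurableSet S₃ := measurableSet_ball.diff measurableSet_closedBall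
  have hcover : Metric.ball (0 : EuclideanSpace ℝ (Fin m)) R ⊆
      Metric.ball 0 1 ∪ Metric.sphere 0 1 ∪ S₂ ∪ S₃ := by
    intro x hx
    by_cases h1 : ‖x‖ < 1
    · exact Or.inl (Or.inl (Or.inl (by simpa using h1)))
    by_cases h2 : ‖x‖ = 1
    · exact Or.inl (Or.inl (Or.inr (by simpa using h2)))
    by_cases h3 : ‖x‖ ≤ 5 / 4
    · refine Or.inl (Or.inr ⟨by simpa using h3, ?_⟩)
      simp only [Metric.mem_closedBall, dist_zero_right]
      intro h; exact h2 (le_antisymm h (not_lt.1 h1))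
    · exact Or.inr ⟨hx, by simpa using h3⟩
  -- the part of the integral over the first two regions, for fixed `a`
  have hin : ∀ a ∈ Metric.ball (0 : EuclideanSpace ℝ (Fin m)) (1 / 4),
      ∫⁻ x in Metric.ball 0 R, g (foldToward a x)
        ≤ (1 + 16 ^ m) * I + ∫⁻ x in S₃, g (foldToward a x) := by
    intro a ha
    rw [mem_ball_zero_iff] at ha
    have hfm : Measurable (foldToward a) := (lipschitzWith_foldToward ha).continuous.measurable
    calc ∫⁻ x in Metric.ball 0 R, g (foldToward a x)
        ≤ ∫⁻ x in Metric.ball 0 1 ∪ Metric.sphere 0 1 ∪ S₂ ∪ S₃, g (foldToward a x) :=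
          lintegral_mono_set hcover
      _ ≤ (∫⁻ x in Metric.ball 0 1, g (foldToward a x)) +
            (∫⁻ x in Metric.sphere 0 1, g (foldToward a x)) + (∫⁻ x in S₂, g (foldToward a x)) +
            ∫⁻ x in S₃, g (foldToward a x) := by
          refine (lintegral_union_le _ _ _).trans (add_le_add_left ?_ _)
          refine (lintegral_union_le _ _ _).trans (add_le_add_left ?_ _)
          exact lintegral_union_le _ _ _
      _ ≤ I + 0 + 16 ^ m * I + ∫⁻ x in S₃, g (foldToward a x) := by
          gcongr
          · refine le_of_eq (setLIntegral_congr_fun measurableSet_ball fun x hx => ?_)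
            rw [foldToward_of_le a (mem_ball_zero_iff.1 hx).le]
          · rw [setLIntegral_measure_zero _ _ hsphere]
          · refine setLIntegral_comp_le_of_antilipschitz (K := 16) hfm ?_ ?_ hg
            · have hsub : S₂ ⊆ Metric.closedBall 0 (5 / 4) \ Metric.ball 0 1 :=
                sdiff_subset_sdiff_right Metric.ball_subset_closedBall
              intro x y
              exact antilipschitzWith_foldToward ha (inclusion hsub x) (inclusion hsub y)
            · intro x hx
              have h1 : ¬ ‖x‖ ≤ 1 := by simpa using hx.2
              exact mem_ball_zero_iff.2 (norm_foldToward_lt ha fun h => h1 h.le)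
      _ = (1 + 16 ^ m) * I + ∫⁻ x in S₃, g (foldToward a x) := by ring
  -- the last region, for fixed `x`
  have hout : ∀ x ∈ S₃, ∫⁻ a in Metric.ball 0 (1 / 4), g (foldToward a x) ≤ 2 ^ m * I := by
    intro x hx
    have hx1 : 5 / 4 < ‖x‖ := by simpa using hx.2
    have hθ : ballCutoff x ≤ 1 / 2 := by
      rcases le_total ‖x‖ (3 / 2) with h | h
      · rw [ballCutoff_of_mid (by linarith) h]; linarith
      · rw [ballCutoff_of_ge h]; norm_num
    refine setLIntegral_comp_le_of_antilipschitz (K := 2)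
      (f := fun a => foldToward a x)
      (continuous_foldToward.comp (Continuous.prodMk_left x)).measurable ?_ ?_ hg
    · refine AntilipschitzWith.of_le_mul_dist fun a b => ?_
      have : foldToward (a : EuclideanSpace ℝ (Fin m)) x
          - foldToward (b : EuclideanSpace ℝ (Fin m)) x
          = (1 - ballCutoff x) • ((a : EuclideanSpace ℝ (Fin m)) - b) := by
        unfold foldToward; module
      rw [Subtype.dist_eq, dist_eq_norm, dist_eq_norm, domRestrict_apply, domRestrict_apply, this,
        norm_smul, Real.norm_of_nonneg (by linarith), NNReal.coe_ofNat]
      nlinarith [norm_nonneg ((a : EuclideanSpace ℝ (Fin m)) - b)]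
    · intro a ha
      exact mem_ball_zero_iff.2 (norm_foldToward_lt (mem_ball_zero_iff.1 ha) (by linarith))
  calc ∫⁻ a in Metric.ball (0 : EuclideanSpace ℝ (Fin m)) (1 / 4), ∫⁻ x in Metric.ball 0 R,
        g (foldToward a x)
      ≤ ∫⁻ a in Metric.ball (0 : EuclideanSpace ℝ (Fin m)) (1 / 4),
          ((1 + 16 ^ m) * I + ∫⁻ x in S₃, g (foldToward a x)) :=
        setLIntegral_mono' measurableSet_ball hin
    _ = (1 + 16 ^ m) * I * V + ∫⁻ x in S₃, ∫⁻ a in Metric.ball 0 (1 / 4), g (foldToward a x) := by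
        rw [lintegral_add_left measurable_const, setLIntegral_const, hVe,
          lintegral_lintegral_swap hmeas.aemeasurable]
    _ ≤ (1 + 16 ^ m) * I * V + ∫⁻ _x in S₃, 2 ^ m * I := by
        exact add_le_add le_rfl (setLIntegral_mono' hS₃ hout)
    _ ≤ (1 + 16 ^ m) * I * V + 2 ^ m * I * W := by
        rw [setLIntegral_const]
        gcongr
        rw [← hWe]
        exact measure_mono sdiff_subset
    _ = _ := by push_cast; ring

end Retraction

/-! ### Integrals of powers of the norm -/

section Radial

variable {m : ℕ}

theorem lintegral_comp_rescale (f : EuclideanSpace ℝ (Fin m) → ℝ≥0∞) {t : ℝ} (ht : 0 < t)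
    (h : EuclideanSpace ℝ (Fin m)) :
    ∫⁻ x, f (t⁻¹ • (x - h)) = ENNReal.ofReal (t ^ m) * ∫⁻ x, f x := by
  rw [lintegral_sub_right_eq_self (μ := volume) (fun x => f (t⁻¹ • x)) h]
  have h1 := lintegral_map_equiv (μ := (volume : Measure (EuclideanSpace ℝ (Fin m)))) f
    (Homeomorph.smulOfNeZero t⁻¹ (inv_ne_zero ht.ne')).toMeasurableEquiv
  have h2 : ⇑(Homeomorph.smulOfNeZero (α := EuclideanSpace ℝ (Fin m)) t⁻¹
      (inv_ne_zero ht.ne')).toMeasurableEquiv = fun x => t⁻¹ • x := rfl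
  rw [h2, Measure.map_addHaar_smul _ (inv_ne_zero ht.ne'), lintegral_smul_measure] at h1
  rw [← h1, finrank_euclideanSpace, Fintype.card_fin, smul_eq_mul, inv_pow, inv_inv,
    abs_of_pos (by positivity)]

theorem enorm_smul_rpow {t : ℝ} (ht : 0 < t) (z : EuclideanSpace ℝ (Fin m)) (β : ℝ) :
    ‖t • z‖ₑ ^ β = ENNReal.ofReal (t ^ β) * ‖z‖ₑ ^ β := by
  rw [enorm_smul, ENNReal.mul_rpow_of_ne_top enorm_ne_top enorm_ne_top, Real.enorm_eq_ofReal ht.le,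
    ENNReal.ofReal_rpow_of_pos ht]

theorem enorm_rpow_eq_ofReal {z : EuclideanSpace ℝ (Fin m)} (hz : z ≠ 0) (β : ℝ) :
    ‖z‖ₑ ^ β = ENNReal.ofReal (‖z‖ ^ β) := by
  rw [← ofReal_norm, ENNReal.ofReal_rpow_of_pos (norm_pos_iff.2 hz)]

theorem setLIntegral_enorm_rpow_rescale {A : Set (EuclideanSpace ℝ (Fin m))} (hA : MeasurableSet A)
    {t : ℝ} (ht : 0 < t) (β : ℝ) :
    ∫⁻ z in {z | t⁻¹ • z ∈ A}, ‖z‖ₑ ^ (-β)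
      = ENNReal.ofReal (t ^ (m - β)) * ∫⁻ z in A, ‖z‖ₑ ^ (-β) := by
  have hA' : MeasurableSet {z : EuclideanSpace ℝ (Fin m) | t⁻¹ • z ∈ A} :=
    hA.preimage (measurable_const_smul t⁻¹)
  rw [← lintegral_indicator hA', ← lintegral_indicator hA]
  have h1 := lintegral_comp_rescale (A.indicator fun z => ‖z‖ₑ ^ (-β)) ht 0
  have h2 : ∀ z : EuclideanSpace ℝ (Fin m), indicator {z | t⁻¹ • z ∈ A} (fun z => ‖z‖ₑ ^ (-β)) z
      = ENNReal.ofReal (t ^ (-β)) * A.indicator (fun z => ‖z‖ₑ ^ (-β)) (t⁻¹ • (z - 0)) :=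
          fun z => by
    rw [sub_zero]
    by_cases hz : t⁻¹ • z ∈ A
    · rw [indicator_of_mem hz, indicator_of_mem (by exact hz), ← enorm_smul_rpow ht,
        smul_inv_smul₀ ht.ne']
    · rw [indicator_of_notMem hz, indicator_of_notMem (by exact hz), mul_zero]
  simp_rw [h2]
  rw [lintegral_const_mul' _ _ ENNReal.ofReal_ne_top, h1, ← mul_assoc,
    ← ENNReal.ofReal_mul (by positivity)]
  congr 2
  rw [← Real.rpow_natCast t m, ← Real.rpow_add ht]
  congr 1; ring

theorem ae_ne_zero (hm : 0 < m) : ∀ᵐ z : EuclideanSpace ℝ (Fin m), z ≠ 0 := by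
  have : Nonempty (Fin m) := ⟨⟨0, hm⟩⟩
  exact Measure.ae_ne volume 0

theorem exists_lintegral_ball_enorm_rpow_le (hm : 0 < m) {β : ℝ} (hβ : β < m) : ∃ C : ℝ≥0,
    ∀ t : ℝ, 0 < t → ∫⁻ z in Metric.ball (0 : EuclideanSpace ℝ (Fin m)) t, ‖z‖ₑ ^ (-β)
      ≤ C * ENNReal.ofReal (t ^ (m - β)) := by
  have hfin : ∫⁻ z in Metric.ball (0 : EuclideanSpace ℝ (Fin m)) 1, ‖z‖ₑ ^ (-β) < ⊤ := by
    have h1 : IntegrableOn (fun z : EuclideanSpace ℝ (Fin m) => ‖z‖ ^ (-β)) (Metric.ball 0 1) := by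
      refine integrableOn_ball_of_norm_le_rpow (C := 1) (α := β)
        (by rw [finrank_euclideanSpace, Fintype.card_fin]; exact hm)
        (by simpa using hβ) (Filter.Eventually.of_forall fun z => ?_) ?_
      · rw [one_mul, Real.norm_of_nonneg (by positivity)]
      · exact (measurable_norm.pow_const _).aestronglyMeasurable
    refine lt_of_le_of_lt (le_of_eq ?_) h1.2
    refine lintegral_congr_ae (ae_restrict_of_ae ((ae_ne_zero hm).mono fun z hz => ?_))
    beta_reduce
    rw [enorm_rpow_eq_ofReal hz, Real.enorm_eq_ofReal (by positivity)]
  refine ⟨(∫⁻ z in Metric.ball (0 : EuclideanSpace ℝ (Fin m)) 1, ‖z‖ₑ ^ (-β)).toNNReal,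
    fun t ht => ?_⟩
  rw [ENNReal.coe_toNNReal hfin.ne, mul_comm,
      ← setLIntegral_enorm_rpow_rescale measurableSet_ball ht]
  refine lintegral_mono_set fun z hz => ?_
  rw [mem_ball_zero_iff] at hz
  rw [mem_ofPred_eq, mem_ball_zero_iff, norm_smul, norm_inv, Real.norm_of_nonneg ht.le,
    inv_mul_lt_iff₀ ht, mul_one]
  exact hz

theorem exists_lintegral_compl_ball_enorm_rpow_le {β : ℝ} (hβ : (m : ℝ) < β) : ∃ C : ℝ≥0,
    ∀ t : ℝ, 0 < t → ∫⁻ z in (Metric.ball (0 : EuclideanSpace ℝ (Fin m)) t)ᶜ, ‖z‖ₑ ^ (-β)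
      ≤ C * ENNReal.ofReal (t ^ (m - β)) := by
  have hβ0 : 0 < β := lt_of_le_of_lt (by positivity) hβ
  have hfin : ∫⁻ z in (Metric.ball (0 : EuclideanSpace ℝ (Fin m)) 1)ᶜ, ‖z‖ₑ ^ (-β) < ⊤ := by
    have h1 := finite_integral_one_add_norm (μ := (volume : Measure (EuclideanSpace ℝ (Fin m))))
        (r := β)
      (by simpa using hβ)
    refine lt_of_le_of_lt ?_ (ENNReal.mul_lt_top (ENNReal.ofReal_lt_top (r := 2 ^ β)) h1)
    rw [← lintegral_const_mul' _ _ ENNReal.ofReal_ne_top]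
    refine (setLIntegral_mono' measurableSet_ball.compl fun z hz => ?_).trans
      (setLIntegral_le_lintegral _ _)
    have hz1 : 1 ≤ ‖z‖ := by simpa using hz
    have hz0 : z ≠ 0 := norm_pos_iff.1 (by linarith)
    rw [enorm_rpow_eq_ofReal hz0, ← ENNReal.ofReal_mul (by positivity)]
    refine ENNReal.ofReal_le_ofReal ?_
    rw [Real.rpow_neg (by positivity), Real.rpow_neg (by positivity), ← div_eq_mul_inv,
      ← Real.inv_rpow (by positivity), ← Real.div_rpow (by positivity) (by positivity)]
    refine Real.rpow_le_rpow (by positivity) ?_ hβ0.le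
    rw [inv_eq_one_div, div_le_div_iff₀ (by positivity) (by positivity)]
    linarith
  refine ⟨(∫⁻ z in (Metric.ball (0 : EuclideanSpace ℝ (Fin m)) 1)ᶜ, ‖z‖ₑ ^ (-β)).toNNReal,
    fun t ht => ?_⟩
  rw [ENNReal.coe_toNNReal hfin.ne, mul_comm,
    ← setLIntegral_enorm_rpow_rescale measurableSet_ball.compl ht]
  refine lintegral_mono_set fun z hz => ?_
  rw [mem_compl_iff, mem_ball_zero_iff, not_lt] at hz
  rw [mem_ofPred_eq, mem_compl_iff, mem_ball_zero_iff, norm_smul, norm_inv,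
    Real.norm_of_nonneg ht.le, inv_mul_lt_iff₀ ht, mul_one, not_lt]
  exact hz

/-- The integral of `‖x‖ ^ (-σ)` over the annulus of radii `e⁻ᴸ` and `2`. -/
noncomputable def annulusIntegral (m : ℕ) (σ L : ℝ) : ℝ≥0∞ :=
  ∫⁻ x in {x : EuclideanSpace ℝ (Fin m) | Real.exp (-L) < ‖x‖ ∧ ‖x‖ < 2}, ‖x‖ₑ ^ (-σ)

theorem measurableSet_annulus (r R : ℝ) :
    MeasurableSet {x : EuclideanSpace ℝ (Fin m) | r < ‖x‖ ∧ ‖x‖ < R} :=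
  (measurableSet_lt measurable_const measurable_norm).inter
    (measurableSet_lt measurable_norm measurable_const)

theorem exists_annulusIntegral_le_of_lt (hm : 0 < m) {σ : ℝ} (hσ : σ < m) :
    ∃ C : ℝ≥0, ∀ L, annulusIntegral m σ L ≤ C := by
  obtain ⟨C, hC⟩ := exists_lintegral_ball_enorm_rpow_le hm hσ
  refine ⟨C * (2 ^ (m - σ) : ℝ).toNNReal, fun L => ?_⟩
  rw [ENNReal.coe_mul]
  exact (lintegral_mono_set fun x hx => mem_ball_zero_iff.2 hx.2).trans (hC 2 two_pos)

/-- In the critical case the integral over the annulus grows at most linearly, as each dyadic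
annulus contributes the same amount. -/
theorem exists_annulusIntegral_le_of_eq (m : ℕ) :
    ∃ C : ℝ≥0, ∀ L : ℝ, 0 < L → annulusIntegral m m L ≤ C * ENNReal.ofReal (1 + L) := by
  set A : Set (EuclideanSpace ℝ (Fin m)) := {x | 1 / 2 < ‖x‖ ∧ ‖x‖ < 2} with hA
  have hAm : MeasurableSet A := measurableSet_annulus _ _
  have hfin : ∫⁻ z in A, ‖z‖ₑ ^ (-(m : ℝ)) < ⊤ := by
    refine lt_of_le_of_lt (setLIntegral_mono' hAm (g := fun _ => ENNReal.ofReal (2 ^ m))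
      fun z hz => ?_) ?_
    · have hz0 : 0 < ‖z‖ := by have := hz.1; linarith
      rw [enorm_rpow_eq_ofReal (norm_pos_iff.1 hz0)]
      refine ENNReal.ofReal_le_ofReal ?_
      rw [Real.rpow_neg hz0.le, Real.rpow_natCast, ← inv_pow]
      gcongr
      rw [inv_le_comm₀ hz0 two_pos]
      linarith [hz.1]
    · rw [setLIntegral_const]
      refine ENNReal.mul_lt_top ENNReal.ofReal_lt_top
        (lt_of_le_of_lt (measure_mono fun x hx => mem_ball_zero_iff.2 hx.2) measure_ball_lt_top)
  set c : ℝ≥0 := (∫⁻ z in A, ‖z‖ₑ ^ (-(m : ℝ))).toNNReal with hc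
  have hce : ∫⁻ z in A, ‖z‖ₑ ^ (-(m : ℝ)) = c := (ENNReal.coe_toNNReal hfin.ne).symm
  have hscaled : ∀ t : ℝ, 0 < t → ∫⁻ z in {z : EuclideanSpace ℝ (Fin m) | t⁻¹ • z ∈ A},
      ‖z‖ₑ ^ (-(m : ℝ)) = c := fun t ht => by
    rw [setLIntegral_enorm_rpow_rescale hAm ht, sub_self, Real.rpow_zero, ENNReal.ofReal_one,
      one_mul, hce]
  have hdyadic : ∀ k : ℕ, ∫⁻ z in {z : EuclideanSpace ℝ (Fin m) |
      (1 / 2) ^ (k + 1) < ‖z‖ ∧ ‖z‖ < 2},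
      ‖z‖ₑ ^ (-(m : ℝ)) ≤ (k + 1) * c := fun k => by
    induction k with
    | zero => simpa [hA] using hce.le
    | succ k ih =>
      have hsub : {z : EuclideanSpace ℝ (Fin m) | (1 / 2) ^ (k + 1 + 1) < ‖z‖ ∧ ‖z‖ < 2} ⊆
          {z | (1 / 2) ^ (k + 1) < ‖z‖ ∧ ‖z‖ < 2} ∪ {z | ((1 / 2 : ℝ) ^ (k + 1))⁻¹ • z ∈ A} := by
        rintro z ⟨h1, h2⟩
        by_cases h3 : (1 / 2) ^ (k + 1) < ‖z‖
        · exact Or.inl ⟨h3, h2⟩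
        · right
          have hp : (0 : ℝ) < (1 / 2) ^ (k + 1) := by positivity
          rw [mem_ofPred_eq, hA, mem_ofPred_eq, norm_smul, norm_inv, Real.norm_of_nonneg hp.le]
          rw [lt_inv_mul_iff₀ hp, inv_mul_lt_iff₀ hp]
          rw [pow_succ] at h1
          exact ⟨by linarith, by linarith [not_lt.1 h3]⟩
      refine (lintegral_mono_set hsub).trans ((lintegral_union_le _ _ _).trans ?_)
      rw [hscaled _ (by positivity)]
      refine (add_le_add_left ih _).trans (le_of_eq ?_)
      push_cast; ring
  refine ⟨3 * c, fun L hL => ?_⟩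
  set k := ⌈L / Real.log 2⌉₊ with hk
  have hlog : 1 / 2 < Real.log 2 := by linarith [Real.log_two_gt_d9]
  have hk1 : L / Real.log 2 ≤ k := Nat.le_ceil _
  have hk2 : (k : ℝ) < L / Real.log 2 + 1 := Nat.ceil_lt_add_one (by positivity)
  have hsub : {x : EuclideanSpace ℝ (Fin m) | Real.exp (-L) < ‖x‖ ∧ ‖x‖ < 2} ⊆
      {z | (1 / 2) ^ (k + 1) < ‖z‖ ∧ ‖z‖ < 2} := by
    rintro x ⟨h1, h2⟩
    refine ⟨lt_of_le_of_lt ?_ h1, h2⟩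
    calc (1 / 2 : ℝ) ^ (k + 1) ≤ (1 / 2) ^ k :=
          pow_le_pow_of_le_one (by norm_num) (by norm_num) (by omega)
      _ = Real.exp (-(k * Real.log 2)) := by
          rw [← mul_neg, ← Real.log_inv, ← Real.rpow_natCast, Real.rpow_def_of_pos (by norm_num),
            mul_comm]
          norm_num
      _ ≤ Real.exp (-L) := by
          rw [Real.exp_le_exp, neg_le_neg_iff]
          rwa [div_le_iff₀ (by positivity)] at hk1
  refine (lintegral_mono_set hsub).trans ((hdyadic k).trans ?_)
  rw [ENNReal.coe_mul, mul_right_comm]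
  gcongr
  rw [show ((k : ℝ≥0∞) + 1) = ENNReal.ofReal (k + 1) by
    rw [ENNReal.ofReal_add (by positivity) zero_le_one, ENNReal.ofReal_natCast, ENNReal.ofReal_one],
    show ((3 : ℝ≥0) : ℝ≥0∞) = ENNReal.ofReal 3 by simp, ← ENNReal.ofReal_mul (by norm_num)]
  refine ENNReal.ofReal_le_ofReal ?_
  have : L / Real.log 2 ≤ 2 * L := by
    rw [div_le_iff₀ (by positivity)]; nlinarith
  linarith

theorem annulusIntegral_lt_top (m : ℕ) {σ : ℝ} (hσ : 0 < σ) (L : ℝ) :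
    annulusIntegral m σ L < ⊤ := by
  refine lt_of_le_of_lt (setLIntegral_mono' (measurableSet_annulus _ _)
    (g := fun _ => ENNReal.ofReal (Real.exp (-L) ^ (-σ))) fun z hz => ?_) ?_
  · have hz0 : 0 < ‖z‖ := (Real.exp_pos _).trans hz.1
    rw [enorm_rpow_eq_ofReal (norm_pos_iff.1 hz0)]
    exact ENNReal.ofReal_le_ofReal
      (Real.rpow_le_rpow_of_nonpos (Real.exp_pos _) hz.1.le (by linarith))
  · rw [setLIntegral_const]
    exact ENNReal.mul_lt_top ENNReal.ofReal_lt_top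
      (lt_of_le_of_lt (measure_mono fun x hx => mem_ball_zero_iff.2 hx.2) measure_ball_lt_top)

/-- Points have zero capacity in the subcritical case and, if `p > 1`, in the critical one. -/
theorem tendsto_capacity (hm : 0 < m) {σ p : ℝ} (hp : 1 ≤ p) (h : σ < m ∨ (σ = m ∧ 1 < p)) :
    Filter.Tendsto (fun L : ℝ => ENNReal.ofReal (L ^ (-p)) * (1 + annulusIntegral m σ L))
      Filter.atTop (nhds 0) := by
  rcases h with h | ⟨rfl, hp1⟩
  · obtain ⟨C, hC⟩ := exists_annulusIntegral_le_of_lt hm h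
    have h1 : Filter.Tendsto (fun L : ℝ => ENNReal.ofReal (L ^ (-p)) * (1 + C))
        Filter.atTop (nhds 0) := by
      have := ENNReal.tendsto_ofReal (tendsto_rpow_neg_atTop (y := p) (by linarith))
      rw [ENNReal.ofReal_zero] at this
      have h2 := ENNReal.Tendsto.mul_const this (b := 1 + (C : ℝ≥0∞))
        (Or.inr (ENNReal.add_ne_top.2 ⟨ENNReal.one_ne_top, ENNReal.coe_ne_top⟩))
      rwa [zero_mul] at h2
    refine tendsto_of_tendsto_of_tendsto_of_le_of_le tendsto_const_nhds h1 (fun _ => zero_le)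
      fun L => ?_
    gcongr
    exact hC L
  · obtain ⟨C, hC⟩ := exists_annulusIntegral_le_of_eq m
    have h1 : Filter.Tendsto (fun L : ℝ => (1 + C : ℝ≥0∞) *
        ENNReal.ofReal (L ^ (-p) + L ^ (-(p - 1))))
        Filter.atTop (nhds 0) := by
      have := ENNReal.tendsto_ofReal ((tendsto_rpow_neg_atTop (y := p) (by linarith)).add
        (tendsto_rpow_neg_atTop (y := p - 1) (by linarith)))
      rw [add_zero, ENNReal.ofReal_zero] at this
      have h2 := ENNReal.Tendsto.const_mul this (a := 1 + (C : ℝ≥0∞))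
        (Or.inr (ENNReal.add_ne_top.2 ⟨ENNReal.one_ne_top, ENNReal.coe_ne_top⟩))
      rwa [mul_zero] at h2
    refine tendsto_of_tendsto_of_tendsto_of_le_of_le' tendsto_const_nhds h1
      (Filter.Eventually.of_forall fun _ => zero_le)
      ((Filter.eventually_gt_atTop 0).mono fun L hL => ?_)
    have h3 : (1 : ℝ≥0∞) + annulusIntegral m m L ≤ (1 + C) * ENNReal.ofReal (1 + L) := by
      rw [add_mul, one_mul]
      refine add_le_add ?_ (hC L hL)
      rw [ENNReal.one_le_ofReal]; linarith
    refine (mul_le_mul_right h3 _).trans (le_of_eq ?_)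
    rw [mul_left_comm, ← ENNReal.ofReal_mul (by positivity), mul_add, mul_one, neg_sub,
      Real.rpow_sub hL, Real.rpow_one, Real.rpow_neg hL.le, inv_mul_eq_div]

/-- The `p`-th power of the logarithm is integrable near the origin. -/
theorem exists_lintegral_log_le (hm : 0 < m) {p : ℝ} (hp : 0 < p) : ∃ C : ℝ≥0, ∀ t : ℝ, 0 < t →
    ∫⁻ x in Metric.closedBall (0 : EuclideanSpace ℝ (Fin m)) t,
      ENNReal.ofReal (Real.log (t / ‖x‖)) ^ p ≤ C * ENNReal.ofReal (t ^ m) := by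
  have hm' : (0 : ℝ) < m := by exact_mod_cast hm
  set f : EuclideanSpace ℝ (Fin m) → ℝ≥0∞ :=
    (Metric.closedBall 0 1).indicator fun x => ENNReal.ofReal (Real.log (1 / ‖x‖)) ^ p with hf
  obtain ⟨C, hC⟩ := exists_lintegral_ball_enorm_rpow_le hm (β := m / 2) (by linarith)
  set δ : ℝ := m / 2 / p with hδ
  have hδ0 : 0 < δ := by positivity
  have hfin : ∫⁻ x, f x < ⊤ := by
    rw [hf, lintegral_indicator measurableSet_closedBall]
    have hle : ∀ᵐ x ∂(volume.restrict (Metric.closedBall (0 : EuclideanSpace ℝ (Fin m)) 1)),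
        ENNReal.ofReal (Real.log (1 / ‖x‖)) ^ p
          ≤ ENNReal.ofReal ((1 / δ) ^ p) * ‖x‖ₑ ^ (-(m / 2 : ℝ)) := by
      refine ae_restrict_of_ae ((ae_ne_zero hm).mono fun x hx => ?_)
      have hx0 : 0 < ‖x‖ := norm_pos_iff.2 hx
      rw [enorm_rpow_eq_ofReal hx, ← ENNReal.ofReal_mul (by positivity)]
      have h1 : Real.log (1 / ‖x‖) ≤ (1 / δ) * (1 / ‖x‖) ^ δ := by
        rw [one_div_mul_eq_div]
        exact Real.log_le_rpow_div (by positivity) hδ0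
      refine (ENNReal.rpow_le_rpow (ENNReal.ofReal_le_ofReal h1) hp.le).trans (le_of_eq ?_)
      rw [ENNReal.ofReal_rpow_of_nonneg (by positivity) hp.le, Real.mul_rpow (by positivity)
        (by positivity), ← Real.rpow_mul (by positivity), hδ, div_mul_cancel₀ _ hp.ne', one_div ‖x‖,
        Real.inv_rpow hx0.le, ← Real.rpow_neg hx0.le]
    refine lt_of_le_of_lt (lintegral_mono_ae hle) ?_
    rw [lintegral_const_mul' _ _ ENNReal.ofReal_ne_top]
    refine ENNReal.mul_lt_top ENNReal.ofReal_lt_top (lt_of_le_of_lt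
      ((lintegral_mono_set (Metric.closedBall_subset_ball one_lt_two)).trans (hC 2 two_pos)) ?_)
    exact ENNReal.mul_lt_top ENNReal.coe_lt_top ENNReal.ofReal_lt_top
  refine ⟨(∫⁻ x, f x).toNNReal, fun t ht => ?_⟩
  rw [ENNReal.coe_toNNReal hfin.ne, mul_comm, ← lintegral_comp_rescale f ht 0,
    ← lintegral_indicator measurableSet_closedBall]
  refine lintegral_mono fun x => ?_
  by_cases hx : x ∈ Metric.closedBall (0 : EuclideanSpace ℝ (Fin m)) t
  · have hx' : t⁻¹ • (x - 0) ∈ Metric.closedBall (0 : EuclideanSpace ℝ (Fin m)) 1 := by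
      rw [mem_closedBall_zero_iff] at hx ⊢
      rw [sub_zero, norm_smul, norm_inv, Real.norm_of_nonneg ht.le, inv_mul_le_iff₀ ht]
      linarith
    rw [hf, indicator_of_mem hx, indicator_of_mem hx', sub_zero, norm_smul, norm_inv,
      Real.norm_of_nonneg ht.le, one_div, mul_inv, inv_inv, div_eq_mul_inv]
  · rw [indicator_of_notMem hx]; exact zero_le

end Radial

/-! ### Logarithmic cutoff functions -/

section LogCutoff

variable {m : ℕ}

/-- The function of `‖x‖` equal to `0` for `‖x‖ ≤ e⁻ᴸ`, to `1` for `‖x‖ ≥ 1`, affine in `log ‖x‖`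
between. -/
noncomputable def logCutoff (L : ℝ) (x : EuclideanSpace ℝ (Fin m)) : ℝ :=
  1 + Real.log (max (Real.exp (-L)) (min ‖x‖ 1)) / L

theorem logCutoff_of_le {L : ℝ} (hL : 0 < L) {x : EuclideanSpace ℝ (Fin m)}
    (hx : ‖x‖ ≤ Real.exp (-L)) : logCutoff L x = 0 := by
  rw [logCutoff, max_eq_left ((min_le_left _ _).trans hx), Real.log_exp, neg_div, div_self hL.ne']
  ring

theorem logCutoff_of_ge {L : ℝ} (hL : 0 < L) {x : EuclideanSpace ℝ (Fin m)}
    (hx : 1 ≤ ‖x‖) : logCutoff L x = 1 := by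
  rw [logCutoff, min_eq_right hx, max_eq_right (by rw [Real.exp_le_one_iff]; linarith),
    Real.log_one, zero_div, add_zero]

theorem abs_logCutoff_sub_le {L : ℝ} (hL : 0 < L) {x y : EuclideanSpace ℝ (Fin m)}
    (hx : 0 < ‖x‖) (hxy : ‖x‖ ≤ ‖y‖) :
    |logCutoff L x - logCutoff L y| ≤ L⁻¹ * Real.log (‖y‖ / ‖x‖) := by
  have hy : 0 < ‖y‖ := hx.trans_le hxy
  set ε := Real.exp (-L) with hε
  have hε0 : 0 < ε := Real.exp_pos _
  have hε1 : ε ≤ 1 := by rw [hε, Real.exp_le_one_iff]; linarith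
  set cx := max ε (min ‖x‖ 1) with hcx
  set cy := max ε (min ‖y‖ 1) with hcy
  have hcx0 : 0 < cx := lt_max_of_lt_left hε0
  have hcy0 : 0 < cy := lt_max_of_lt_left hε0
  have hmono : cx ≤ cy := max_le_max le_rfl (min_le_min hxy le_rfl)
  have hlog : 0 ≤ Real.log cy - Real.log cx := sub_nonneg.2 (Real.log_le_log hcx0 hmono)
  have hquot : Real.log cy - Real.log cx ≤ Real.log (‖y‖ / ‖x‖) := by
    rw [← Real.log_div hcy0.ne' hcx0.ne']
    refine Real.log_le_log (by positivity) ?_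
    rw [div_le_div_iff₀ hcx0 hx]
    rcases le_total ‖y‖ ε with h1 | h1
    · have : cy = cx := by
        rw [hcx, hcy, max_eq_left ((min_le_left _ _).trans h1),
          max_eq_left ((min_le_left _ _).trans (hxy.trans h1))]
      rw [this]; nlinarith
    · rcases le_total ‖x‖ 1 with h2 | h2
      · have h3 : cy ≤ ‖y‖ := max_le h1 (min_le_left _ _)
        have h4 : ‖x‖ ≤ cx := le_max_of_le_right (le_min le_rfl h2)
        nlinarith
      · have h3 : cy = cx := by rw [hcx, hcy, min_eq_right h2, min_eq_right (h2.trans hxy)]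
        rw [h3]; nlinarith
  have : logCutoff L x - logCutoff L y = -(L⁻¹ * (Real.log cy - Real.log cx)) := by
    rw [logCutoff, logCutoff]; field_simp; ring
  rw [this, abs_neg, abs_of_nonneg (by positivity)]
  gcongr

theorem log_div_le {a b : ℝ} (ha : 0 < a) (hb : 0 < b) : Real.log (b / a) ≤ (b - a) / a := by
  refine (Real.log_le_sub_one_of_pos (by positivity)).trans (le_of_eq ?_)
  field_simp

theorem lipschitzWith_logCutoff {L : ℝ} (hL : 0 < L) :
    LipschitzWith (L⁻¹ * Real.exp L).toNNReal (logCutoff (m := m) L) := by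
  refine LipschitzWith.of_dist_le_mul fun x y => ?_
  rw [Real.dist_eq, dist_eq_norm, Real.coe_toNNReal _ (by positivity)]
  set ε := Real.exp (-L) with hε
  have hε0 : 0 < ε := Real.exp_pos _
  set c : EuclideanSpace ℝ (Fin m) → ℝ := fun x => max ε (min ‖x‖ 1) with hc
  have hc0 : ∀ x, ε ≤ c x := fun x => le_max_left _ _
  have key : ∀ x y, c x ≤ c y → |Real.log (c x) - Real.log (c y)| ≤ Real.exp L * |c x - c y| := by
    intro x y hxy
    have h0 := hε0.trans_le (hc0 x)
    rw [abs_sub_comm, abs_of_nonneg (sub_nonneg.2 (Real.log_le_log h0 hxy)), abs_sub_comm,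
      abs_of_nonneg (sub_nonneg.2 hxy), ← Real.log_div (h0.trans_le hxy).ne' h0.ne']
    refine (log_div_le h0 (h0.trans_le hxy)).trans ?_
    rw [div_le_iff₀ h0]
    have h1 : 1 ≤ Real.exp L * c x := by
      calc 1 = Real.exp L * ε := by rw [hε, ← Real.exp_add]; simp
        _ ≤ Real.exp L * c x := by gcongr; exact hc0 x
    nlinarith [sub_nonneg.2 hxy]
  have h1 : |Real.log (c x) - Real.log (c y)| ≤ Real.exp L * |c x - c y| := by
    rcases le_total (c x) (c y) with h | h
    · exact key x y h
    · rw [abs_sub_comm, abs_sub_comm (c x)]; exact key y x h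
  have h2 : |c x - c y| ≤ ‖x - y‖ := by
    refine (abs_max_sub_max_le_max _ _ _ _).trans ?_
    rw [sub_self, abs_zero, max_eq_right (abs_nonneg _)]
    refine (abs_min_sub_min_le_max _ _ _ _).trans ?_
    rw [sub_self, abs_zero, max_eq_left (abs_nonneg _)]
    exact abs_norm_sub_norm_le x y
  have h3 : logCutoff L x - logCutoff L y = L⁻¹ * (Real.log (c x) - Real.log (c y)) := by
    rw [logCutoff, logCutoff]; field_simp; ring
  rw [h3, abs_mul, abs_of_pos (inv_pos.2 hL), mul_assoc]
  gcongr
  exact h1.trans (by gcongr)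

end LogCutoff

/-! ### The Gagliardo energy -/

section Gagliardo

variable {m : ℕ} {N : Type*} [EMetricSpace N]

/-- The Gagliardo energy on `A ⊆ ℝ^m` with kernel `‖x - y‖ ^ (-β)`, for maps defined on `ℝ^m`. -/
noncomputable def gagliardoOn (β p : ℝ) (A : Set (EuclideanSpace ℝ (Fin m)))
    (w : EuclideanSpace ℝ (Fin m) → N) : ℝ≥0∞ :=
  ∫⁻ x in A, ∫⁻ y in A, edist (w x) (w y) ^ p * ‖x - y‖ₑ ^ (-β)

theorem gagliardoOn_mono {β p : ℝ} {A B : Set (EuclideanSpace ℝ (Fin m))} (h : A ⊆ B)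
    (w : EuclideanSpace ℝ (Fin m) → N) : gagliardoOn β p A w ≤ gagliardoOn β p B w :=
  (lintegral_mono_set h).trans (lintegral_mono fun _ => lintegral_mono_set h)

theorem gagliardoOn_congr_ae {β p : ℝ} {A : Set (EuclideanSpace ℝ (Fin m))}
    {w w' : EuclideanSpace ℝ (Fin m) → N} (h : w =ᵐ[volume.restrict A] w') :
    gagliardoOn β p A w = gagliardoOn β p A w' := by
  refine lintegral_congr_ae (h.mono fun x hx => lintegral_congr_ae (h.mono fun y hy => ?_))
  simp only [hx, hy]

theorem gagliardoEnergy_eq_gagliardoOn {s p : ℝ} {A : Set (EuclideanSpace ℝ (Fin m))}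
    (hA : MeasurableSet A) (w : EuclideanSpace ℝ (Fin m) → N) :
    gagliardoEnergy s p A (fun x => w x) = gagliardoOn (m + s * p) p A w := by
  have h1 : ∀ x : A, ∫⁻ y : A, edist (w x) (w y) ^ p / edist x y ^ ((m : ℝ) + s * p)
      = ∫⁻ y in A, edist (w x) (w y) ^ p *
          ‖(x : EuclideanSpace ℝ (Fin m)) - y‖ₑ ^ (-((m : ℝ) + s * p)) :=
    fun x => by
      rw [← lintegral_subtype_comap hA]
      refine lintegral_congr fun y => ?_
      rw [Subtype.edist_eq, edist_eq_enorm_sub, div_eq_mul_inv, ENNReal.rpow_neg]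
  rw [gagliardoEnergy, gagliardoOn, ← lintegral_subtype_comap hA]
  exact lintegral_congr h1

theorem gagliardoOn_const {β p : ℝ} (hp : 0 < p) (A : Set (EuclideanSpace ℝ (Fin m))) (b : N) :
    gagliardoOn β p A (fun _ => b) = 0 := by
  simp [gagliardoOn, ENNReal.zero_rpow_of_pos hp]

theorem gagliardoOn_univ_rescale {σ p : ℝ} (w : EuclideanSpace ℝ (Fin m) → N) {t : ℝ} (ht : 0 < t)
    (h : EuclideanSpace ℝ (Fin m)) :
    gagliardoOn (m + σ) p univ (fun x => w (t⁻¹ • (x - h)))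
      = ENNReal.ofReal (t ^ ((m : ℝ) - σ)) * gagliardoOn (m + σ) p univ w := by
  set f : EuclideanSpace ℝ (Fin m) → ℝ≥0∞ := fun x =>
    ∫⁻ y, edist (w x) (w y) ^ p * ‖x - y‖ₑ ^ (-(m + σ)) with hf
  have hinner : ∀ x, ∫⁻ y, edist (w (t⁻¹ • (x - h))) (w (t⁻¹ • (y - h))) ^ p * ‖x - y‖ₑ ^ (-(m + σ))
      = ENNReal.ofReal (t ^ (-σ)) * f (t⁻¹ • (x - h)) := fun x => by
    have h1 := lintegral_comp_rescale (fun y => edist (w (t⁻¹ • (x - h))) (w y) ^ p *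
      ‖t⁻¹ • (x - h) - y‖ₑ ^ (-(m + σ))) ht h
    have h2 : ∀ y, edist (w (t⁻¹ • (x - h))) (w (t⁻¹ • (y - h))) ^ p * ‖x - y‖ₑ ^ (-(m + σ))
        = ENNReal.ofReal (t ^ (-(m + σ))) * (edist (w (t⁻¹ • (x - h))) (w (t⁻¹ • (y - h))) ^ p *
          ‖t⁻¹ • (x - h) - t⁻¹ • (y - h)‖ₑ ^ (-(m + σ))) := fun y => by
      rw [mul_left_comm, ← enorm_smul_rpow ht, ← smul_sub, smul_inv_smul₀ ht.ne',
        sub_sub_sub_cancel_right]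
    simp_rw [h2]
    rw [lintegral_const_mul' _ _ ENNReal.ofReal_ne_top, h1, ← mul_assoc,
      ← ENNReal.ofReal_mul (by positivity), ← Real.rpow_natCast t m, ← Real.rpow_add ht]
    congr 3; ring
  simp only [gagliardoOn, Measure.restrict_univ]
  simp_rw [hinner]
  rw [lintegral_const_mul' _ _ ENNReal.ofReal_ne_top, lintegral_comp_rescale f ht h, ← mul_assoc,
    ← ENNReal.ofReal_mul (by positivity), ← Real.rpow_natCast t m, ← Real.rpow_add ht]
  congr 3; ring

theorem measurable_enorm_sub_rpow (β : ℝ) :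
    Measurable fun z : EuclideanSpace ℝ (Fin m) × EuclideanSpace ℝ (Fin m) => ‖z.1 - z.2‖ₑ ^ β :=
  (continuous_fst.sub continuous_snd).enorm.measurable.pow_const _

theorem rpow_le_of_le_add_add {a b c d S : ℝ≥0∞} {p : ℝ} (hp : 0 < p) (ha : a ^ p ≤ S)
    (hb : b ^ p ≤ S) (hc : c ^ p ≤ S) (hd : d ≤ a + b + c) : d ^ p ≤ 3 ^ p * S := by
  have h : ∀ {x : ℝ≥0∞}, x ^ p ≤ S → x ≤ S ^ p⁻¹ := fun {x} hx => by
    rwa [ENNReal.le_rpow_inv_iff hp]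
  calc d ^ p ≤ (3 * S ^ p⁻¹) ^ p := by
        refine ENNReal.rpow_le_rpow (hd.trans ?_) hp.le
        calc a + b + c ≤ S ^ p⁻¹ + S ^ p⁻¹ + S ^ p⁻¹ := by gcongr <;> exact h ‹_›
          _ = 3 * S ^ p⁻¹ := by ring
    _ = 3 ^ p * S := by
        rw [ENNReal.mul_rpow_of_nonneg _ _ hp.le, ENNReal.rpow_inv_rpow hp.ne']

/-- At two points that do not lie in the same ball, a glued map is compared with the map outside
the balls through the values of the latter at these two points. -/
theorem edist_glueBalls_rpow_le {J : Type} {c : J → EuclideanSpace ℝ (Fin m)} {ρ : J → ℝ}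
    (hB : DisjointBalls c ρ) {w : J → EuclideanSpace ℝ (Fin m) → N}
    {h₀ : EuclideanSpace ℝ (Fin m) → N} {b : J → N}
    (hw : ∀ j, ∀ x ∉ Metric.ball (c j) (ρ j), w j x = b j)
    (hh : ∀ j, ∀ x ∈ Metric.ball (c j) (ρ j), h₀ x = b j) {p : ℝ} (hp : 0 < p)
    (x y : EuclideanSpace ℝ (Fin m)) :
    edist (glueBalls c ρ w h₀ x) (glueBalls c ρ w h₀ y) ^ p
      ≤ 3 ^ p * (edist (h₀ x) (h₀ y) ^ p + ∑' j, edist (w j x) (w j y) ^ p) := by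
  set S := edist (h₀ x) (h₀ y) ^ p + ∑' j, edist (w j x) (w j y) ^ p with hS
  have hj : ∀ j, edist (w j x) (w j y) ^ p ≤ S := fun j =>
    (ENNReal.le_tsum j).trans le_add_self
  by_cases hxy : ∃ j, x ∈ Metric.ball (c j) (ρ j) ∧ y ∈ Metric.ball (c j) (ρ j)
  · obtain ⟨j, hx, hy⟩ := hxy
    rw [glueBalls, glue_of_mem hB.disjoint_ball w h₀ hx, glue_of_mem hB.disjoint_ball w h₀ hy]
    exact rpow_le_of_le_add_add hp (hj j) (hj j) (hj j) (by rw [add_assoc]; exact le_self_add)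
  push Not at hxy
  have key : ∀ x y, (∀ j, x ∈ Metric.ball (c j) (ρ j) → y ∉ Metric.ball (c j) (ρ j)) →
      (∀ j, edist (w j x) (w j y) ^ p ≤ S) → edist (glueBalls c ρ w h₀ x) (h₀ x) ^ p ≤ S := by
    intro x y hxy hj
    by_cases hx : ∃ j, x ∈ Metric.ball (c j) (ρ j)
    · obtain ⟨j, hx⟩ := hx
      rw [glueBalls, glue_of_mem hB.disjoint_ball w h₀ hx, hh j x hx, ← hw j y (hxy j hx)]
      exact hj j
    · push Not at hx
      rw [glueBalls, glue_of_notMem w h₀ hx, edist_self, ENNReal.zero_rpow_of_pos hp]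
      exact zero_le
  refine rpow_le_of_le_add_add hp (key x y hxy hj) (le_self_add : edist (h₀ x) (h₀ y) ^ p ≤ S)
    (key y x (fun j hy hx => hxy j hx hy) fun j => by rw [edist_comm]; exact hj j) ?_
  rw [edist_comm (glueBalls c ρ w h₀ y)]
  exact edist_triangle4 _ _ _ _

theorem gagliardoOn_comp_lipschitz_le {γ : ℝ → N} {K : ℝ≥0} (hγ : LipschitzWith K γ) {β p : ℝ}
    (hp : 0 ≤ p) (A : Set (EuclideanSpace ℝ (Fin m))) (f : EuclideanSpace ℝ (Fin m) → ℝ) :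
    gagliardoOn β p A (γ ∘ f) ≤ (K : ℝ≥0∞) ^ p * gagliardoOn β p A f := by
  rw [gagliardoOn, gagliardoOn, ← lintegral_const_mul' _ _
      (by simp [ENNReal.rpow_ne_top_of_nonneg hp])]
  refine lintegral_mono fun x => ?_
  rw [← lintegral_const_mul' _ _ (by simp [ENNReal.rpow_ne_top_of_nonneg hp])]
  refine lintegral_mono fun y => ?_
  rw [← mul_assoc, ← ENNReal.mul_rpow_of_nonneg _ _ hp]
  gcongr
  exact hγ (f x) (f y)

variable [SecondCountableTopology N] [MeasurableSpace N] [BorelSpace N]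

theorem measurable_gagliardo_integrand {w : EuclideanSpace ℝ (Fin m) → N} (hw : Measurable w)
    (β p : ℝ) : Measurable fun z : EuclideanSpace ℝ (Fin m) × EuclideanSpace ℝ (Fin m) =>
      edist (w z.1) (w z.2) ^ p * ‖z.1 - z.2‖ₑ ^ (-β) :=
  (((hw.comp measurable_fst).edist (hw.comp measurable_snd)).pow_const _).mul
    (measurable_enorm_sub_rpow _)

theorem gagliardoOn_univ_eq_lintegral_prod {w : EuclideanSpace ℝ (Fin m) → N}
    (hw : AEMeasurable w volume) (β p : ℝ) :
    gagliardoOn β p univ w = ∫⁻ z : EuclideanSpace ℝ (Fin m) × EuclideanSpace ℝ (Fin m),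
      edist (w z.1) (w z.2) ^ p * ‖z.1 - z.2‖ₑ ^ (-β) := by
  simp only [gagliardoOn, Measure.restrict_univ]
  rw [Measure.volume_eq_prod, lintegral_prod]
  exact ((hw.comp_fst.edist hw.comp_snd).pow_const _).mul
    (measurable_enorm_sub_rpow _).aemeasurable

theorem gagliardoOn_glueBalls_le {J : Type} [Countable J] {c : J → EuclideanSpace ℝ (Fin m)}
    {ρ : J → ℝ} (hB : DisjointBalls c ρ) {w : J → EuclideanSpace ℝ (Fin m) → N}
    {h₀ : EuclideanSpace ℝ (Fin m) → N} {b : J → N} (hwm : ∀ j, NullMeasurable (w j) volume)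
    (hhm : NullMeasurable h₀ volume) (hw : ∀ j, ∀ x ∉ Metric.ball (c j) (ρ j), w j x = b j)
    (hh : ∀ j, ∀ x ∈ Metric.ball (c j) (ρ j), h₀ x = b j) {β p : ℝ} (hp : 0 < p) :
    gagliardoOn β p univ (glueBalls c ρ w h₀)
      ≤ 3 ^ p * (gagliardoOn β p univ h₀ + ∑' j, gagliardoOn β p univ (w j)) := by
  have hgm := nullMeasurable_glue hB.disjoint_ball (fun _ => measurableSet_ball) hwm hhm
  have hm : ∀ {w : EuclideanSpace ℝ (Fin m) → N}, AEMeasurable w volume → AEMeasurable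
      (fun z : EuclideanSpace ℝ (Fin m) × EuclideanSpace ℝ (Fin m) =>
        edist (w z.1) (w z.2) ^ p * ‖z.1 - z.2‖ₑ ^ (-β)) (volume.prod volume) := fun hw =>
    ((hw.comp_fst.edist hw.comp_snd).pow_const _).mul (measurable_enorm_sub_rpow _).aemeasurable
  rw [gagliardoOn_univ_eq_lintegral_prod hgm.aemeasurable,
    gagliardoOn_univ_eq_lintegral_prod hhm.aemeasurable]
  simp_rw [fun j => gagliardoOn_univ_eq_lintegral_prod (hwm j).aemeasurable β p]
  rw [Measure.volume_eq_prod, ← lintegral_tsum fun j => hm (hwm j).aemeasurable,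
    ← lintegral_add_left' (hm hhm.aemeasurable),
    ← lintegral_const_mul' _ _ (ENNReal.rpow_ne_top_of_nonneg hp.le (by simp))]
  refine lintegral_mono fun z => ?_
  rw [ENNReal.tsum_mul_right, ← add_mul, ← mul_assoc]
  exact mul_le_mul_left (edist_glueBalls_rpow_le hB hw hh hp z.1 z.2) _

end Gagliardo

/-! ### The Gagliardo energy of logarithmic cutoff functions -/

section LogCutoffEnergy

variable {m : ℕ}

theorem enorm_logCutoff_sub_le {L : ℝ} (hL : 0 < L) {x y : EuclideanSpace ℝ (Fin m)}
    (hx : 0 < ‖x‖) (hxy : ‖x‖ ≤ ‖y‖) :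
    edist (logCutoff L x) (logCutoff L y)
      ≤ ENNReal.ofReal L⁻¹ * ENNReal.ofReal (Real.log (‖y‖ / ‖x‖)) := by
  rw [edist_dist, Real.dist_eq, ← ENNReal.ofReal_mul (by positivity)]
  exact ENNReal.ofReal_le_ofReal (abs_logCutoff_sub_le hL hx hxy)

/-- Contribution of the points `x` close to `y`, where the cutoff function is Lipschitz. -/
theorem exists_lintegral_near_le (hm : 0 < m) {σ p : ℝ} (hp : 0 < p) (hσp : σ < p) :
    ∃ C : ℝ≥0, ∀ L : ℝ, 0 < L → ∀ y : EuclideanSpace ℝ (Fin m), y ≠ 0 →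
      ∫⁻ x in {x | ‖x‖ ≤ ‖y‖ ∧ ‖x - y‖ < ‖y‖ / 2},
        edist (logCutoff L x) (logCutoff L y) ^ p * ‖x - y‖ₑ ^ (-(m + σ))
      ≤ C * ENNReal.ofReal (L ^ (-p)) * ‖y‖ₑ ^ (-σ) := by
  obtain ⟨C, hC⟩ := exists_lintegral_ball_enorm_rpow_le hm (β := m + σ - p) (by linarith)
  refine ⟨C * (2 ^ p * 2 ^ (σ - p) : ℝ).toNNReal, fun L hL y hy => ?_⟩
  have hy0 : 0 < ‖y‖ := norm_pos_iff.2 hy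
  set c : ℝ := L⁻¹ * (2 / ‖y‖) with hc
  have hc0 : 0 < c := by positivity
  have hA : MeasurableSet {x : EuclideanSpace ℝ (Fin m) | ‖x‖ ≤ ‖y‖ ∧ ‖x - y‖ < ‖y‖ / 2} :=
    (measurableSet_le measurable_norm measurable_const).inter
      (measurableSet_lt (measurable_id.sub_const y).norm measurable_const)
  calc ∫⁻ x in {x | ‖x‖ ≤ ‖y‖ ∧ ‖x - y‖ < ‖y‖ / 2},
        edist (logCutoff L x) (logCutoff L y) ^ p * ‖x - y‖ₑ ^ (-(m + σ))
      ≤ ∫⁻ x in {x | ‖x‖ ≤ ‖y‖ ∧ ‖x - y‖ < ‖y‖ / 2},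
          ENNReal.ofReal (c ^ p) * ‖x - y‖ₑ ^ (-(m + σ - p)) := by
        refine setLIntegral_mono' hA fun x hx => ?_
        have hxy : ‖y‖ ≤ ‖x‖ + ‖x - y‖ := by
          have := norm_sub_norm_le y x
          rw [norm_sub_rev] at this; linarith
        have hx2 : ‖y‖ / 2 ≤ ‖x‖ := by linarith [hx.2]
        have hx0 : 0 < ‖x‖ := by linarith
        have h1 : edist (logCutoff L x) (logCutoff L y) ≤ ENNReal.ofReal c * ‖x - y‖ₑ := by
          refine (enorm_logCutoff_sub_le hL hx0 hx.1).trans ?_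
          rw [← ofReal_norm, ← ENNReal.ofReal_mul (by positivity), ← ENNReal.ofReal_mul hc0.le]
          refine ENNReal.ofReal_le_ofReal ?_
          rw [hc, mul_assoc]
          gcongr
          refine (log_div_le hx0 hy0).trans ?_
          rw [div_mul_eq_mul_div, div_le_div_iff₀ hx0 hy0]
          nlinarith [norm_nonneg (x - y)]
        by_cases hd : x = y
        · subst hd
          rw [edist_self, ENNReal.zero_rpow_of_pos hp, zero_mul]
          exact zero_le
        have hd0 : ‖x - y‖ₑ ≠ 0 := by simpa [sub_eq_zero] using hd
        calc edist (logCutoff L x) (logCutoff L y) ^ p * ‖x - y‖ₑ ^ (-(m + σ))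
            ≤ (ENNReal.ofReal c * ‖x - y‖ₑ) ^ p * ‖x - y‖ₑ ^ (-(m + σ)) := by gcongr
          _ = _ := by
            rw [ENNReal.mul_rpow_of_nonneg _ _ hp.le, ENNReal.ofReal_rpow_of_pos hc0, mul_assoc,
              ← ENNReal.rpow_add _ _ hd0 enorm_ne_top]
            congr 2; ring
    _ ≤ ENNReal.ofReal (c ^ p) * ∫⁻ x in {x | ‖x - y‖ < ‖y‖ / 2}, ‖x - y‖ₑ ^ (-(m + σ - p)) := by
        rw [← lintegral_const_mul' _ _ ENNReal.ofReal_ne_top]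
        exact lintegral_mono_set fun x hx => hx.2
    _ = ENNReal.ofReal (c ^ p) * ∫⁻ x in Metric.ball (0 : EuclideanSpace ℝ (Fin m)) (‖y‖ / 2),
        ‖x‖ₑ ^ (-(m + σ - p)) := by
        congr 1
        have hB : MeasurableSet {x : EuclideanSpace ℝ (Fin m) | ‖x - y‖ < ‖y‖ / 2} :=
          measurableSet_lt (by fun_prop) measurable_const
        rw [← lintegral_indicator hB, ← lintegral_indicator measurableSet_ball]
        refine Eq.trans ?_ (lintegral_sub_right_eq_self (μ := volume) _ y)
        refine lintegral_congr fun x => ?_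
        simp only [indicator, mem_ofPred_eq, mem_ball_zero_iff]
    _ ≤ ENNReal.ofReal (c ^ p) * (C * ENNReal.ofReal ((‖y‖ / 2) ^ (m - (m + σ - p)))) := by
        gcongr; exact hC _ (by positivity)
    _ = _ := by
        rw [enorm_rpow_eq_ofReal hy, ENNReal.coe_mul, mul_left_comm, mul_assoc, mul_assoc]
        congr 1
        change _ = ENNReal.ofReal _ * _
        rw [← ENNReal.ofReal_mul (by positivity), ← ENNReal.ofReal_mul (by positivity),
          ← ENNReal.ofReal_mul (by positivity)]
        congr 1
        have e1 : ‖y‖ ^ (-σ) = ‖y‖ ^ (p - σ) / ‖y‖ ^ p := by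
          rw [← Real.rpow_sub hy0]; congr 1; ring
        have e2 : (2 : ℝ) ^ (σ - p) = (2 ^ (p - σ))⁻¹ := by
          rw [← Real.rpow_neg two_pos.le]; congr 1; ring
        rw [hc, Real.mul_rpow (by positivity) (by positivity), Real.inv_rpow hL.le,
          ← Real.rpow_neg hL.le, Real.div_rpow (by positivity) hy0.le,
          show (m : ℝ) - (m + σ - p) = p - σ by ring, Real.div_rpow hy0.le (by positivity), e1, e2]
        generalize ‖y‖ ^ (p - σ) = u
        field_simp

/-- Contribution of the points `x` far from `y`, where the kernel is bounded. -/
theorem exists_lintegral_far_le (hm : 0 < m) {σ p : ℝ} (hσ : 0 < σ) (hp : 0 < p) :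
    ∃ C : ℝ≥0, ∀ L : ℝ, 0 < L → ∀ y : EuclideanSpace ℝ (Fin m), y ≠ 0 → ∀ r : ℝ, 0 < r → r ≤ ‖y‖ →
      (r = ‖y‖ ∨ r = 1) →
      ∫⁻ x in {x | ‖x‖ ≤ r ∧ ‖y‖ / 2 ≤ ‖x - y‖},
        edist (logCutoff L x) (logCutoff L y) ^ p * ‖x - y‖ₑ ^ (-(m + σ))
      ≤ C * ENNReal.ofReal (L ^ (-p)) * ENNReal.ofReal (r ^ m) * ‖y‖ₑ ^ (-(m + σ)) := by
  obtain ⟨C, hC⟩ := exists_lintegral_log_le hm hp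
  refine ⟨C * (2 ^ (m + σ) : ℝ).toNNReal, fun L hL y hy r hr hry hr' => ?_⟩
  have hy0 : 0 < ‖y‖ := norm_pos_iff.2 hy
  have hA : MeasurableSet {x : EuclideanSpace ℝ (Fin m) | ‖x‖ ≤ r ∧ ‖y‖ / 2 ≤ ‖x - y‖} :=
    (measurableSet_le measurable_norm measurable_const).inter
      (measurableSet_le measurable_const (measurable_id.sub_const y).norm)
  have hpt : ∀ᵐ x : EuclideanSpace ℝ (Fin m), x ∈ {x | ‖x‖ ≤ r ∧ ‖y‖ / 2 ≤ ‖x - y‖} →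
      edist (logCutoff L x) (logCutoff L y) ^ p * ‖x - y‖ₑ ^ (-(m + σ))
      ≤ (ENNReal.ofReal (L ^ (-p)) * ENNReal.ofReal ((‖y‖ / 2) ^ (-(m + σ)))) *
        ENNReal.ofReal (Real.log (r / ‖x‖)) ^ p := by
    filter_upwards [ae_ne_zero hm] with x hx0 hx
    have hx0' : 0 < ‖x‖ := norm_pos_iff.2 hx0
    have hxy0 : 0 < ‖x - y‖ := lt_of_lt_of_le (by positivity) hx.2
    have h1 : edist (logCutoff L x) (logCutoff L y)
        ≤ ENNReal.ofReal L⁻¹ * ENNReal.ofReal (Real.log (r / ‖x‖)) := by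
      rcases hr' with rfl | rfl
      · exact enorm_logCutoff_sub_le hL hx0' hx.1
      · -- the cutoff is constant outside the unit ball
        have he : ‖‖y‖⁻¹ • y‖ = 1 := norm_smul_inv_norm (𝕜 := ℝ) hy
        have := enorm_logCutoff_sub_le hL hx0' (y := ‖y‖⁻¹ • y) (he ▸ hx.1)
        have hF : logCutoff L (‖y‖⁻¹ • y) = logCutoff L y := by
          rw [logCutoff_of_ge hL he.ge, logCutoff_of_ge hL hry]
        rwa [he, hF] at this
    have h2 : ‖x - y‖ₑ ^ (-(m + σ)) ≤ ENNReal.ofReal ((‖y‖ / 2) ^ (-(m + σ))) := by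
      rw [enorm_rpow_eq_ofReal (norm_pos_iff.1 hxy0)]
      exact ENNReal.ofReal_le_ofReal
        (Real.rpow_le_rpow_of_nonpos (by positivity) hx.2
            (by linarith [(Nat.cast_nonneg m : (0 : ℝ) ≤ m)]))
    calc edist (logCutoff L x) (logCutoff L y) ^ p * ‖x - y‖ₑ ^ (-(m + σ))
        ≤ (ENNReal.ofReal L⁻¹ * ENNReal.ofReal (Real.log (r / ‖x‖))) ^ p *
          ENNReal.ofReal ((‖y‖ / 2) ^ (-(m + σ))) := by gcongr
      _ = _ := by
        rw [ENNReal.mul_rpow_of_nonneg _ _ hp.le, ENNReal.ofReal_rpow_of_pos (by positivity),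
          Real.inv_rpow hL.le, ← Real.rpow_neg hL.le]
        ring
  calc ∫⁻ x in {x | ‖x‖ ≤ r ∧ ‖y‖ / 2 ≤ ‖x - y‖},
        edist (logCutoff L x) (logCutoff L y) ^ p * ‖x - y‖ₑ ^ (-(m + σ))
      ≤ ∫⁻ x in {x | ‖x‖ ≤ r ∧ ‖y‖ / 2 ≤ ‖x - y‖},
        (ENNReal.ofReal (L ^ (-p)) * ENNReal.ofReal ((‖y‖ / 2) ^ (-(m + σ)))) *
          ENNReal.ofReal (Real.log (r / ‖x‖)) ^ p := setLIntegral_mono_ae' hA hpt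
    _ ≤ (ENNReal.ofReal (L ^ (-p)) * ENNReal.ofReal ((‖y‖ / 2) ^ (-(m + σ)))) *
          ∫⁻ x in Metric.closedBall (0 : EuclideanSpace ℝ (Fin m)) r,
              ENNReal.ofReal (Real.log (r / ‖x‖)) ^ p := by
        rw [← lintegral_const_mul' _ _ (ENNReal.mul_ne_top ENNReal.ofReal_ne_top
            ENNReal.ofReal_ne_top)]
        exact lintegral_mono_set fun x hx => mem_closedBall_zero_iff.2 hx.1
    _ ≤ (ENNReal.ofReal (L ^ (-p)) * ENNReal.ofReal ((‖y‖ / 2) ^ (-(m + σ)))) *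
          (C * ENNReal.ofReal (r ^ m)) := by gcongr; exact hC r hr
    _ = _ := by
        have : ENNReal.ofReal ((‖y‖ / 2) ^ (-(m + σ)))
            = ((2 ^ (m + σ) : ℝ).toNNReal : ℝ≥0∞) * ‖y‖ₑ ^ (-(m + σ)) := by
          rw [enorm_rpow_eq_ofReal hy]
          change _ = ENNReal.ofReal _ * _
          rw [← ENNReal.ofReal_mul (by positivity)]
          congr 1
          rw [Real.div_rpow hy0.le (by positivity), Real.rpow_neg two_pos.le, div_inv_eq_mul,
              mul_comm]
        rw [this, ENNReal.coe_mul]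
        ring

/-- By symmetry it suffices to integrate over the pairs with `‖x‖ ≤ ‖y‖`, where the pairs of close
points and those of distant points are estimated separately. -/
theorem exists_gagliardoOn_logCutoff_le (hm : 0 < m) {σ p : ℝ} (hσ : 0 < σ) (hσp : σ < p) :
    ∃ C : ℝ≥0, ∀ L : ℝ, 0 < L →
      gagliardoOn (m + σ) p univ (logCutoff (m := m) L)
        ≤ C * (ENNReal.ofReal (L ^ (-p)) * (1 + annulusIntegral m σ L)) := by
  have hp : 0 < p := hσ.trans hσp
  obtain ⟨C₁, hC₁⟩ := exists_lintegral_near_le hm hp hσp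
  obtain ⟨C₂, hC₂⟩ := exists_lintegral_far_le hm hσ hp
  obtain ⟨C₃, hC₃⟩ := exists_lintegral_compl_ball_enorm_rpow_le (m := m) (β := m + σ) (by linarith)
  set c₃ : ℝ≥0 := C₃ * (2 ^ ((m : ℝ) - (m + σ)) : ℝ).toNNReal with hc₃
  have hc₃' : ∫⁻ z in (Metric.ball (0 : EuclideanSpace ℝ (Fin m)) 2)ᶜ, ‖z‖ₑ ^ (-(m + σ)) ≤ c₃ := by
    rw [hc₃, ENNReal.coe_mul]; exact hC₃ 2 two_pos
  refine ⟨2 * ((C₁ + C₂) + C₂ * c₃), fun L hL => ?_⟩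
  set P := ENNReal.ofReal (L ^ (-p)) with hP
  set k : EuclideanSpace ℝ (Fin m) → EuclideanSpace ℝ (Fin m) → ℝ≥0∞ := fun x y =>
    edist (logCutoff L x) (logCutoff L y) ^ p * ‖x - y‖ₑ ^ (-(m + σ)) with hk
  have hkm : Measurable (Function.uncurry k) :=
    measurable_gagliardo_integrand (lipschitzWith_logCutoff hL).continuous.measurable _ _
  have hksymm : ∀ x y, k x y = k y x := fun x y => by
    simp only [hk]
    rw [edist_comm, enorm_sub_rev]
  set T : Set (EuclideanSpace ℝ (Fin m) × EuclideanSpace ℝ (Fin m)) := {z | ‖z.1‖ ≤ ‖z.2‖} with hT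
  have hTm : MeasurableSet T := measurableSet_le measurable_fst.norm measurable_snd.norm
  set k' : EuclideanSpace ℝ (Fin m) → EuclideanSpace ℝ (Fin m) → ℝ≥0∞ := fun x y =>
    T.indicator (Function.uncurry k) (x, y) with hk'
  have hk'm : Measurable (Function.uncurry k') := hkm.indicator hTm
  -- by symmetry, only the pairs with `‖x‖ ≤ ‖y‖` matter
  have hsymm : gagliardoOn (m + σ) p univ (logCutoff (m := m) L) ≤ 2 * ∫⁻ y, ∫⁻ x, k' x y := by
    have h1 : ∀ x y, k x y ≤ k' x y + k' y x := fun x y => by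
      rcases le_total ‖x‖ ‖y‖ with h | h
      · have : k' x y = k x y := indicator_of_mem (s := T) (by exact h) _
        rw [this]; exact le_self_add
      · have : k' y x = k y x := indicator_of_mem (s := T) (by exact h) _
        rw [this, hksymm]; exact le_add_self
    simp only [gagliardoOn, Measure.restrict_univ]
    calc ∫⁻ x, ∫⁻ y, k x y ≤ ∫⁻ x, ∫⁻ y, (k' x y + k' y x) :=
          lintegral_mono fun x => lintegral_mono fun y => h1 x y
      _ = ∫⁻ x, ((∫⁻ y, k' x y) + ∫⁻ y, k' y x) := by
          refine lintegral_congr fun x => ?_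
          exact lintegral_add_left (hk'm.comp measurable_prodMk_left) _
      _ = (∫⁻ x, ∫⁻ y, k' x y) + ∫⁻ x, ∫⁻ y, k' y x :=
          lintegral_add_left hk'm.lintegral_prod_right _
      _ = 2 * ∫⁻ y, ∫⁻ x, k' x y := by
          rw [lintegral_lintegral_swap hk'm.aemeasurable, two_mul]
  set A : Set (EuclideanSpace ℝ (Fin m)) := {x | Real.exp (-L) < ‖x‖ ∧ ‖x‖ < 2} with hA
  have hexp1 : Real.exp (-L) < 1 := by rw [Real.exp_lt_one_iff]; linarith
  have hinner : ∀ y, ∫⁻ x, k' x y ≤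
      A.indicator (fun y => (C₁ + C₂) * P * ‖y‖ₑ ^ (-σ)) y +
      ((Metric.ball (0 : EuclideanSpace ℝ (Fin m)) 2)ᶜ).indicator
        (fun y => C₂ * P * ‖y‖ₑ ^ (-(m + σ))) y := by
    intro y
    have hk's : ∫⁻ x, k' x y = ∫⁻ x in {x | ‖x‖ ≤ ‖y‖}, k x y := by
      rw [← lintegral_indicator (measurableSet_le measurable_norm measurable_const)]
      exact lintegral_congr fun x => rfl
    rw [hk's]
    rcases le_or_gt ‖y‖ (Real.exp (-L)) with h | h
    · have : ∫⁻ x in {x | ‖x‖ ≤ ‖y‖}, k x y = 0 := by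
        refine (setLIntegral_congr_fun (g := fun _ => 0)
          (measurableSet_le measurable_norm measurable_const) fun x hx => ?_).trans (by simp)
        simp only [hk]
        rw [logCutoff_of_le hL h, logCutoff_of_le hL (le_trans hx h), edist_self,
          ENNReal.zero_rpow_of_pos hp, zero_mul]
      rw [this]; exact zero_le
    have hy0 : 0 < ‖y‖ := (Real.exp_pos _).trans h
    have hy : y ≠ 0 := norm_pos_iff.1 hy0
    rcases lt_or_ge ‖y‖ 2 with h2 | h2
    · refine le_trans ?_ le_self_add
      rw [indicator_of_mem (show y ∈ A from ⟨h, h2⟩)]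
      have hsub : {x : EuclideanSpace ℝ (Fin m) | ‖x‖ ≤ ‖y‖} ⊆
          {x | ‖x‖ ≤ ‖y‖ ∧ ‖x - y‖ < ‖y‖ / 2} ∪ {x | ‖x‖ ≤ ‖y‖ ∧ ‖y‖ / 2 ≤ ‖x - y‖} :=
              fun x hx => by
        rcases lt_or_ge ‖x - y‖ (‖y‖ / 2) with h3 | h3
        · exact Or.inl ⟨hx, h3⟩
        · exact Or.inr ⟨hx, h3⟩
      refine (lintegral_mono_set hsub).trans ((lintegral_union_le _ _ _).trans
        ((add_le_add (hC₁ L hL y hy) (hC₂ L hL y hy ‖y‖ hy0 le_rfl (Or.inl rfl))).trans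
            (le_of_eq ?_)))
      rw [mul_assoc (C₂ * P), enorm_rpow_eq_ofReal hy, enorm_rpow_eq_ofReal hy,
        ← ENNReal.ofReal_mul (by positivity)]
      have : ‖y‖ ^ m * ‖y‖ ^ (-(m + σ)) = ‖y‖ ^ (-σ) := by
        rw [← Real.rpow_natCast ‖y‖ m, ← Real.rpow_add hy0]; congr 1; ring
      rw [this]; ring
    · refine le_trans ?_ le_add_self
      have hy2 : y ∈ (Metric.ball (0 : EuclideanSpace ℝ (Fin m)) 2)ᶜ := by simpa using h2
      rw [indicator_of_mem hy2]
      have hcongr : ∫⁻ x in {x | ‖x‖ ≤ ‖y‖}, k x y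
          ≤ ∫⁻ x in {x | ‖x‖ ≤ 1 ∧ ‖y‖ / 2 ≤ ‖x - y‖}, k x y := by
        have hm1 : MeasurableSet {x : EuclideanSpace ℝ (Fin m) | ‖x‖ ≤ 1 ∧ ‖y‖ / 2 ≤ ‖x - y‖} :=
          (measurableSet_le measurable_norm measurable_const).inter
            (measurableSet_le measurable_const (measurable_id.sub_const y).norm)
        refine (setLIntegral_le_lintegral _ _).trans ?_
        rw [← lintegral_indicator hm1]
        refine lintegral_mono fun x => ?_
        by_cases hx : ‖x‖ ≤ 1
        · rw [indicator_of_mem]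
          refine ⟨hx, ?_⟩
          have := norm_sub_norm_le y x
          rw [norm_sub_rev] at this
          linarith
        · simp only [hk]
          rw [logCutoff_of_ge hL (not_le.1 hx).le, logCutoff_of_ge hL (by linarith : 1 ≤ ‖y‖),
            edist_self, ENNReal.zero_rpow_of_pos hp, zero_mul]
          exact zero_le
      refine hcongr.trans ((hC₂ L hL y hy 1 one_pos (by linarith) (Or.inr rfl)).trans (le_of_eq ?_))
      rw [one_pow, ENNReal.ofReal_one, mul_one]
  calc gagliardoOn (m + σ) p univ (logCutoff (m := m) L) ≤ 2 * ∫⁻ y, ∫⁻ x, k' x y := hsymm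
    _ ≤ 2 * ((C₁ + C₂) * P * annulusIntegral m σ L + C₂ * P * c₃) := by
        gcongr
        refine (lintegral_mono hinner).trans ?_
        have hAm : MeasurableSet A := measurableSet_annulus _ _
        have htop : ∀ c : ℝ≥0, (c : ℝ≥0∞) * P ≠ ⊤ := fun c =>
          ENNReal.mul_ne_top ENNReal.coe_ne_top ENNReal.ofReal_ne_top
        rw [lintegral_add_left, lintegral_indicator hAm,
            lintegral_indicator measurableSet_ball.compl,
          lintegral_const_mul' _ _ (by exact_mod_cast htop (C₁ + C₂)),
          lintegral_const_mul' _ _ (htop C₂)]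
        · gcongr
          exact le_rfl
        · exact ((measurable_enorm.pow_const _).const_mul _).indicator hAm
    _ ≤ _ := by
        push_cast
        calc 2 * (((C₁ : ℝ≥0∞) + C₂) * P * annulusIntegral m σ L + C₂ * P * c₃)
            ≤ 2 * (((C₁ : ℝ≥0∞) + C₂) * P * (1 + annulusIntegral m σ L)
              + C₂ * P * c₃ * (1 + annulusIntegral m σ L)) := by
              exact mul_le_mul_right (add_le_add (mul_le_mul_right le_add_self _)
                (le_mul_of_one_le_right zero_le le_self_add)) _
          _ = _ := by ring

end LogCutoffEnergy

/-! ### Extension of maps of finite Gagliardo energy -/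

section FractionalExtension

variable {m : ℕ} {N : Type*} [EMetricSpace N]

/-- The contribution of the intermediate point `z` to the energy of `w ∘ Φ` between `x` and `y`. -/
noncomputable def midpointKernel (Φ : EuclideanSpace ℝ (Fin m) → EuclideanSpace ℝ (Fin m))
    (w : EuclideanSpace ℝ (Fin m) → N) (p e : ℝ) (x y z : EuclideanSpace ℝ (Fin m)) : ℝ≥0∞ :=
  {z | ‖Φ x - z‖ ≤ 7 * ‖x - y‖}.indicator (fun z => edist (w (Φ x)) (w z) ^ p) z * ‖x - y‖ₑ ^ (-e)

/-- Integrating the kernel in `y` turns it back into a kernel of Gagliardo type. -/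
theorem exists_lintegral_midpointKernel_le {σ p : ℝ} (hσ : 0 < σ) (hp : 0 < p) : ∃ C : ℝ≥0,
    ∀ (Φ : EuclideanSpace ℝ (Fin m) → EuclideanSpace ℝ (Fin m)) (w : EuclideanSpace ℝ (Fin m) → N)
        (x z : EuclideanSpace ℝ (Fin m)),
      ∫⁻ y, midpointKernel Φ w p (m + (m + σ)) x y z
        ≤ C * (edist (w (Φ x)) (w z) ^ p * ‖Φ x - z‖ₑ ^ (-(m + σ))) := by
  obtain ⟨C₁, hC₁⟩ := exists_lintegral_compl_ball_enorm_rpow_le (m := m) (β := m + (m + σ))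
    (by have : (0 : ℝ) ≤ m := by positivity
        linarith)
  refine ⟨C₁ * (7 ^ (m + σ) : ℝ).toNNReal, fun Φ w x z => ?_⟩
  by_cases hz : z = Φ x
  · have : ∀ y, midpointKernel Φ w p (m + (m + σ)) x y z = 0 := fun y => by
      rw [midpointKernel, indicator_of_mem
          (by rw [mem_ofPred_eq, hz, sub_self, norm_zero]; positivity),
        hz, edist_self, ENNReal.zero_rpow_of_pos hp, zero_mul]
    simp [this]
  have hz0 : 0 < ‖Φ x - z‖ := norm_pos_iff.2 (sub_ne_zero.2 (Ne.symm hz))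
  have hS : MeasurableSet ((Metric.ball (0 : EuclideanSpace ℝ (Fin m)) (‖Φ x - z‖ / 7))ᶜ) :=
      measurableSet_ball.compl
  calc ∫⁻ y, midpointKernel Φ w p (m + (m + σ)) x y z
      ≤ ∫⁻ y, edist (w (Φ x)) (w z) ^ p *
          ((Metric.ball (0 : EuclideanSpace ℝ (Fin m)) (‖Φ x - z‖ / 7))ᶜ.indicator
            (fun y => ‖y‖ₑ ^ (-(m + (m + σ)))) (x - y)) := by
        refine lintegral_mono fun y => ?_
        rw [midpointKernel]
        by_cases hy : ‖Φ x - z‖ ≤ 7 * ‖x - y‖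
        · rw [indicator_of_mem (mem_ofPred_eq ▸ hy), indicator_of_mem]
          rw [mem_compl_iff, mem_ball_zero_iff, not_lt]
          linarith
        · rw [indicator_of_notMem (mem_ofPred_eq ▸ hy), zero_mul]
          exact zero_le
    _ = edist (w (Φ x)) (w z) ^ p *
          ∫⁻ y in (Metric.ball (0 : EuclideanSpace ℝ (Fin m)) (‖Φ x - z‖ / 7))ᶜ,
              ‖y‖ₑ ^ (-(m + (m + σ))) := by
        rw [lintegral_const_mul, lintegral_sub_left_eq_self (μ := volume) _ x,
          lintegral_indicator hS]
        exact ((measurable_enorm.pow_const _).indicator hS).comp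
            (measurable_const.sub measurable_id)
    _ ≤ edist (w (Φ x)) (w z) ^ p *
          (C₁ * ENNReal.ofReal ((‖Φ x - z‖ / 7) ^ ((m : ℝ) - (m + (m + σ))))) := by
        gcongr; exact hC₁ _ (by positivity)
    _ = _ := by
        rw [enorm_rpow_eq_ofReal (sub_ne_zero.2 (Ne.symm hz)), mul_left_comm, ENNReal.coe_mul,
          mul_assoc]
        congr 1
        rw [mul_left_comm]
        congr 1
        rw [show (m : ℝ) - (m + (m + σ)) = -(m + σ) by ring,
          Real.div_rpow (by positivity) (by positivity),
          Real.rpow_neg (by positivity : (0 : ℝ) ≤ 7),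
          div_inv_eq_mul, mul_comm, ENNReal.ofReal_mul (by positivity)]
        rfl

/-- If `w = b` outside the ball of radius `3 / 2`, then the interaction of `x` with the exterior of
the ball of radius `2` is controlled by its interaction with the ball. -/
theorem exists_lintegral_compl_gagliardo_le (hm : 0 < m) {σ p : ℝ} (hσ : 0 < σ) (hp : 0 < p) :
    ∃ C : ℝ≥0, ∀ (w : EuclideanSpace ℝ (Fin m) → N) (b : N), (∀ x, 3 / 2 ≤ ‖x‖ → w x = b)
      → ∀ x : EuclideanSpace ℝ (Fin m),
      ∫⁻ y in (Metric.ball 0 2)ᶜ, edist (w x) (w y) ^ p * ‖x - y‖ₑ ^ (-(m + σ))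
        ≤ C * ∫⁻ y in Metric.ball 0 2, edist (w x) (w y) ^ p * ‖x - y‖ₑ ^ (-(m + σ)) := by
  have : Nonempty (Fin m) := ⟨⟨0, hm⟩⟩
  have hmσ : 0 < m + σ := by positivity
  obtain ⟨C₁, hC₁⟩ := exists_lintegral_compl_ball_enorm_rpow_le (m := m) (β := m + σ) (by linarith)
  obtain ⟨A, hA⟩ : ∃ A : Set (EuclideanSpace ℝ (Fin m)),
      A = Metric.ball 0 2 \ Metric.closedBall 0 (3 / 2) := ⟨_, rfl⟩
  have hAm : MeasurableSet A := hA ▸ measurableSet_ball.diff measurableSet_closedBall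
  have hA0 : volume A ≠ 0 := by
    rw [hA]
    refine (IsOpen.measure_pos volume (Metric.isOpen_ball.sdiff Metric.isClosed_closedBall) ?_).ne'
    obtain ⟨e, he⟩ := exists_norm_eq (EuclideanSpace ℝ (Fin m)) (show (0 : ℝ) ≤ 7 / 4 by norm_num)
    exact ⟨e, by simp [he]; norm_num⟩
  have hAt : volume A ≠ ⊤ := by
    rw [hA]
    exact ((measure_mono sdiff_subset).trans_lt measure_ball_lt_top).ne
  obtain ⟨κ, hκ⟩ : ∃ κ : ℝ≥0∞, κ = ENNReal.ofReal (4 ^ (-(m + σ))) * volume A := ⟨_, rfl⟩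
  have hκ0 : κ ≠ 0 := by
    rw [hκ]
    refine mul_ne_zero ?_ hA0
    rw [Ne, ENNReal.ofReal_eq_zero, not_le]
    positivity
  have hκt : κ ≠ ⊤ := hκ ▸ ENNReal.mul_ne_top ENNReal.ofReal_ne_top hAt
  obtain ⟨C₂, hC₂⟩ : ∃ C₂ : ℝ≥0, (C₁ : ℝ≥0∞) * ENNReal.ofReal ((1 / 2 : ℝ) ^ ((m : ℝ) - (m + σ))) =
    C₂ := ⟨C₁ * ((1 / 2 : ℝ) ^ ((m : ℝ) - (m + σ))).toNNReal, by rw [ENNReal.coe_mul]; rfl⟩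
  obtain ⟨κ', hκ'⟩ : ∃ κ' : ℝ≥0, (κ' : ℝ≥0∞) = κ⁻¹ :=
    ⟨κ⁻¹.toNNReal, ENNReal.coe_toNNReal (by simp [hκ0])⟩
  refine ⟨C₂ * κ', fun w b hb x => ?_⟩
  have hbc : ∀ y ∈ (Metric.ball (0 : EuclideanSpace ℝ (Fin m)) 2)ᶜ, w y = b := fun y hy => hb y (by
    rw [mem_compl_iff, mem_ball_zero_iff, not_lt] at hy
    linarith)
  by_cases hx' : 3 / 2 ≤ ‖x‖
  · refine le_of_eq_of_le ((setLIntegral_congr_fun measurableSet_ball.compl fun y hy => ?_).trans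
      lintegral_zero) zero_le
    rw [hb x hx', hbc y hy, edist_self, ENNReal.zero_rpow_of_pos hp, zero_mul]
  rw [not_le] at hx'
  have hup : ∫⁻ y in (Metric.ball 0 2)ᶜ, edist (w x) (w y) ^ p * ‖x - y‖ₑ ^ (-(m + σ))
      ≤ C₂ * edist (w x) b ^ p := by
    calc _ ≤ ∫⁻ y in (Metric.ball 0 2)ᶜ, edist (w x) b ^ p *
          ((Metric.ball (0 : EuclideanSpace ℝ (Fin m)) (1 / 2))ᶜ.indicator
              (fun y => ‖y‖ₑ ^ (-(m + σ))) (x - y)) := by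
          refine setLIntegral_mono' measurableSet_ball.compl fun y hy => ?_
          rw [hbc y hy, indicator_of_mem]
          rw [mem_compl_iff, mem_ball_zero_iff, not_lt] at hy ⊢
          have := norm_sub_norm_le y x
          rw [norm_sub_rev] at this
          linarith
      _ ≤ ∫⁻ y, edist (w x) b ^ p *
          ((Metric.ball (0 : EuclideanSpace ℝ (Fin m)) (1 / 2))ᶜ.indicator
              (fun y => ‖y‖ₑ ^ (-(m + σ))) (x - y)) :=
          setLIntegral_le_lintegral _ _
      _ = edist (w x) b ^ p *
          ∫⁻ y in (Metric.ball (0 : EuclideanSpace ℝ (Fin m)) (1 / 2))ᶜ, ‖y‖ₑ ^ (-(m + σ)) := by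
          rw [lintegral_const_mul, lintegral_sub_left_eq_self (μ := volume) _ x,
            lintegral_indicator measurableSet_ball.compl]
          exact ((measurable_enorm.pow_const _).indicator measurableSet_ball.compl).comp
            (measurable_const.sub measurable_id)
      _ ≤ edist (w x) b ^ p * C₂ := by
          rw [← hC₂]
          gcongr
          exact hC₁ _ (by norm_num)
      _ = _ := mul_comm _ _
  have hlow : κ * edist (w x) b ^ p
      ≤ ∫⁻ y in Metric.ball 0 2, edist (w x) (w y) ^ p * ‖x - y‖ₑ ^ (-(m + σ)) := by
    calc κ * edist (w x) b ^ p
        = ∫⁻ _y in A, edist (w x) b ^ p * ENNReal.ofReal (4 ^ (-(m + σ))) := by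
          rw [setLIntegral_const, hκ]; ring
      _ ≤ ∫⁻ y in A, edist (w x) (w y) ^ p * ‖x - y‖ₑ ^ (-(m + σ)) := by
          refine setLIntegral_mono' hAm fun y hy => ?_
          rw [hA, mem_sdiff, mem_ball_zero_iff, mem_closedBall_zero_iff, not_le] at hy
          rw [hb y hy.2.le]
          have hne : x - y ≠ 0 := sub_ne_zero.2 fun h => by rw [h] at hx'; linarith [hy.2]
          rw [enorm_rpow_eq_ofReal hne]
          refine mul_le_mul_right (ENNReal.ofReal_le_ofReal
            (Real.rpow_le_rpow_of_nonpos (norm_pos_iff.2 hne) ?_ (by linarith))) _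
          exact (norm_sub_le _ _).trans (by linarith [hy.1])
      _ ≤ _ := lintegral_mono_set (hA ▸ sdiff_subset)
  calc _ ≤ C₂ * edist (w x) b ^ p := hup
    _ = C₂ * κ⁻¹ * (κ * edist (w x) b ^ p) := by
        rw [mul_assoc, ← mul_assoc κ⁻¹, ENNReal.inv_mul_cancel hκ0 hκt, one_mul]
    _ ≤ _ := by
        rw [ENNReal.coe_mul, hκ']
        exact mul_le_mul_right hlow _

variable [SecondCountableTopology N] [MeasurableSpace N] [BorelSpace N]

/-- The inner integral of the Gagliardo energy on the unit ball. -/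
noncomputable def gagliardoDensity (β p : ℝ) (w : EuclideanSpace ℝ (Fin m) → N)
    (z : EuclideanSpace ℝ (Fin m)) : ℝ≥0∞ :=
  ∫⁻ y in Metric.ball 0 1, edist (w z) (w y) ^ p * ‖z - y‖ₑ ^ (-β)

theorem measurable_gagliardoDensity {w : EuclideanSpace ℝ (Fin m) → N} (hw : Measurable w)
    (β p : ℝ) : Measurable (gagliardoDensity β p w) :=
  (measurable_gagliardo_integrand hw β p).lintegral_prod_right'

/-- The average over the points `z` of the unit ball at distance comparable to `‖x - y‖` of
`f x` and `f y` serves as an intermediate between `x` and `y`. -/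
theorem gagliardo_integrand_comp_le {Φ : EuclideanSpace ℝ (Fin m) → EuclideanSpace ℝ (Fin m)}
    (hΦ : LipschitzWith 6 Φ) (hΦ1 : ∀ x, ‖Φ x‖ ≤ 1) {w : EuclideanSpace ℝ (Fin m) → N}
    (hw : Measurable w) {β p : ℝ} (hp : 0 < p) {x y : EuclideanSpace ℝ (Fin m)} (hxy : x ≠ y)
    (hxy4 : ‖x - y‖ ≤ 4) :
    edist (w (Φ x)) (w (Φ y)) ^ p * ‖x - y‖ₑ ^ (-β)
      ≤ (3 ^ p * 8 ^ m * (volume (Metric.ball (0 : EuclideanSpace ℝ (Fin m)) 1))⁻¹) *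
      ((∫⁻ z in Metric.ball 0 1, {z | ‖Φ x - z‖ ≤ 7 * ‖x - y‖}.indicator
        (fun z => edist (w (Φ x)) (w z) ^ p) z * ‖x - y‖ₑ ^ (-(m + β))) +
      ∫⁻ z in Metric.ball 0 1, {z | ‖Φ y - z‖ ≤ 7 * ‖y - x‖}.indicator
        (fun z => edist (w (Φ y)) (w z) ^ p) z * ‖y - x‖ₑ ^ (-(m + β))) := by
  set r := ‖x - y‖ with hr
  have hr0 : 0 < r := norm_pos_iff.2 (sub_ne_zero.2 hxy)
  have hr' : ‖y - x‖ = r := norm_sub_rev y x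
  have hre : ‖y - x‖ₑ = ‖x - y‖ₑ := enorm_sub_rev y x
  set v := volume (Metric.ball (0 : EuclideanSpace ℝ (Fin m)) 1) with hv
  have hv0 : v ≠ 0 := (Metric.measure_ball_pos _ _ one_pos).ne'
  have hvt : v ≠ ⊤ := measure_ball_lt_top.ne
  -- a ball of radius `r / 8` contained in the unit ball and close to `Φ x`
  set c := (1 - r / 8) • Φ x with hc
  set W := Metric.ball c (r / 8) with hW
  have hcx : ‖c - Φ x‖ ≤ r / 8 := by
    have : c - Φ x = (-(r / 8)) • Φ x := by rw [hc]; module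
    rw [this, norm_smul, norm_neg, Real.norm_of_nonneg (by positivity)]
    nlinarith [hΦ1 x]
  have hW1 : W ⊆ Metric.ball 0 1 := by
    intro z hz
    rw [hW, Metric.mem_ball, dist_eq_norm] at hz
    rw [mem_ball_zero_iff]
    have h1 : ‖c‖ ≤ 1 - r / 8 := by
      rw [hc, norm_smul, Real.norm_of_nonneg (by linarith)]
      nlinarith [hΦ1 x]
    have := norm_sub_norm_le z c
    linarith
  have hWx : ∀ z ∈ W, ‖Φ x - z‖ ≤ 7 * r := fun z hz => by
    rw [hW, Metric.mem_ball, dist_eq_norm] at hz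
    have h2 := norm_sub_le_norm_sub_add_norm_sub (Φ x) c z
    have e1 : ‖c - z‖ = ‖z - c‖ := norm_sub_rev _ _
    have e2 : ‖Φ x - c‖ = ‖c - Φ x‖ := norm_sub_rev _ _
    linarith
  have hWy : ∀ z ∈ W, ‖Φ y - z‖ ≤ 7 * r := fun z hz => by
    rw [hW, Metric.mem_ball, dist_eq_norm] at hz
    have h1 := norm_sub_le_norm_sub_add_norm_sub (Φ y) (Φ x) z
    have h2 := norm_sub_le_norm_sub_add_norm_sub (Φ x) c z
    have h3 : ‖Φ y - Φ x‖ ≤ 6 * r := by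
      have := hΦ.dist_le_mul y x
      rw [dist_eq_norm, dist_eq_norm, hr'] at this
      simpa using this
    have e1 : ‖c - z‖ = ‖z - c‖ := norm_sub_rev _ _
    have e2 : ‖Φ x - c‖ = ‖c - Φ x‖ := norm_sub_rev _ _
    linarith
  have hWv : volume W = ENNReal.ofReal ((r / 8) ^ m) * v := by
    rw [hW, Measure.addHaar_ball_of_pos _ _ (by positivity), finrank_euclideanSpace,
        Fintype.card_fin]
  have hmeas : ∀ a : N, Measurable fun z => edist a (w z) ^ p := fun a =>
    (measurable_const.edist hw).pow_const p
  have hind : ∀ a : EuclideanSpace ℝ (Fin m), MeasurableSet {z | ‖a - z‖ ≤ 7 * r} := fun a =>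
    measurableSet_le (by fun_prop) measurable_const
  rw [hr', hre]
  set I := ∫⁻ z in Metric.ball (0 : EuclideanSpace ℝ (Fin m)) 1,
    {z | ‖Φ x - z‖ ≤ 7 * r}.indicator (fun z => edist (w (Φ x)) (w z) ^ p) z with hI
  set I' := ∫⁻ z in Metric.ball (0 : EuclideanSpace ℝ (Fin m)) 1,
    {z | ‖Φ y - z‖ ≤ 7 * r}.indicator (fun z => edist (w (Φ y)) (w z) ^ p) z with hI'
  have hk0 : ‖x - y‖ₑ ≠ 0 := by simpa [sub_eq_zero] using hxy
  have hktop : ∀ β : ℝ, ‖x - y‖ₑ ^ β ≠ ⊤ := fun β => ENNReal.rpow_ne_top_of_ne_zero hk0 enorm_ne_top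
  have hmain : edist (w (Φ x)) (w (Φ y)) ^ p * volume W ≤ 3 ^ p * (I + I') := by
    rw [← setLIntegral_const]
    calc ∫⁻ _z in W, edist (w (Φ x)) (w (Φ y)) ^ p
        ≤ ∫⁻ z in W, 3 ^ p * (edist (w (Φ x)) (w z) ^ p + edist (w (Φ y)) (w z) ^ p) := by
          refine lintegral_mono fun z => ?_
          refine rpow_le_of_le_add_add hp (le_self_add : edist (w (Φ x)) (w z) ^ p ≤ _)
            (le_add_self : edist (w (Φ y)) (w z) ^ p ≤ _)
            (le_add_self : edist (w (Φ y)) (w z) ^ p ≤ _) ?_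
          refine le_trans ?_ le_self_add
          rw [edist_comm (w (Φ y))]
          exact edist_triangle _ _ _
      _ = 3 ^ p * ((∫⁻ z in W, edist (w (Φ x)) (w z) ^ p)
          + ∫⁻ z in W, edist (w (Φ y)) (w z) ^ p) := by
          rw [lintegral_const_mul' _ _ (ENNReal.rpow_ne_top_of_nonneg hp.le (by simp)),
            lintegral_add_left (hmeas _)]
      _ ≤ 3 ^ p * (I + I') := by
          gcongr 3 ^ p * (?_ + ?_)
          · refine le_trans (le_of_eq ?_) (lintegral_mono_set hW1)
            refine setLIntegral_congr_fun measurableSet_ball fun z hz => ?_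
            exact (indicator_of_mem (s := {z | ‖Φ x - z‖ ≤ 7 * r}) (hWx z hz)
              fun z => edist (w (Φ x)) (w z) ^ p).symm
          · refine le_trans (le_of_eq ?_) (lintegral_mono_set hW1)
            refine setLIntegral_congr_fun measurableSet_ball fun z hz => ?_
            exact (indicator_of_mem (s := {z | ‖Φ y - z‖ ≤ 7 * r}) (hWy z hz)
              fun z => edist (w (Φ y)) (w z) ^ p).symm
  rw [lintegral_mul_const' _ _ (hktop _), lintegral_mul_const' _ _ (hktop _), ← add_mul]
  have hkey : ‖x - y‖ₑ ^ (-β) = volume W * (8 ^ m * v⁻¹ * ‖x - y‖ₑ ^ (-(m + β))) := by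
    have h1 : ENNReal.ofReal ((r / 8) ^ m) * 8 ^ m = ‖x - y‖ₑ ^ (m : ℝ) := by
      rw [enorm_rpow_eq_ofReal (sub_ne_zero.2 hxy), show (8 : ℝ≥0∞) ^ m = ENNReal.ofReal (8 ^ m) by
        rw [ENNReal.ofReal_pow (by norm_num)]; norm_num, ← ENNReal.ofReal_mul (by positivity),
        Real.rpow_natCast, div_pow, div_mul_cancel₀ _ (by positivity)]
    calc ‖x - y‖ₑ ^ (-β) = ‖x - y‖ₑ ^ (m : ℝ) * ‖x - y‖ₑ ^ (-(m + β)) := by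
          rw [← ENNReal.rpow_add _ _ hk0 enorm_ne_top]; congr 1; ring
      _ = (ENNReal.ofReal ((r / 8) ^ m) * 8 ^ m) * (v * v⁻¹) * ‖x - y‖ₑ ^ (-(m + β)) := by
          rw [h1, ENNReal.mul_inv_cancel hv0 hvt, mul_one]
      _ = _ := by rw [hWv]; ring
  rw [hkey, ← mul_assoc]
  refine (mul_le_mul_left hmain _).trans (le_of_eq ?_)
  ring

theorem measurable_midpointKernel {Φ : EuclideanSpace ℝ (Fin m) → EuclideanSpace ℝ (Fin m)}
    (hΦ : Measurable Φ) {w : EuclideanSpace ℝ (Fin m) → N} (hw : Measurable w)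
    (p e : ℝ) : Measurable fun t : (EuclideanSpace ℝ (Fin m) × EuclideanSpace ℝ (Fin m)) ×
        EuclideanSpace ℝ (Fin m) => midpointKernel Φ w p e t.1.1 t.1.2 t.2 := by
  have hx : Measurable fun t : (EuclideanSpace ℝ (Fin m) × EuclideanSpace ℝ (Fin m)) ×
      EuclideanSpace ℝ (Fin m) => t.1.1 := measurable_fst.fst
  have hy : Measurable fun t : (EuclideanSpace ℝ (Fin m) × EuclideanSpace ℝ (Fin m)) ×
      EuclideanSpace ℝ (Fin m) => t.1.2 := measurable_fst.snd
  have hz : Measurable fun t : (EuclideanSpace ℝ (Fin m) × EuclideanSpace ℝ (Fin m)) ×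
      EuclideanSpace ℝ (Fin m) => t.2 := measurable_snd
  refine Measurable.mul ?_ ((measurable_enorm.comp (hx.sub hy)).pow_const _)
  have h1 : Measurable fun t : (EuclideanSpace ℝ (Fin m) × EuclideanSpace ℝ (Fin m)) ×
      EuclideanSpace ℝ (Fin m) => edist (w (Φ t.1.1)) (w t.2) ^ p :=
    ((hw.comp (hΦ.comp hx)).edist (hw.comp hz)).pow_const _
  have h2 : MeasurableSet {t : (EuclideanSpace ℝ (Fin m) × EuclideanSpace ℝ (Fin m)) ×
      EuclideanSpace ℝ (Fin m) | ‖Φ t.1.1 - t.2‖ ≤ 7 * ‖t.1.1 - t.1.2‖} :=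
    measurableSet_le ((hΦ.comp hx).sub hz).norm ((hx.sub hy).norm.const_mul _)
  exact h1.indicator h2

/-- Composition with a Lipschitz map `Φ` into the unit ball turns the energy into the integral of the
energy density along `Φ`; no lower bound on `‖Φ x - Φ y‖` is needed, since the points are compared
through intermediate ones. -/
theorem exists_gagliardoOn_comp_le {σ p : ℝ} (hσ : 0 < σ) (hp : 0 < p) : ∃ C : ℝ≥0,
    ∀ Φ : EuclideanSpace ℝ (Fin m) → EuclideanSpace ℝ (Fin m), LipschitzWith 6 Φ →
      (∀ x, ‖Φ x‖ ≤ 1) → ∀ w : EuclideanSpace ℝ (Fin m) → N, Measurable w →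
      gagliardoOn (m + σ) p (Metric.ball 0 2) (w ∘ Φ)
        ≤ C * ∫⁻ x in Metric.ball 0 2, gagliardoDensity (m + σ) p w (Φ x) := by
  obtain ⟨C₂, hC₂⟩ := exists_lintegral_midpointKernel_le (m := m) (N := N) hσ hp
  obtain ⟨c, hct, hc⟩ : ∃ c : ℝ≥0∞, c ≠ ⊤ ∧
      3 ^ p * 8 ^ m * (volume (Metric.ball (0 : EuclideanSpace ℝ (Fin m)) 1))⁻¹ = c := by
    refine ⟨_, ENNReal.mul_ne_top (ENNReal.mul_ne_top
      (ENNReal.rpow_ne_top_of_nonneg hp.le (by simp)) (by simp)) ?_, rfl⟩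
    simp [(Metric.measure_ball_pos volume (0 : EuclideanSpace ℝ (Fin m)) one_pos).ne']
  refine ⟨c.toNNReal * (2 * C₂), fun Φ hΦ hΦ1 w hw => ?_⟩
  have hΦm : Measurable Φ := hΦ.continuous.measurable
  have hqm := measurable_midpointKernel hΦm hw p (m + (m + σ))
  obtain ⟨q, hq⟩ : ∃ q, midpointKernel Φ w p (m + (m + σ)) = q := ⟨_, rfl⟩
  rw [hq] at hqm
  have hq1 : Measurable fun t : EuclideanSpace ℝ (Fin m) × EuclideanSpace ℝ (Fin m) =>
      ∫⁻ z in Metric.ball 0 1, q t.1 t.2 z :=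
    hqm.lintegral_prod_right'
  have hq1' : Measurable fun t : EuclideanSpace ℝ (Fin m) × EuclideanSpace ℝ (Fin m) =>
      ∫⁻ z in Metric.ball 0 1, q t.2 t.1 z :=
    hq1.comp measurable_swap
  have hint : ∀ x, ∫⁻ y in Metric.ball 0 2, ∫⁻ z in Metric.ball 0 1, q x y z
      ≤ C₂ * gagliardoDensity (m + σ) p w (Φ x) := by
    intro x
    have hqx : Measurable fun t : EuclideanSpace ℝ (Fin m) × EuclideanSpace ℝ (Fin m) =>
        q x t.1 t.2 :=
      hqm.comp ((measurable_const.prodMk measurable_fst).prodMk measurable_snd)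
    rw [lintegral_lintegral_swap hqx.aemeasurable, gagliardoDensity,
      ← lintegral_const_mul' _ _ ENNReal.coe_ne_top]
    refine lintegral_mono fun z => (setLIntegral_le_lintegral _ _).trans ?_
    rw [← hq]
    exact hC₂ Φ w x z
  have hpt : ∀ x ∈ Metric.ball (0 : EuclideanSpace ℝ (Fin m)) 2,
      ∀ y ∈ Metric.ball (0 : EuclideanSpace ℝ (Fin m)) 2,
      edist ((w ∘ Φ) x) ((w ∘ Φ) y) ^ p * ‖x - y‖ₑ ^ (-(m + σ))
      ≤ c * ((∫⁻ z in Metric.ball 0 1, q x y z) + ∫⁻ z in Metric.ball 0 1, q y x z) := by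
    intro x hx y hy
    by_cases hxy : x = y
    · rw [hxy, edist_self, ENNReal.zero_rpow_of_pos hp, zero_mul]
      exact zero_le
    rw [← hq, ← hc]
    refine gagliardo_integrand_comp_le hΦ hΦ1 hw hp hxy ?_
    rw [mem_ball_zero_iff] at hx hy
    exact (norm_sub_le _ _).trans (by linarith)
  calc gagliardoOn (m + σ) p (Metric.ball 0 2) (w ∘ Φ)
      ≤ ∫⁻ x in Metric.ball 0 2, ∫⁻ y in Metric.ball 0 2,
        c * ((∫⁻ z in Metric.ball 0 1, q x y z) + ∫⁻ z in Metric.ball 0 1, q y x z) :=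
        setLIntegral_mono' measurableSet_ball fun x hx =>
          setLIntegral_mono' measurableSet_ball fun y hy => hpt x hx y hy
    _ = c * ((∫⁻ x in Metric.ball 0 2, ∫⁻ y in Metric.ball 0 2, ∫⁻ z in Metric.ball 0 1, q x y z) +
          ∫⁻ x in Metric.ball 0 2, ∫⁻ y in Metric.ball 0 2, ∫⁻ z in Metric.ball 0 1, q y x z) := by
        rw [← lintegral_add_left hq1.lintegral_prod_right', ← lintegral_const_mul' _ _ hct]
        refine lintegral_congr fun x => ?_
        rw [lintegral_const_mul' _ _ hct]
        congr 1
        exact lintegral_add_left (hq1.comp measurable_prodMk_left) _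
    _ = c * (2 * ∫⁻ x in Metric.ball 0 2, ∫⁻ y in Metric.ball 0 2, ∫⁻ z in Metric.ball 0 1,
        q x y z) := by
        rw [two_mul, lintegral_lintegral_swap (f := fun x y => ∫⁻ z in Metric.ball 0 1, q y x z)
          hq1'.aemeasurable]
    _ ≤ c * (2 * ∫⁻ x in Metric.ball 0 2, C₂ * gagliardoDensity (m + σ) p w (Φ x)) := by
        gcongr with x
        exact hint x
    _ = _ := by
        rw [lintegral_const_mul' _ _ ENNReal.coe_ne_top, ENNReal.coe_mul, ENNReal.coe_toNNReal hct]
        push_cast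
        ring

/-- The energy on `ℝ^m` of a map that is constant outside a ball is controlled by the energy on a
larger ball. -/
theorem exists_gagliardoOn_univ_le (hm : 0 < m) {σ p : ℝ} (hσ : 0 < σ) (hp : 0 < p) : ∃ C : ℝ≥0,
    ∀ (w : EuclideanSpace ℝ (Fin m) → N) (b : N), Measurable w → (∀ x, 3 / 2 ≤ ‖x‖ → w x = b) →
      gagliardoOn (m + σ) p univ w ≤ C * gagliardoOn (m + σ) p (Metric.ball 0 2) w := by
  obtain ⟨C, hC⟩ := exists_lintegral_compl_gagliardo_le (N := N) hm hσ hp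
  refine ⟨1 + 2 * C, fun w b hw hb => ?_⟩
  have hbc : ∀ y ∈ (Metric.ball (0 : EuclideanSpace ℝ (Fin m)) 2)ᶜ, w y = b := fun y hy => hb y (by
    rw [mem_compl_iff, mem_ball_zero_iff, not_lt] at hy
    linarith)
  have hC' := hC w b hb
  have hkm := measurable_gagliardo_integrand hw (m + σ) p
  have hE : gagliardoOn (m + σ) p (Metric.ball 0 2) w = ∫⁻ x in Metric.ball 0 2,
    ∫⁻ y in Metric.ball 0 2, edist (w x) (w y) ^ p * ‖x - y‖ₑ ^ (-(m + σ)) := rfl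
  have hE' : gagliardoOn (m + σ) p univ w =
    ∫⁻ x, ∫⁻ y, edist (w x) (w y) ^ p * ‖x - y‖ₑ ^ (-(m + σ)) := by
    simp only [gagliardoOn, Measure.restrict_univ]
  have hzero : ∀ x ∈ (Metric.ball (0 : EuclideanSpace ℝ (Fin m)) 2)ᶜ,
      ∀ y ∈ (Metric.ball (0 : EuclideanSpace ℝ (Fin m)) 2)ᶜ,
      edist (w x) (w y) ^ p * ‖x - y‖ₑ ^ (-(m + σ)) = 0 := fun x hx y hy => by
    rw [hbc x hx, hbc y hy, edist_self, ENNReal.zero_rpow_of_pos hp, zero_mul]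
  have hsymm : ∀ x y, edist (w x) (w y) ^ p * ‖x - y‖ₑ ^ (-(m + σ)) =
      edist (w y) (w x) ^ p * ‖y - x‖ₑ ^ (-(m + σ)) := fun x y => by
    rw [edist_comm, enorm_sub_rev]
  rw [hE', hE]
  clear hE hE' hbc hC
  obtain ⟨k, hk⟩ : ∃ k : EuclideanSpace ℝ (Fin m) → EuclideanSpace ℝ (Fin m) → ℝ≥0∞,
    ∀ x y, edist (w x) (w y) ^ p * ‖x - y‖ₑ ^ (-(m + σ)) = k x y := ⟨_, fun _ _ => rfl⟩
  simp only [hk] at hC' hkm hzero hsymm ⊢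
  have hBm : MeasurableSet (Metric.ball (0 : EuclideanSpace ℝ (Fin m)) 2) := measurableSet_ball
  generalize Metric.ball (0 : EuclideanSpace ℝ (Fin m)) 2 = B at *
  have h2 : ∫⁻ x in B, ∫⁻ y in Bᶜ, k x y ≤ C * ∫⁻ x in B, ∫⁻ y in B, k x y := by
    rw [← lintegral_const_mul' _ _ ENNReal.coe_ne_top]
    exact lintegral_mono fun x => hC' x
  have h3 : ∫⁻ x in Bᶜ, ∫⁻ y in B, k x y = ∫⁻ x in B, ∫⁻ y in Bᶜ, k x y := by
    rw [lintegral_lintegral_swap hkm.aemeasurable]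
    exact lintegral_congr fun x => lintegral_congr fun y => hsymm y x
  have h4 : ∫⁻ x in Bᶜ, ∫⁻ y in Bᶜ, k x y = 0 := by
    refine (setLIntegral_congr_fun hBm.compl fun x hx => ?_).trans lintegral_zero
    exact (setLIntegral_congr_fun hBm.compl fun y hy => hzero x hx y hy).trans lintegral_zero
  have h5 : ∀ A : Set (EuclideanSpace ℝ (Fin m)), ∫⁻ x in A, ∫⁻ y, k x y =
      (∫⁻ x in A, ∫⁻ y in B, k x y) + ∫⁻ x in A, ∫⁻ y in Bᶜ, k x y := fun A => by
    rw [← lintegral_add_left hkm.lintegral_prod_right']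
    exact lintegral_congr fun x => (lintegral_add_compl _ hBm).symm
  rw [← lintegral_add_compl _ hBm, h5, h5, h3, h4, add_zero]
  calc _ ≤ (∫⁻ x in B, ∫⁻ y in B, k x y) + C * (∫⁻ x in B, ∫⁻ y in B, k x y) +
        C * ∫⁻ x in B, ∫⁻ y in B, k x y := by gcongr
    _ = _ := by push_cast; ring

/-- For some `a`, the energy on `ℝ^m` of `w ∘ foldToward a` is controlled by that of `w` on the unit
ball: this holds on average over `a`. -/
theorem exists_foldToward_gagliardoOn_le (hm : 0 < m) {σ p : ℝ} (hσ : 0 < σ) (hp : 0 < p) :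
    ∃ C : ℝ≥0, ∀ w : EuclideanSpace ℝ (Fin m) → N, Measurable w →
      ∃ a : EuclideanSpace ℝ (Fin m), ‖a‖ < 1 / 4 ∧
        gagliardoOn (m + σ) p univ (w ∘ foldToward a)
          ≤ C * gagliardoOn (m + σ) p (Metric.ball 0 1) w := by
  obtain ⟨C₁, hC₁⟩ := exists_gagliardoOn_comp_le (m := m) (N := N) hσ hp
  obtain ⟨C₂, hC₂⟩ := exists_gagliardoOn_univ_le (N := N) hm hσ hp
  obtain ⟨C₃, hC₃⟩ := exists_lintegral_foldToward_le m 2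
  set V := volume (Metric.ball (0 : EuclideanSpace ℝ (Fin m)) (1 / 4)) with hV
  have hV0 : V ≠ 0 := (Metric.measure_ball_pos _ _ (by norm_num)).ne'
  have hVt : V ≠ ⊤ := measure_ball_lt_top.ne
  refine ⟨C₂ * (C₁ * (V⁻¹.toNNReal * C₃)), fun w hw => ?_⟩
  have hdm := measurable_gagliardoDensity hw (m + σ) p
  have hFm : Measurable fun a : EuclideanSpace ℝ (Fin m) => ∫⁻ x in Metric.ball 0 2,
      gagliardoDensity (m + σ) p w (foldToward a x) :=
    (hdm.comp continuous_foldToward.measurable).lintegral_prod_right'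
  obtain ⟨a, ha, hle⟩ := exists_le_setLAverage hV0 hVt hFm.aemeasurable
  have ha' : ‖a‖ < 1 / 4 := mem_ball_zero_iff.1 ha
  have hlip := lipschitzWith_foldToward ha'
  refine ⟨a, ha', ?_⟩
  refine (hC₂ _ (w a) (hw.comp hlip.continuous.measurable) fun x hx => by
    rw [Function.comp_apply, foldToward_of_ge a hx]).trans ?_
  rw [ENNReal.coe_mul, mul_assoc]
  refine mul_le_mul_right ?_ _
  refine (hC₁ _ hlip (norm_foldToward_le ha') w hw).trans ?_
  rw [ENNReal.coe_mul, mul_assoc]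
  refine mul_le_mul_right (hle.trans ?_) _
  rw [setLAverage_eq, ENNReal.div_eq_inv_mul, ENNReal.coe_mul, ENNReal.coe_toNNReal (by simp [hV0]),
    mul_assoc]
  exact mul_le_mul_right (hC₃ _ hdm) _

end FractionalExtension

/-! ### Lipschitz paths in Riemannian manifolds -/

section Paths

open Filter Topology Manifold

variable {d : ℕ} {N : Type*} [EMetricSpace N]
  [ChartedSpace (EuclideanSpace ℝ (Fin d)) N]
  [RiemannianBundle (fun x : N => TangentSpace (𝓡 d) x)]

/-- A smooth map whose differential preserves the length of tangent vectors does not increase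
distances. -/
theorem lipschitzWith_one_of_norm_mfderiv [IsRiemannianManifold (𝓡 d) N] {ν : ℕ}
    {ι : N → EuclideanSpace ℝ (Fin ν)} (hι : IsIsometricEmbedding (d := d) ι) :
    LipschitzWith 1 ι := by
  intro x y
  rw [ENNReal.coe_one, one_mul, IsRiemannianManifold.out (I := 𝓡 d) x y]
  refine le_of_forall_gt fun r hr => ?_
  obtain ⟨γ, h0, h1, hγ, hlen⟩ := exists_lt_of_riemannianEDist_lt hr
  refine lt_of_le_of_lt ?_ hlen
  rw [IsRiemannianManifold.out (I := 𝓘(ℝ, EuclideanSpace ℝ (Fin ν))) (ι x) (ι y)]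
  have hs : CMDiff[Icc 0 1] 1 (ι ∘ γ) := (hι.contMDiff.of_le (by simp)).comp_contMDiffOn hγ
  refine (riemannianEDist_le_pathELength hs (by simp [h0]) (by simp [h1]) zero_le_one).trans ?_
  rw [pathELength_eq_lintegral_mfderivWithin_Icc, pathELength_eq_lintegral_mfderivWithin_Icc]
  refine le_of_eq (setLIntegral_congr_fun measurableSet_Icc fun t ht => ?_)
  have h1 : mfderivWithin 𝓘(ℝ, ℝ) 𝓘(ℝ, EuclideanSpace ℝ (Fin ν)) (ι ∘ γ) (Icc 0 1) t =
      (mfderiv (𝓡 d) 𝓘(ℝ, EuclideanSpace ℝ (Fin ν)) ι (γ t)) ∘L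
        (mfderivWithin 𝓘(ℝ, ℝ) (𝓡 d) γ (Icc 0 1) t) := by
    apply mfderiv_comp_mfderivWithin
    · exact (hι.contMDiff.mdifferentiable (by simp)) _
    · exact hγ.mdifferentiableOn one_ne_zero t ht
    · rw [uniqueMDiffWithinAt_iff_uniqueDiffWithinAt]
      exact uniqueDiffOn_Icc zero_lt_one t ht
  have h2 : mfderivWithin 𝓘(ℝ, ℝ) 𝓘(ℝ, EuclideanSpace ℝ (Fin ν)) (ι ∘ γ) (Icc 0 1) t 1 =
      mfderiv (𝓡 d) 𝓘(ℝ, EuclideanSpace ℝ (Fin ν)) ι (γ t)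
        (mfderivWithin 𝓘(ℝ, ℝ) (𝓡 d) γ (Icc 0 1) t 1) :=
    congr($h1 1)
  rw [h2]
  rw [← ofReal_norm, ← ofReal_norm, hι.norm_mfderiv]

variable [IsManifold (𝓡 d) ∞ N]

attribute [local instance] normedAddCommGroupTangentSpaceVectorSpace
  normedSpaceTangentSpaceVectorSpace in
theorem eventually_enorm_mfderivWithin_symm_extChartAt_apply_le
    [IsContMDiffRiemannianBundle (𝓡 d) ∞ (EuclideanSpace ℝ (Fin d))
      (fun x : N => TangentSpace (𝓡 d) x)] (x : N) :
    ∃ C : ℝ≥0, ∀ᶠ y in 𝓝 (extChartAt (𝓡 d) x x), ∀ v : EuclideanSpace ℝ (Fin d),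
      ‖mfderivWithin 𝓘(ℝ, EuclideanSpace ℝ (Fin d)) (𝓡 d) (extChartAt (𝓡 d) x).symm
        (range (𝓡 d)) y v‖ₑ ≤ C * ‖v‖ₑ := by
  have : IsContinuousRiemannianBundle (EuclideanSpace ℝ (Fin d))
      (fun x : N => TangentSpace (𝓡 d) x) := by
    obtain ⟨g, hg, h⟩ := IsContMDiffRiemannianBundle.exists_contMDiff (IB := 𝓡 d) (n := ∞)
      (F := EuclideanSpace ℝ (Fin d)) (E := fun x : N => TangentSpace (𝓡 d) x)
    exact ⟨⟨g, hg.continuous, h⟩⟩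
  obtain ⟨C, -, hC⟩ := eventually_enorm_mfderivWithin_symm_extChartAt_lt (𝓡 d) x
  refine ⟨C, ?_⟩
  rw [← nhdsWithin_univ, ← ModelWithCorners.range_eq_univ (𝓡 d)]
  filter_upwards [hC] with y hy v
  exact (ContinuousLinearMap.le_opENorm _ _).trans (mul_le_mul' hy.le le_rfl)

/-- The inverse of a chart is Lipschitz near the centre of the chart. -/
theorem exists_lipschitzOnWith_symm_extChartAt
    [IsContMDiffRiemannianBundle (𝓡 d) ∞ (EuclideanSpace ℝ (Fin d))
      (fun x : N => TangentSpace (𝓡 d) x)] [IsRiemannianManifold (𝓡 d) N] (x : N) :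
    ∃ C : ℝ≥0, ∃ r > 0, LipschitzOnWith C (extChartAt (𝓡 d) x).symm
      (Metric.ball (extChartAt (𝓡 d) x x) r) := by
  obtain ⟨C, hC⟩ := eventually_enorm_mfderivWithin_symm_extChartAt_apply_le (d := d) x
  obtain ⟨r, hr0, hr⟩ := Metric.mem_nhds_iff.1
    (inter_mem (extChartAt_target_mem_nhds (I := 𝓡 d) x) hC)
  refine ⟨C, r, hr0, fun y hy z hz => ?_⟩
  let η := ContinuousAffineMap.lineMap (R := ℝ) y z
  set γ := (extChartAt (𝓡 d) x).symm ∘ η with hγ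
  have hη : ∀ t ∈ Icc (0 : ℝ) 1, η t ∈ Metric.ball (extChartAt (𝓡 d) x x) r := by
    intro t ht
    apply (convex_ball _ _).segment_subset hy hz
    rw [segment_eq_image_lineMap]
    exact ⟨t, ht, rfl⟩
  have hη1 : Icc (0 : ℝ) 1 ⊆ η ⁻¹' (extChartAt (𝓡 d) x).target := fun t ht => (hr (hη t ht)).1
  have hηs : CMDiff[Icc 0 1] 1 η := by
    apply ContMDiff.contMDiffOn
    rw [contMDiff_iff_contDiff]
    exact ContinuousAffineMap.contDiff _
  rw [IsRiemannianManifold.out (I := 𝓡 d)]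
  have : riemannianEDist (𝓡 d) ((extChartAt (𝓡 d) x).symm y) ((extChartAt (𝓡 d) x).symm z)
      ≤ pathELength (𝓡 d) γ 0 1 := by
    apply riemannianEDist_le_pathELength _ _ _ zero_le_one
    · exact (contMDiffOn_extChartAt_symm x).comp hηs hη1
    · simp [γ, η, ContinuousAffineMap.coe_lineMap_eq]
    · simp [γ, η, ContinuousAffineMap.coe_lineMap_eq]
  refine this.trans ?_
  rw [← lintegral_fderiv_lineMap_eq_edist, pathELength_eq_lintegral_mfderivWithin_Icc,
    ← lintegral_const_mul' _ _ ENNReal.coe_ne_top]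
  refine setLIntegral_mono' measurableSet_Icc fun t ht => ?_
  have h1 : mfderivWithin 𝓘(ℝ, ℝ) (𝓡 d) γ (Icc 0 1) t =
      (mfderivWithin 𝓘(ℝ, EuclideanSpace ℝ (Fin d)) (𝓡 d) (extChartAt (𝓡 d) x).symm
        (range (𝓡 d)) (η t)) ∘L (mfderiv[Icc 0 1] η t) := by
    apply mfderivWithin_comp
    · exact mdifferentiableWithinAt_extChartAt_symm (hη1 ht)
    · exact hηs.mdifferentiableOn one_ne_zero t ht
    · exact hη1.trans (preimage_mono (extChartAt_target_subset_range x))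
    · rw [uniqueMDiffWithinAt_iff_uniqueDiffWithinAt]
      exact uniqueDiffOn_Icc zero_lt_one t ht
  have h2 : mfderivWithin 𝓘(ℝ, ℝ) (𝓡 d) γ (Icc 0 1) t 1 =
      mfderivWithin 𝓘(ℝ, EuclideanSpace ℝ (Fin d)) (𝓡 d) (extChartAt (𝓡 d) x).symm
        (range (𝓡 d)) (η t) (mfderiv[Icc 0 1] η t 1) :=
    congr($h1 1)
  rw [h2, mfderivWithin_eq_fderivWithin]
  exact (hr (hη t ht)).2 _

/-- Near `b`, points are joined to `b` by paths parametrized on `ℝ`, constant outside `[0, 1]`, of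
arbitrarily small Lipschitz constant. -/
theorem eventually_exists_lipschitzWith_path
    [IsContMDiffRiemannianBundle (𝓡 d) ∞ (EuclideanSpace ℝ (Fin d))
      (fun x : N => TangentSpace (𝓡 d) x)] [IsRiemannianManifold (𝓡 d) N] (b : N) {K : ℝ≥0}
    (hK : 0 < K) :
    ∀ᶠ c in 𝓝 b, ∃ γ : ℝ → N, LipschitzWith K γ ∧ (∀ t ≤ 0, γ t = c) ∧ ∀ t, 1 ≤ t → γ t = b := by
  obtain ⟨C, r, hr, hC⟩ := exists_lipschitzOnWith_symm_extChartAt (d := d) b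
  have h1 : ∀ᶠ c in 𝓝 b, extChartAt (𝓡 d) b c ∈ Metric.ball (extChartAt (𝓡 d) b b)
      (min r (K / (C + 1))) := (continuousAt_extChartAt b).preimage_mem_nhds
    (Metric.ball_mem_nhds _ (by positivity))
  filter_upwards [h1, extChartAt_source_mem_nhds (I := 𝓡 d) b] with c hc hcs
  rw [Metric.mem_ball, lt_min_iff] at hc
  set y := extChartAt (𝓡 d) b c with hy
  set z := extChartAt (𝓡 d) b b with hz
  set τ : ℝ → ℝ := fun t => projIcc (0 : ℝ) 1 zero_le_one t with hτ
  have hτ1 : LipschitzWith 1 τ := by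
    refine LipschitzWith.of_dist_le_mul fun s t => ?_
    exact LipschitzWith.projIcc (a := (0 : ℝ)) (b := 1) zero_le_one |>.dist_le_mul s t
  have hl : LipschitzWith (K / (C + 1)) (fun t : ℝ => AffineMap.lineMap y z (τ t)) := by
    refine LipschitzWith.of_dist_le_mul fun s t => ?_
    rw [dist_lineMap_lineMap, mul_comm]
    have := hτ1.dist_le_mul s t
    have h3 : dist y z ≤ ((K / (C + 1) : ℝ≥0) : ℝ) := by push_cast; exact hc.2.le
    simp only [NNReal.coe_one, one_mul] at this
    gcongr
  have hlm : MapsTo (fun t : ℝ => (AffineMap.lineMap y z (τ t) : EuclideanSpace ℝ (Fin d))) univ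
      (Metric.ball z r) := by
    intro t _
    apply (convex_ball _ _).segment_subset (Metric.mem_ball.2 hc.1) (Metric.mem_ball_self hr)
    rw [segment_eq_image_lineMap]
    exact ⟨τ t, (projIcc (0 : ℝ) 1 zero_le_one t).2, rfl⟩
  refine ⟨fun t => (extChartAt (𝓡 d) b).symm (AffineMap.lineMap y z (τ t)), ?_, ?_, ?_⟩
  · have := hC.comp hl.lipschitzOnWith hlm
    rw [lipschitzOnWith_univ] at this
    refine this.weaken ?_
    rw [← mul_div_assoc, mul_comm]
    refine div_le_of_le_mul₀ zero_le zero_le ?_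
    gcongr
    exact le_self_add
  · intro t ht
    have : τ t = 0 := by simp [hτ, projIcc_of_le_left _ ht]
    simp only [this, AffineMap.lineMap_apply_zero]
    exact (extChartAt (𝓡 d) b).left_inv hcs
  · intro t ht
    have : τ t = 1 := by simp [hτ, projIcc_of_right_le _ ht]
    simp only [this, AffineMap.lineMap_apply_one]
    exact (extChartAt (𝓡 d) b).left_inv (mem_extChartAt_source b)

/-- Any two points of a connected Riemannian manifold are joined by a Lipschitz path. -/
theorem exists_lipschitzWith_path [ConnectedSpace N]
    [IsContMDiffRiemannianBundle (𝓡 d) ∞ (EuclideanSpace ℝ (Fin d))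
      (fun x : N => TangentSpace (𝓡 d) x)] [IsRiemannianManifold (𝓡 d) N] (c b : N) :
    ∃ (K : ℝ≥0) (γ : ℝ → N), LipschitzWith K γ ∧ (∀ t ≤ 0, γ t = c) ∧ ∀ t, 1 ≤ t → γ t = b := by
  set R : N → N → Prop := fun c b => ∃ (K : ℝ≥0) (γ : ℝ → N), LipschitzWith K γ ∧
    (∀ t ≤ 0, γ t = c) ∧ ∀ t, 1 ≤ t → γ t = b with hR
  have hsymm : ∀ {c b}, R c b → R b c := by
    rintro c b ⟨K, γ, hγ, h0, h1⟩
    refine ⟨K, fun t => γ (1 - t), ?_, fun t ht => h1 _ (by linarith), fun t ht =>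
      h0 _ (by linarith)⟩
    have : LipschitzWith 1 (fun t : ℝ => 1 - t) := LipschitzWith.of_dist_le_mul fun s t => by
      rw [Real.dist_eq, Real.dist_eq, show 1 - s - (1 - t) = -(s - t) by ring, abs_neg]
      simp
    exact (hγ.comp this).weaken (by simp)
  have htrans : ∀ {a c b}, R a c → R c b → R a b := by
    rintro a c b ⟨K, γ, hγ, h0, h1⟩ ⟨K', γ', hγ', h0', h1'⟩
    have hl1 : LipschitzWith 2 (fun t : ℝ => 2 * t) := LipschitzWith.of_dist_le_mul fun s t => by
      simp [Real.dist_eq, ← mul_sub, abs_mul]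
    have hl2 : LipschitzWith 2 (fun t : ℝ => 2 * t - 1) :=
      LipschitzWith.of_dist_le_mul fun s t => by simp [Real.dist_eq, ← mul_sub, abs_mul]
    have hA := hγ.comp hl1
    have hB := hγ'.comp hl2
    refine ⟨K * 2 + K' * 2, fun t => if t ≤ 1 / 2 then γ (2 * t) else γ' (2 * t - 1), ?_, ?_, ?_⟩
    · -- points on different sides are compared through the value `c` at `1 / 2`
      have key : ∀ s t : ℝ, s ≤ 1 / 2 → 1 / 2 < t →
          edist (γ (2 * s)) (γ' (2 * t - 1)) ≤ (K * 2 + K' * 2 : ℝ≥0) * edist s t := by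
        intro s t hs ht
        have e1 : γ (2 * (1 / 2)) = c := h1 _ (by norm_num)
        have e2 : γ' (2 * (1 / 2) - 1) = c := h0' _ (by norm_num)
        have h3 := hA s (1 / 2)
        have h4 := hB (1 / 2) t
        simp only [Function.comp_apply] at h3 h4
        rw [e1] at h3
        rw [e2] at h4
        have h5 : edist s (1 / 2) ≤ edist s t := by
          rw [edist_dist, edist_dist, Real.dist_eq, Real.dist_eq]
          exact ENNReal.ofReal_le_ofReal (by
            rw [abs_of_nonpos (by linarith), abs_of_nonpos (by linarith)]; linarith)
        have h6 : edist (1 / 2) t ≤ edist s t := by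
          rw [edist_dist, edist_dist, Real.dist_eq, Real.dist_eq]
          exact ENNReal.ofReal_le_ofReal (by
            rw [abs_of_nonpos (by linarith), abs_of_nonpos (by linarith)]; linarith)
        rw [ENNReal.coe_add, add_mul]
        exact (edist_triangle _ c _).trans (add_le_add (h3.trans (mul_le_mul_right h5 _))
          (h4.trans (mul_le_mul_right h6 _)))
      intro s t
      by_cases hs : s ≤ 1 / 2 <;> by_cases ht : t ≤ 1 / 2
      · simp only [hs, ht, if_true]
        exact (hA s t).trans (mul_le_mul_left (by exact_mod_cast le_self_add) _)
      · simp only [hs, ht, if_true, if_false]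
        exact key s t hs (not_le.1 ht)
      · simp only [hs, ht, if_true, if_false]
        rw [edist_comm, edist_comm s]
        exact key t s ht (not_le.1 hs)
      · simp only [hs, ht, if_false]
        exact (hB s t).trans (mul_le_mul_left (by exact_mod_cast le_add_self) _)
    · intro t ht
      simp only [show t ≤ 1 / 2 by linarith, if_true]
      exact h0 _ (by linarith)
    · intro t ht
      simp only [show ¬ t ≤ 1 / 2 by linarith, if_false]
      exact h1' _ (by linarith)
  have hloc : ∀ b, ∀ᶠ c in 𝓝 b, R c b := fun b =>
    (eventually_exists_lipschitzWith_path (d := d) b one_pos).mono fun c ⟨γ, h⟩ => ⟨1, γ, h⟩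
  have hclopen : IsClopen {c | R c b} := by
    refine ⟨⟨isOpen_iff_mem_nhds.2 fun c hc => ?_⟩, isOpen_iff_mem_nhds.2 fun c hc => ?_⟩
    · filter_upwards [hloc c] with a ha hab
      exact hc (htrans (hsymm ha) hab)
    · filter_upwards [hloc c] with a ha
      exact htrans ha hc
  have : {c | R c b} = univ := hclopen.eq_univ ⟨b, (hloc b).self_of_nhds⟩
  exact eq_univ_iff_forall.1 this c

end Paths

/-! ### Transition and extension -/

section Transition

open Filter Topology

variable {m : ℕ} {N : Type*} [EMetricSpace N] [MeasurableSpace N] [BorelSpace N]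

/-- Transitions of small energy between two values `b n` and `b'`. In the subcritical and critical
cases a logarithmic cutoff makes the energy small. When `N` is compact, `b'` is a cluster point of
the sequence `b` and the smallness comes from short paths. -/
theorem exists_transition_of_logCutoff (hm : 0 < m) {σ p : ℝ} (hp : 1 ≤ p) (hσ : 0 < σ)
    (hpath : ∀ c b : N, ∃ (K : ℝ≥0) (γ : ℝ → N), LipschitzWith K γ ∧ (∀ t ≤ 0, γ t = c) ∧
      ∀ t, 1 ≤ t → γ t = b)
    (hloc : ∀ (b : N) (K : ℝ≥0), 0 < K → ∀ᶠ c in 𝓝 b, ∃ γ : ℝ → N, LipschitzWith K γ ∧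
      (∀ t ≤ 0, γ t = c) ∧ ∀ t, 1 ≤ t → γ t = b)
    (hN : (σ < m ∨ (σ = m ∧ 1 < p)) ∨ CompactSpace N)
    {𝓔 : (EuclideanSpace ℝ (Fin m) → N) → ℝ≥0∞}
    (h𝓔 : ∃ C : ℝ≥0, ∀ (K : ℝ≥0) (γ : ℝ → N) (L : ℝ), 0 < L → LipschitzWith K γ →
      𝓔 (γ ∘ logCutoff L) ≤
        C * ((K : ℝ≥0∞) ^ p * (ENNReal.ofReal (L ^ (-p)) * (1 + annulusIntegral m σ L))))
    (b : ℕ → N) :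
    ∃ b' : N, ∀ η : ℝ, 0 < η → ∃ᶠ n in atTop, ∃ r : ℝ, 0 < r ∧ r ≤ 1 ∧
      ((m : ℝ) - σ < 0 → r = 1 / 2) ∧ ∃ w : EuclideanSpace ℝ (Fin m) → N, NullMeasurable w volume ∧
        (∀ x ∈ Metric.ball 0 r, w x = b n) ∧ (∀ x ∉ Metric.ball 0 1, w x = b') ∧
        𝓔 w ≤ ENNReal.ofReal η := by
  obtain ⟨C, hC⟩ := h𝓔
  have hp0 : 0 < p := by linarith
  have hw : ∀ {K : ℝ≥0} {γ : ℝ → N} {L : ℝ} {c c' : N}, 0 < L → LipschitzWith K γ →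
      (∀ t ≤ 0, γ t = c) → (∀ t, 1 ≤ t → γ t = c') →
      NullMeasurable (γ ∘ logCutoff (m := m) L) volume ∧
      (∀ x ∈ Metric.ball (0 : EuclideanSpace ℝ (Fin m)) (Real.exp (-L)),
        (γ ∘ logCutoff L) x = c) ∧
      (∀ x ∉ Metric.ball (0 : EuclideanSpace ℝ (Fin m)) 1, (γ ∘ logCutoff L) x = c') := by
    intro K γ L c c' hL hγ h0 h1
    refine ⟨(hγ.continuous.comp (lipschitzWith_logCutoff hL).continuous).measurable.nullMeasurable,
      fun x hx => ?_, fun x hx => ?_⟩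
    · rw [Function.comp_apply, logCutoff_of_le hL (mem_ball_zero_iff.1 hx).le]
      exact h0 0 le_rfl
    · rw [mem_ball_zero_iff, not_lt] at hx
      rw [Function.comp_apply, logCutoff_of_ge hL hx]
      exact h1 1 le_rfl
  rcases hN with hσm | hN
  · refine ⟨b 0, fun η hη => Frequently.of_forall fun n => ?_⟩
    obtain ⟨K, γ, hγ, h0, h1⟩ := hpath (b n) (b 0)
    have hKp : (C : ℝ≥0∞) * (K : ℝ≥0∞) ^ p ≠ ⊤ :=
      ENNReal.mul_ne_top ENNReal.coe_ne_top (ENNReal.rpow_ne_top_of_nonneg hp0.le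
          ENNReal.coe_ne_top)
    have hlim := ENNReal.Tendsto.const_mul (tendsto_capacity hm hp hσm) (Or.inr hKp)
    rw [mul_zero] at hlim
    obtain ⟨L, hL, hL0⟩ := ((hlim.eventually (ge_mem_nhds (ENNReal.ofReal_pos.2 hη))).and
      (eventually_gt_atTop 0)).exists
    obtain ⟨hw1, hw2, hw3⟩ := hw hL0 hγ h0 h1
    refine ⟨Real.exp (-L), Real.exp_pos _, by rw [Real.exp_le_one_iff]; linarith, fun h => ?_, _,
      hw1, hw2, hw3, ?_⟩
    · rcases hσm with h' | h' <;> linarith [h]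
    · refine (hC K γ L hL0 hγ).trans ?_
      rw [← mul_assoc]
      exact hL
  · obtain ⟨b', -, hb'⟩ := isCompact_univ.exists_mapClusterPt (f := atTop) (u := b) (by simp)
    refine ⟨b', fun η hη => ?_⟩
    have hL0 : 0 < Real.log 2 := Real.log_pos (by norm_num)
    have hL1 : Real.exp (-Real.log 2) = 1 / 2 := by
      rw [Real.exp_neg, Real.exp_log (by norm_num), one_div]
    obtain ⟨M, hM⟩ : ∃ M : ℝ≥0, (M : ℝ≥0∞) =
        C * (ENNReal.ofReal (Real.log 2 ^ (-p)) * (1 + annulusIntegral m σ (Real.log 2))) := by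
      refine ⟨_, ENNReal.coe_toNNReal (ENNReal.mul_ne_top ENNReal.coe_ne_top
        (ENNReal.mul_ne_top ENNReal.ofReal_ne_top ?_))⟩
      exact ENNReal.add_ne_top.2 ⟨ENNReal.one_ne_top, (annulusIntegral_lt_top m hσ _).ne⟩
    set K : ℝ≥0 := (η.toNNReal / (M + 1)) ^ p⁻¹ with hK
    have hη' : 0 < η.toNNReal := Real.toNNReal_pos.2 hη
    have hK0 : 0 < K := NNReal.rpow_pos (by positivity)
    refine (hb'.frequently (hloc b' K hK0)).mono ?_
    rintro n ⟨γ, hγ, h0, h1⟩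
    obtain ⟨hw1, hw2, hw3⟩ := hw hL0 hγ h0 h1
    rw [hL1] at hw2
    refine ⟨1 / 2, by norm_num, by norm_num, fun _ => rfl, _, hw1, hw2, hw3, ?_⟩
    refine (hC K γ _ hL0 hγ).trans ?_
    rw [mul_left_comm, ← hM, ← ENNReal.coe_rpow_of_nonneg _ hp0.le, hK,
      NNReal.rpow_inv_rpow hp0.ne', ← ENNReal.coe_mul]
    change _ ≤ ((η.toNNReal : ℝ≥0) : ℝ≥0∞)
    rw [ENNReal.coe_le_coe, div_mul_eq_mul_div]
    refine div_le_of_le_mul₀ zero_le zero_le ?_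
    gcongr
    exact le_self_add

end Transition

/-- To extend maps from the unit ball with control of the energy, it is enough to control the energy
of `w ∘ foldToward a` for Borel maps `w` and suitable `a`. -/
theorem exists_extension_of_foldToward {m : ℕ} {N : Type*} [EMetricSpace N]
    [SecondCountableTopology N] [MeasurableSpace N] [BorelSpace N]
    {𝓔 : (EuclideanSpace ℝ (Fin m) → N) → ℝ≥0∞}
    {E : (Metric.ball (0 : EuclideanSpace ℝ (Fin m)) 1 → N) → ℝ≥0∞}
    (hE : ∀ w w' : EuclideanSpace ℝ (Fin m) → N, w =ᵐ[volume.restrict (Metric.ball 0 1)] w' →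
      E (fun x => w x) = E (fun x => w' x))
    (h𝓔 : ∀ w w' : EuclideanSpace ℝ (Fin m) → N, w =ᵐ[volume] w' → 𝓔 w = 𝓔 w')
    (h : ∃ C : ℝ≥0, ∀ w : EuclideanSpace ℝ (Fin m) → N, Measurable w → E (fun x => w x) ≠ 0 →
      E (fun x => w x) ≠ ⊤ → ∃ a : EuclideanSpace ℝ (Fin m), ‖a‖ < 1 / 4 ∧
        𝓔 (w ∘ foldToward a) ≤ C * E (fun x => w x)) :
    ∃ C : ℝ≥0, ∀ u : Metric.ball (0 : EuclideanSpace ℝ (Fin m)) 1 → N,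
      NullMeasurable u volume → E u ≠ 0 → E u ≠ ⊤ → ∃ (v : EuclideanSpace ℝ (Fin m) → N) (b : N),
        NullMeasurable v volume ∧ (∀ x : Metric.ball (0 : EuclideanSpace ℝ (Fin m)) 1, v x = u x) ∧
        (∀ x ∉ Metric.ball 0 2, v x = b) ∧ 𝓔 v ≤ C * E u := by
  classical
  obtain ⟨C, hC⟩ := h
  refine ⟨C, fun u hu h0 ht => ?_⟩
  obtain ⟨g, hg, hgu⟩ := hu.aemeasurable
  set w : EuclideanSpace ℝ (Fin m) → N := fun x => if hx : x ∈ Metric.ball 0 1 then g ⟨x, hx⟩ else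
    u ⟨0, Metric.mem_ball_self one_pos⟩ with hw
  have hwm : Measurable w := Measurable.dite hg measurable_const measurableSet_ball
  set e : EuclideanSpace ℝ (Fin m) → EuclideanSpace ℝ (Fin m) → N := fun a x =>
    if hx : x ∈ Metric.ball 0 1 then u ⟨x, hx⟩ else w (foldToward a x) with he
  have heu : ∀ a (x : Metric.ball (0 : EuclideanSpace ℝ (Fin m)) 1), e a x = u x := fun a x => by
    simp only [he, dif_pos x.2]
  have hew : ∀ a, e a =ᵐ[volume.restrict (Metric.ball 0 1)] w := fun a => by
    refine (ae_restrict_iff_subtype measurableSet_ball).2 (hgu.mono fun x hx => ?_)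
    rw [heu a x, hx]
    simp only [hw, dif_pos x.2]
  have hEu : ∀ a, E (fun x => w x) = E u := fun a =>
    (hE _ _ (hew a)).symm.trans (congrArg E (funext (heu a)))
  obtain ⟨a, ha, hle⟩ := hC w hwm (by rwa [hEu 0]) (by rwa [hEu 0])
  have hae : e a =ᵐ[volume] w ∘ foldToward a := by
    have h1 := (ae_restrict_iff' measurableSet_ball).1 (hew a)
    filter_upwards [h1] with x hx
    by_cases hxb : x ∈ Metric.ball (0 : EuclideanSpace ℝ (Fin m)) 1
    · rw [hx hxb, Function.comp_apply, foldToward_of_le a (mem_ball_zero_iff.1 hxb).le]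
    · simp only [he, dif_neg hxb, Function.comp_apply]
  refine ⟨e a, w a, ?_, heu a, fun x hx => ?_, ?_⟩
  · exact AEMeasurable.nullMeasurable
      ⟨_, hwm.comp (lipschitzWith_foldToward ha).continuous.measurable, hae⟩
  · rw [mem_ball_zero_iff, not_lt] at hx
    have hxb : x ∉ Metric.ball (0 : EuclideanSpace ℝ (Fin m)) 1 := by
      rw [mem_ball_zero_iff, not_lt]; linarith
    simp only [he, dif_neg hxb]
    rw [foldToward_of_ge a (by linarith)]
  · rw [h𝓔 _ _ hae, ← hEu a]
    exact hle

/-- The fractional energy on `ℝ^m` is a gluing energy. -/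
theorem isGluingEnergy_gagliardoOn {m : ℕ} {N : Type*} [EMetricSpace N]
    [SecondCountableTopology N] [MeasurableSpace N] [BorelSpace N] {σ p : ℝ} (hp : 0 < p) :
    IsGluingEnergy (m := m) ((m : ℝ) - σ) (gagliardoOn (N := N) ((m : ℝ) + σ) p univ) where
  scale w _ t ht h := (gagliardoOn_univ_rescale w ht h).le
  const b := gagliardoOn_const hp _ b
  glue := by
    refine ⟨3 ^ p, NNReal.one_le_rpow (by norm_num) hp.le, fun c ρ hB w h₀ b hw hh hwb hhb => ?_⟩
    rw [ENNReal.coe_rpow_of_nonneg _ hp.le]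
    exact gagliardoOn_glueBalls_le hB hw hh hwb hhb hp

/-! ### Weak derivatives on `ℝ^m` -/

section WeakDerivative

open Filter Topology

variable {m : ℕ} {F : Type*} [NormedAddCommGroup F] [NormedSpace ℝ F]

/-- `D` is the weak derivative on `U` of `f`, both being locally integrable there. -/
structure HasWeakFDeriv (U : Set (EuclideanSpace ℝ (Fin m))) (f : EuclideanSpace ℝ (Fin m) → F)
    (D : EuclideanSpace ℝ (Fin m) → EuclideanSpace ℝ (Fin m) →L[ℝ] F) : Prop where
  locallyIntegrableOn : LocallyIntegrableOn f U volume
  locallyIntegrableOn_deriv : LocallyIntegrableOn D U volume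
  integral_eq : ∀ φ : EuclideanSpace ℝ (Fin m) → ℝ, ContDiff ℝ ∞ φ → HasCompactSupport φ →
    tsupport φ ⊆ U → ∀ v, ∫ x, fderiv ℝ φ x v • f x = - ∫ x, φ x • D x v

theorem integrable_smul_of_tsupport_subset {U : Set (EuclideanSpace ℝ (Fin m))}
    {f : EuclideanSpace ℝ (Fin m) → F} (hf : LocallyIntegrableOn f U volume)
    {φ : EuclideanSpace ℝ (Fin m) → ℝ} (hφ : Continuous φ) (hc : HasCompactSupport φ)
    (hU : tsupport φ ⊆ U) : Integrable (fun x => φ x • f x) volume := by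
  have h1 : IntegrableOn (fun x => φ x • f x) (tsupport φ) volume :=
    (hf.integrableOn_compact_subset hU hc).continuousOn_smul hφ.continuousOn hc
  refine (integrableOn_iff_integrable_of_support_subset ?_).1 h1
  exact (Function.support_smul_subset_left _ _).trans (subset_tsupport _)

theorem continuous_fderiv_apply_of_contDiff {φ : EuclideanSpace ℝ (Fin m) → ℝ}
    (hφ : ContDiff ℝ ∞ φ) (v : EuclideanSpace ℝ (Fin m)) :
    Continuous fun x => fderiv ℝ φ x v :=
  (hφ.continuous_fderiv (by simp)).clm_apply continuous_const

theorem stronglyMeasurable_fderiv_of_finiteDimensional [FiniteDimensional ℝ F]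
    (f : EuclideanSpace ℝ (Fin m) → F) : StronglyMeasurable (fderiv ℝ f) := by
  have : CompleteSpace F := FiniteDimensional.complete ℝ F
  have : ProperSpace (EuclideanSpace ℝ (Fin m) →L[ℝ] F) := FiniteDimensional.proper ℝ _
  exact (measurable_fderiv ℝ f).stronglyMeasurable

namespace HasWeakFDeriv

variable {U U' : Set (EuclideanSpace ℝ (Fin m))} {f g : EuclideanSpace ℝ (Fin m) → F}
  {D D' : EuclideanSpace ℝ (Fin m) → EuclideanSpace ℝ (Fin m) →L[ℝ] F}

theorem integrable_test (h : HasWeakFDeriv U f D) {φ : EuclideanSpace ℝ (Fin m) → ℝ}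
    (hφ : ContDiff ℝ ∞ φ) (hc : HasCompactSupport φ) (hU : tsupport φ ⊆ U)
    (v : EuclideanSpace ℝ (Fin m)) : Integrable (fun x => fderiv ℝ φ x v • f x) volume :=
  integrable_smul_of_tsupport_subset h.locallyIntegrableOn
    (continuous_fderiv_apply_of_contDiff hφ v) (hc.fderiv_apply (𝕜 := ℝ) v)
    ((tsupport_fderiv_apply_subset ℝ v).trans hU)

theorem integrable_deriv (h : HasWeakFDeriv U f D) {φ : EuclideanSpace ℝ (Fin m) → ℝ}
    (hφ : Continuous φ) (hc : HasCompactSupport φ) (hU : tsupport φ ⊆ U) :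
    Integrable (fun x => φ x • D x) volume :=
  integrable_smul_of_tsupport_subset h.locallyIntegrableOn_deriv hφ hc hU

theorem mono (h : HasWeakFDeriv U f D) (hU : U' ⊆ U) : HasWeakFDeriv U' f D :=
  ⟨h.locallyIntegrableOn.mono_set hU, h.locallyIntegrableOn_deriv.mono_set hU,
    fun φ hφ hc hs v => h.integral_eq φ hφ hc (hs.trans hU) v⟩

theorem congr_ae (h : HasWeakFDeriv U f D) (hU : MeasurableSet U)
    (hf : f =ᵐ[volume.restrict U] g) (hD : D =ᵐ[volume.restrict U] D') :
    HasWeakFDeriv U g D' := by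
  rw [EventuallyEq, ae_restrict_iff' hU] at hf hD
  refine ⟨h.locallyIntegrableOn.congr ((ae_restrict_iff' hU).2 hf),
    h.locallyIntegrableOn_deriv.congr ((ae_restrict_iff' hU).2 hD), fun φ hφ hc hs v => ?_⟩
  have h0 : ∀ x ∉ U, φ x = 0 := fun x hx => image_eq_zero_of_notMem_tsupport fun h => hx (hs h)
  have h1 : ∀ x ∉ U, fderiv ℝ φ x v = 0 := fun x hx =>
    image_eq_zero_of_notMem_tsupport (f := fun x => fderiv ℝ φ x v)
      fun h => hx (hs (tsupport_fderiv_apply_subset ℝ v h))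
  have e1 : ∫ x, fderiv ℝ φ x v • g x = ∫ x, fderiv ℝ φ x v • f x :=
    integral_congr_ae (hf.mono fun x hx => by
      by_cases hxU : x ∈ U
      · simp only [hx hxU]
      · simp only [h1 x hxU, zero_smul])
  have e2 : ∫ x, φ x • D' x v = ∫ x, φ x • D x v :=
    integral_congr_ae (hD.mono fun x hx => by
      by_cases hxU : x ∈ U
      · simp only [hx hxU]
      · simp only [h0 x hxU, zero_smul])
  rw [e1, e2]
  exact h.integral_eq φ hφ hc hs v

theorem ae_eq [CompleteSpace F] (h : HasWeakFDeriv U f D) (h' : HasWeakFDeriv U f D')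
    (hU : IsOpen U) : D =ᵐ[volume.restrict U] D' := by
  have key := hU.ae_eq_zero_of_integral_contDiff_smul_eq_zero
    (h.locallyIntegrableOn_deriv.sub h'.locallyIntegrableOn_deriv) fun φ hφ hc hs => by
      have i1 := h.integrable_deriv hφ.continuous hc hs
      have i2 := h'.integrable_deriv hφ.continuous hc hs
      have e : (fun x => φ x • (D - D') x) = fun x => φ x • D x - φ x • D' x := by
        ext1 x; rw [Pi.sub_apply, smul_sub]
      rw [e, integral_sub i1 i2, sub_eq_zero]
      ext1 v
      rw [ContinuousLinearMap.integral_apply i1, ContinuousLinearMap.integral_apply i2]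
      simp only [_root_.smul_apply]
      rw [← neg_inj, ← h.integral_eq φ hφ hc hs v, ← h'.integral_eq φ hφ hc hs v]
  rw [EventuallyEq, ae_restrict_iff' hU.measurableSet]
  exact key.mono fun x hx hxU => sub_eq_zero.1 (hx hxU)

/-- Weak derivatives pass to limits in `L¹` on balls. -/
theorem of_tendsto {fk : ℕ → EuclideanSpace ℝ (Fin m) → F}
    {Dk : ℕ → EuclideanSpace ℝ (Fin m) → EuclideanSpace ℝ (Fin m) →L[ℝ] F}
    (h : ∀ k, HasWeakFDeriv univ (fk k) (Dk k)) (hf : LocallyIntegrable f volume)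
    (hD : LocallyIntegrable D volume)
    (hfk : ∀ R : ℝ, Tendsto (fun k => ∫⁻ x in Metric.ball 0 R, ‖fk k x - f x‖ₑ) atTop (𝓝 0))
    (hDk : ∀ R : ℝ, Tendsto (fun k => ∫⁻ x in Metric.ball 0 R, ‖Dk k x - D x‖ₑ) atTop (𝓝 0)) :
    HasWeakFDeriv univ f D := by
  have key : ∀ (φ : EuclideanSpace ℝ (Fin m) → ℝ), Continuous φ → HasCompactSupport φ →
      ∀ {F' : Type _} [NormedAddCommGroup F'] [NormedSpace ℝ F']
      (u : ℕ → EuclideanSpace ℝ (Fin m) → F') (u₀ : EuclideanSpace ℝ (Fin m) → F'),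
      (∀ k, LocallyIntegrable (u k) volume) → LocallyIntegrable u₀ volume →
      (∀ R : ℝ, Tendsto (fun k => ∫⁻ x in Metric.ball 0 R, ‖u k x - u₀ x‖ₑ) atTop (𝓝 0)) →
      Tendsto (fun k => ∫ x, φ x • u k x) atTop (𝓝 (∫ x, φ x • u₀ x)) := by
    intro φ hφ hc F' _ _ u u₀ hu hu₀ hlim
    obtain ⟨R, hR⟩ := hc.isCompact.isBounded.subset_ball (0 : EuclideanSpace ℝ (Fin m))
    obtain ⟨M, hM⟩ := hc.exists_bound_of_continuous hφ
    have hi : ∀ {w : EuclideanSpace ℝ (Fin m) → F'}, LocallyIntegrable w volume →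
        Integrable (fun x => φ x • w x) volume := fun hw =>
      integrable_smul_of_tsupport_subset (hw.locallyIntegrableOn univ) hφ hc (subset_univ _)
    refine tendsto_integral_of_L1 _ (hi hu₀).aestronglyMeasurable
      (Eventually.of_forall fun k => hi (hu k)) ?_
    have hb : ∀ k, ∫⁻ x, ‖φ x • u k x - φ x • u₀ x‖ₑ
        ≤ ENNReal.ofReal M * ∫⁻ x in Metric.ball 0 R, ‖u k x - u₀ x‖ₑ := fun k => by
      rw [← lintegral_const_mul' _ _ ENNReal.ofReal_ne_top,
          ← lintegral_indicator measurableSet_ball]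
      refine lintegral_mono fun x => ?_
      rw [← smul_sub, enorm_smul]
      by_cases hx : x ∈ Metric.ball (0 : EuclideanSpace ℝ (Fin m)) R
      · rw [indicator_of_mem hx, ← ofReal_norm]
        gcongr
        exact hM x
      · rw [image_eq_zero_of_notMem_tsupport fun h => hx (hR h), enorm_zero, zero_mul]
        exact zero_le
    refine tendsto_of_tendsto_of_tendsto_of_le_of_le tendsto_const_nhds ?_ (fun _ => zero_le) hb
    have := ENNReal.Tendsto.const_mul (hlim R) (Or.inr (ENNReal.ofReal_ne_top (r := M)))
    rwa [mul_zero] at this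
  have hfl : ∀ k, LocallyIntegrable (fk k) volume := fun k =>
    locallyIntegrableOn_univ.1 (h k).locallyIntegrableOn
  have hDl : ∀ k, LocallyIntegrable (Dk k) volume := fun k =>
    locallyIntegrableOn_univ.1 (h k).locallyIntegrableOn_deriv
  refine ⟨hf.locallyIntegrableOn _, hD.locallyIntegrableOn _, fun φ hφ hc hs v => ?_⟩
  have l1 := key (fun x => fderiv ℝ φ x v) (continuous_fderiv_apply_of_contDiff hφ v)
    (hc.fderiv_apply (𝕜 := ℝ) v) fk f hfl hf hfk
  have l2 := key φ hφ.continuous hc Dk D hDl hD hDk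
  have l3 := ((ContinuousLinearMap.apply ℝ F v).continuous.tendsto _).comp l2
  have hi : ∀ {w : EuclideanSpace ℝ (Fin m) → EuclideanSpace ℝ (Fin m) →L[ℝ] F},
      LocallyIntegrable w volume → (∫ x, φ x • w x) v = ∫ x, φ x • w x v := fun hw =>
    ContinuousLinearMap.integral_apply
      (integrable_smul_of_tsupport_subset (hw.locallyIntegrableOn univ) hφ.continuous hc hs) v
  refine tendsto_nhds_unique l1 ?_
  have e : ∀ k, ∫ x, fderiv ℝ φ x v • fk k x = -(∫ x, φ x • Dk k x) v := fun k => by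
    rw [(h k).integral_eq φ hφ hc (subset_univ _) v, hi (hDl k)]
  simp only [e, ← hi hD]
  exact l3.neg

/-- The weak derivative of a Lipschitz function is its derivative. -/
theorem of_lipschitzWith [FiniteDimensional ℝ F] {K : ℝ≥0} (hf : LipschitzWith K f) :
    HasWeakFDeriv univ f (fderiv ℝ f) := by
  have : CompleteSpace F := FiniteDimensional.complete ℝ F
  have hD : LocallyIntegrable (fderiv ℝ f) volume := by
    refine (locallyIntegrable_const (K : ℝ)).mono
      (stronglyMeasurable_fderiv_of_finiteDimensional f).aestronglyMeasurable
      (ae_of_all _ fun x => ?_)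
    rw [Real.norm_of_nonneg (NNReal.coe_nonneg K)]
    exact norm_fderiv_le_of_lipschitz ℝ hf
  refine ⟨hf.continuous.locallyIntegrable.locallyIntegrableOn _, hD.locallyIntegrableOn _,
    fun φ hφ hc hs v => ?_⟩
  have i1 : Integrable (fun x => fderiv ℝ φ x v • f x) volume :=
    integrable_smul_of_tsupport_subset (hf.continuous.locallyIntegrable.locallyIntegrableOn univ)
      (continuous_fderiv_apply_of_contDiff hφ v) (hc.fderiv_apply (𝕜 := ℝ) v) (subset_univ _)
  have i2 : Integrable (fun x => φ x • fderiv ℝ f x v) volume :=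
    (integrable_smul_of_tsupport_subset (hD.locallyIntegrableOn univ) hφ.continuous hc
      hs).apply_continuousLinearMap v
  obtain ⟨K', hφl⟩ := hφ.lipschitzWith_of_hasCompactSupport hc (by simp)
  rw [SeparatingDual.eq_iff_forall_dual_eq (R := ℝ)]
  intro ℓ
  rw [map_neg, ← ℓ.integral_comp_comm i1, ← ℓ.integral_comp_comm i2]
  have hℓ : LipschitzWith (‖ℓ‖₊ * K) (ℓ ∘ f) := ℓ.lipschitz.comp hf
  have := hℓ.integral_lineDeriv_mul_eq (μ := volume) hφl hc v
  have e1 : ∫ x, lineDeriv ℝ (ℓ ∘ f) x v * φ x = ∫ x, ℓ (φ x • fderiv ℝ f x v) := by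
    refine integral_congr_ae (hf.ae_differentiableAt.mono fun x hx => ?_)
    have h1 : HasFDerivAt (ℓ ∘ f) (ℓ ∘L fderiv ℝ f x) x := ℓ.hasFDerivAt.comp x hx.hasFDerivAt
    simp only [(h1.hasLineDerivAt v).lineDeriv, map_smul, smul_eq_mul,
      ContinuousLinearMap.comp_apply]
    ring
  have e2 : ∫ x, lineDeriv ℝ φ x (-v) * (ℓ ∘ f) x = - ∫ x, ℓ (fderiv ℝ φ x v • f x) := by
    rw [← integral_neg]
    refine integral_congr_ae (ae_of_all _ fun x => ?_)
    have h1 := (hφ.differentiable (by simp) x).hasFDerivAt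
    simp only [(h1.hasLineDerivAt (-v)).lineDeriv, map_smul, smul_eq_mul, map_neg,
      Function.comp_apply, neg_mul]
  rw [← e1, this, e2, neg_neg]

theorem const [FiniteDimensional ℝ F] (b : F) :
    HasWeakFDeriv univ (fun _ : EuclideanSpace ℝ (Fin m) => b) 0 := by
  have := of_lipschitzWith (m := m) (LipschitzWith.const b)
  rwa [fderiv_fun_const] at this

/-- The weak derivative vanishes where the function is constant. -/
theorem ae_eq_zero_of_eqOn_const [FiniteDimensional ℝ F] (h : HasWeakFDeriv univ f D)
    (hU : IsOpen U) {b : F} (hb : ∀ x ∈ U, f x = b) : ∀ᵐ x, x ∈ U → D x = 0 := by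
  have : CompleteSpace F := FiniteDimensional.complete ℝ F
  have h1 : HasWeakFDeriv U f 0 := ((const b).mono (subset_univ U)).congr_ae hU.measurableSet
    ((ae_restrict_iff' hU.measurableSet).2 (ae_of_all _ fun x hx => (hb x hx).symm)) (ae_eq_refl _)
  exact (ae_restrict_iff' hU.measurableSet).1 ((h.mono (subset_univ U)).ae_eq h1 hU)

end HasWeakFDeriv

end WeakDerivative

/-! ### Mollification -/

section Mollification

open Filter Topology

variable {m : ℕ} {F : Type*} [NormedAddCommGroup F] [NormedSpace ℝ F]

/-- The regularization of `f` by convolution with a normalized bump function. -/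
noncomputable def mollify (φ : ContDiffBump (0 : EuclideanSpace ℝ (Fin m)))
    (f : EuclideanSpace ℝ (Fin m) → F) (x : EuclideanSpace ℝ (Fin m)) : F :=
  ∫ y, φ.normed volume (x - y) • f y

theorem mollify_eq_convolution (φ : ContDiffBump (0 : EuclideanSpace ℝ (Fin m)))
    (f : EuclideanSpace ℝ (Fin m) → F) :
    mollify φ f = convolution (φ.normed volume) f (ContinuousLinearMap.lsmul ℝ ℝ) volume :=
  funext fun _ => convolution_lsmul_swap.symm

theorem contDiff_mollify (φ : ContDiffBump (0 : EuclideanSpace ℝ (Fin m)))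
    {f : EuclideanSpace ℝ (Fin m) → F} (hf : LocallyIntegrable f volume) :
    ContDiff ℝ ∞ (mollify φ f) := by
  rw [mollify_eq_convolution]
  exact φ.hasCompactSupport_normed.contDiff_convolution_left _ φ.contDiff_normed hf

theorem tsupport_normed_const_sub_subset (φ : ContDiffBump (0 : EuclideanSpace ℝ (Fin m)))
    (x : EuclideanSpace ℝ (Fin m)) :
    tsupport (fun y => φ.normed volume (x - y)) ⊆ Metric.closedBall x φ.rOut := by
  refine closure_minimal (fun y hy => ?_) Metric.isClosed_closedBall
  have : x - y ∈ Function.support (φ.normed volume) := hy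
  rw [φ.support_normed_eq, mem_ball_zero_iff] at this
  rw [Metric.mem_closedBall, dist_eq_norm, norm_sub_rev]
  exact this.le

theorem hasCompactSupport_normed_const_sub (φ : ContDiffBump (0 : EuclideanSpace ℝ (Fin m)))
    (x : EuclideanSpace ℝ (Fin m)) : HasCompactSupport (fun y => φ.normed volume (x - y)) :=
  HasCompactSupport.of_support_subset_isCompact (isCompact_closedBall x φ.rOut)
    (subset_closure.trans (tsupport_normed_const_sub_subset φ x))

theorem continuous_normed_const_sub (φ : ContDiffBump (0 : EuclideanSpace ℝ (Fin m)))
    (x : EuclideanSpace ℝ (Fin m)) : Continuous (fun y => φ.normed volume (x - y)) :=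
  φ.continuous_normed.comp (continuous_const.sub continuous_id)

theorem integrable_normed_const_sub_smul (φ : ContDiffBump (0 : EuclideanSpace ℝ (Fin m)))
    {f : EuclideanSpace ℝ (Fin m) → F} (hf : LocallyIntegrable f volume)
    (x : EuclideanSpace ℝ (Fin m)) :
    Integrable (fun y => φ.normed volume (x - y) • f y) volume :=
  integrable_smul_of_tsupport_subset (hf.locallyIntegrableOn univ)
    (continuous_normed_const_sub φ x) (hasCompactSupport_normed_const_sub φ x) (subset_univ _)

/-- The derivative of the regularization is the regularization of the weak derivative. -/
theorem HasWeakFDeriv.fderiv_mollify {U : Set (EuclideanSpace ℝ (Fin m))}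
    {f : EuclideanSpace ℝ (Fin m) → F}
    {D : EuclideanSpace ℝ (Fin m) → EuclideanSpace ℝ (Fin m) →L[ℝ] F}
    (h : HasWeakFDeriv U f D) (hf : LocallyIntegrable f volume) (hD : LocallyIntegrable D volume)
    (φ : ContDiffBump (0 : EuclideanSpace ℝ (Fin m))) {x : EuclideanSpace ℝ (Fin m)}
    (hx : Metric.closedBall x φ.rOut ⊆ U) :
    fderiv ℝ (mollify φ f) x = mollify φ D x := by
  have hη : ContDiff ℝ ∞ (φ.normed volume : EuclideanSpace ℝ (Fin m) → ℝ) := φ.contDiff_normed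
  have h1 := (φ.hasCompactSupport_normed (μ := volume)).hasFDerivAt_convolution_left
    (ContinuousLinearMap.lsmul ℝ ℝ : ℝ →L[ℝ] F →L[ℝ] F) (μ := volume) φ.contDiff_normed hf x
  rw [mollify_eq_convolution φ f, h1.fderiv]
  ext1 v
  have hψ : ∀ y, fderiv ℝ (fun y => φ.normed volume (x - y)) y v
      = - fderiv ℝ (φ.normed volume) (x - y) v := fun y => by
    have e := ((hη.differentiable (by simp) (x - y)).hasFDerivAt).comp y
      ((hasFDerivAt_id y).const_sub x)
    have e' : fderiv ℝ (fun y => φ.normed volume (x - y)) y = _ := e.fderiv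
    rw [e']
    simp
  have hw := h.integral_eq (fun y => φ.normed volume (x - y))
    (hη.comp (contDiff_const.sub contDiff_id)) (hasCompactSupport_normed_const_sub φ x)
    ((tsupport_normed_const_sub_subset φ x).trans hx) v
  simp only [hψ, neg_smul, integral_neg, neg_inj] at hw
  rw [convolution_eq_swap, ContinuousLinearMap.integral_apply]
  · simp only [ContinuousLinearMap.precompL_apply, ContinuousLinearMap.lsmul_apply]
    rw [hw, mollify, ContinuousLinearMap.integral_apply (integrable_normed_const_sub_smul φ hD x)]
    rfl
  · have := ((φ.hasCompactSupport_normed (μ := volume)).fderiv ℝ).convolutionExists_left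
      ((ContinuousLinearMap.lsmul ℝ ℝ : ℝ →L[ℝ] F →L[ℝ] F).precompL (EuclideanSpace ℝ (Fin m)))
      (μ := volume) (hη.continuous_fderiv (by simp)) hf x
    exact this.integrable_swap

theorem lintegral_normed_sub_const (φ : ContDiffBump (0 : EuclideanSpace ℝ (Fin m)))
    (y : EuclideanSpace ℝ (Fin m)) :
    ∫⁻ x, ENNReal.ofReal (φ.normed volume (x - y)) = 1 := by
  rw [lintegral_sub_right_eq_self (fun x => ENNReal.ofReal (φ.normed volume x)) y,
    ← ofReal_integral_eq_lintegral_ofReal φ.integrable_normed (ae_of_all _ φ.nonneg_normed),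
    φ.integral_normed, ENNReal.ofReal_one]

/-- Regularization does not increase the `L¹` norm. -/
theorem lintegral_enorm_mollify_le (φ : ContDiffBump (0 : EuclideanSpace ℝ (Fin m)))
    {f : EuclideanSpace ℝ (Fin m) → F} (hf : AEStronglyMeasurable f volume) :
    ∫⁻ x, ‖mollify φ f x‖ₑ ≤ ∫⁻ x, ‖f x‖ₑ := by
  have hm : AEMeasurable (fun z : EuclideanSpace ℝ (Fin m) × EuclideanSpace ℝ (Fin m) =>
      ENNReal.ofReal (φ.normed volume (z.1 - z.2)) * ‖f z.2‖ₑ) (volume.prod volume) := by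
    refine AEMeasurable.mul ?_ hf.enorm.comp_snd
    exact (ENNReal.measurable_ofReal.comp
      (φ.continuous_normed.measurable.comp (measurable_fst.sub measurable_snd))).aemeasurable
  calc ∫⁻ x, ‖mollify φ f x‖ₑ
      ≤ ∫⁻ x, ∫⁻ y, ENNReal.ofReal (φ.normed volume (x - y)) * ‖f y‖ₑ := by
        refine lintegral_mono fun x => (enorm_integral_le_lintegral_enorm _).trans (le_of_eq ?_)
        refine lintegral_congr fun y => ?_
        rw [enorm_smul, Real.enorm_of_nonneg (φ.nonneg_normed _)]
    _ = ∫⁻ y, ∫⁻ x, ENNReal.ofReal (φ.normed volume (x - y)) * ‖f y‖ₑ :=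
        lintegral_lintegral_swap hm
    _ = ∫⁻ y, ‖f y‖ₑ := by
        refine lintegral_congr fun y => ?_
        rw [lintegral_mul_const', lintegral_normed_sub_const, one_mul]
        exact enorm_ne_top

theorem mollify_sub (φ : ContDiffBump (0 : EuclideanSpace ℝ (Fin m)))
    {f g : EuclideanSpace ℝ (Fin m) → F} (hf : LocallyIntegrable f volume)
    (hg : LocallyIntegrable g volume) (x : EuclideanSpace ℝ (Fin m)) :
    mollify φ (fun y => f y - g y) x = mollify φ f x - mollify φ g x := by
  simp only [mollify, smul_sub]
  exact integral_sub (integrable_normed_const_sub_smul φ hf x)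
    (integrable_normed_const_sub_smul φ hg x)

/-- A sequence of bump functions whose supports shrink to the origin. -/
noncomputable def shrinkingBump (k : ℕ) : ContDiffBump (0 : EuclideanSpace ℝ (Fin m)) where
  rIn := 1 / (2 * (k + 1))
  rOut := 1 / (k + 1)
  rIn_pos := by positivity
  rIn_lt_rOut := by
    have : (0 : ℝ) < k + 1 := by positivity
    exact one_div_lt_one_div_of_lt this (by linarith)

theorem tendsto_rOut_shrinkingBump :
    Tendsto (fun k => (shrinkingBump (m := m) k).rOut) atTop (𝓝 0) :=
  tendsto_one_div_add_atTop_nhds_zero_nat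

theorem ae_tendsto_mollify [CompleteSpace F] {f : EuclideanSpace ℝ (Fin m) → F}
    (hf : LocallyIntegrable f volume) :
    ∀ᵐ x, Tendsto (fun k => mollify (shrinkingBump k) f x) atTop (𝓝 (f x)) := by
  simp only [mollify_eq_convolution]
  refine ContDiffBump.ae_convolution_tendsto_right_of_locallyIntegrable (K := 2)
    tendsto_rOut_shrinkingBump (Eventually.of_forall fun k => ?_) hf
  simp only [shrinkingBump]
  apply le_of_eq
  field_simp

/-! ### Comparison of a function with its dilations -/

theorem lintegral_comp_homothety (f : EuclideanSpace ℝ (Fin m) → ℝ≥0∞) {t : ℝ} (ht : 0 < t)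
    (c : EuclideanSpace ℝ (Fin m)) :
    ∫⁻ x, f (c + t • (x - c)) = ENNReal.ofReal (t⁻¹ ^ m) * ∫⁻ x, f x := by
  rw [← lintegral_comp_rescale f (inv_pos.2 ht) (c - t⁻¹ • c)]
  refine lintegral_congr fun x => ?_
  congr 1
  rw [inv_inv, smul_sub, smul_sub, smul_sub, smul_smul, mul_inv_cancel₀ ht.ne', one_smul]
  abel

theorem ae_comp_homothety {P : EuclideanSpace ℝ (Fin m) → Prop} (hP : ∀ᵐ x, P x) {t : ℝ}
    (ht : 0 < t) (c : EuclideanSpace ℝ (Fin m)) : ∀ᵐ x, P (c + t • (x - c)) := by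
  have h0 : volume {x | ¬ P x} = 0 := hP
  set S := toMeasurable volume {x | ¬ P x} with hS
  have hSm : MeasurableSet S := measurableSet_toMeasurable _ _
  have h1 := lintegral_comp_homothety (S.indicator 1) ht c
  rw [lintegral_indicator_one hSm, hS, measure_toMeasurable, h0, mul_zero, ← hS,
    lintegral_eq_zero_iff] at h1
  · refine h1.mono fun x hx => ?_
    by_contra hPx
    have : c + t • (x - c) ∈ S := subset_toMeasurable _ _ hPx
    have hx' : S.indicator (1 : EuclideanSpace ℝ (Fin m) → ℝ≥0∞) (c + t • (x - c)) = 0 := hx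
    rw [indicator_of_mem this] at hx'
    exact one_ne_zero hx'
  · exact (measurable_one.indicator hSm).comp (by fun_prop)

/-- The difference between a smooth function and its dilation is an integral of the derivative along
segments. -/
theorem lintegral_enorm_sub_comp_homothety_le_of_contDiff [CompleteSpace F]
    {g : EuclideanSpace ℝ (Fin m) → F} (hg : ContDiff ℝ 1 g) {A : Set (EuclideanSpace ℝ (Fin m))}
    {c : EuclideanSpace ℝ (Fin m)} {R θ : ℝ} (hθ : 1 / 2 ≤ θ) (hθ' : θ ≤ 2) (hA : MeasurableSet A)
    (hR : ∀ x ∈ A, ‖x - c‖ ≤ R) {H : EuclideanSpace ℝ (Fin m) → ℝ≥0∞} (hH : Measurable H)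
    (hgH : ∀ x ∈ A, ∀ t ∈ uIcc θ 1, ‖fderiv ℝ g (c + t • (x - c))‖ₑ ≤ H (c + t • (x - c))) :
    ∫⁻ x in A, ‖g x - g (c + θ • (x - c))‖ₑ ≤ ENNReal.ofReal R * 2 ^ m * ∫⁻ x, H x := by
  have hpt : ∀ x ∈ A, ‖g x - g (c + θ • (x - c))‖ₑ
      ≤ ∫⁻ t in uIoc θ 1, ENNReal.ofReal R * H (c + t • (x - c)) := by
    intro x hx
    have hd : ∀ t, HasDerivAt (fun t : ℝ => g (c + t • (x - c)))
        (fderiv ℝ g (c + t • (x - c)) (x - c)) t := fun t => by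
      have h1 : HasDerivAt (fun t : ℝ => c + t • (x - c)) (x - c) t := by
        simpa using ((hasDerivAt_id t).smul_const (x - c)).const_add c
      exact (hg.differentiable (by simp) _).hasFDerivAt.comp_hasDerivAt t h1
    have hcont : Continuous fun t : ℝ => fderiv ℝ g (c + t • (x - c)) (x - c) :=
      ((hg.continuous_fderiv (by simp)).comp (by fun_prop)).clm_apply continuous_const
    have hint := intervalIntegral.integral_eq_sub_of_hasDerivAt (a := θ) (b := 1)
      (fun t _ => hd t) (hcont.intervalIntegrable _ _)
    rw [one_smul, add_sub_cancel] at hint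
    rw [← hint, ← ofReal_norm, intervalIntegral.norm_intervalIntegral_eq, ofReal_norm]
    refine (enorm_integral_le_lintegral_enorm _).trans ?_
    refine setLIntegral_mono' measurableSet_uIoc fun t ht => ?_
    refine (ContinuousLinearMap.le_opENorm _ _).trans ?_
    rw [mul_comm, ← ofReal_norm (x - c)]
    exact mul_le_mul' (ENNReal.ofReal_le_ofReal (hR x hx)) (hgH x hx t (uIoc_subset_uIcc ht))
  have hmeas : Measurable fun z : EuclideanSpace ℝ (Fin m) × ℝ =>
      ENNReal.ofReal R * H (c + z.2 • (z.1 - c)) :=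
    (hH.comp (by fun_prop)).const_mul _
  calc ∫⁻ x in A, ‖g x - g (c + θ • (x - c))‖ₑ
      ≤ ∫⁻ x in A, ∫⁻ t in uIoc θ 1, ENNReal.ofReal R * H (c + t • (x - c)) :=
        setLIntegral_mono' hA hpt
    _ = ∫⁻ t in uIoc θ 1, ∫⁻ x in A, ENNReal.ofReal R * H (c + t • (x - c)) :=
        lintegral_lintegral_swap hmeas.aemeasurable
    _ ≤ ∫⁻ _t in uIoc θ 1, ENNReal.ofReal R * 2 ^ m * ∫⁻ x, H x := by
        refine setLIntegral_mono' measurableSet_uIoc fun t ht => ?_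
        have ht2 : 1 / 2 ≤ t := by
          have := (uIoc_subset_uIcc ht).1
          exact le_trans (le_min hθ (by norm_num)) this
        refine (setLIntegral_le_lintegral _ _).trans ?_
        rw [lintegral_const_mul' _ _ ENNReal.ofReal_ne_top,
          lintegral_comp_homothety H (by linarith) c, ← mul_assoc]
        gcongr
        rw [show (2 : ℝ≥0∞) ^ m = ENNReal.ofReal (2 ^ m) by
          rw [ENNReal.ofReal_pow (by norm_num)]; norm_num]
        refine ENNReal.ofReal_le_ofReal (pow_le_pow_left₀ (by positivity) ?_ _)
        rw [inv_le_comm₀ (by linarith) (by norm_num)]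
        linarith
    _ ≤ ENNReal.ofReal R * 2 ^ m * ∫⁻ x, H x := by
        rw [setLIntegral_const]
        refine mul_le_of_le_one_right' ?_
        rw [uIoc, Real.volume_Ioc, ENNReal.ofReal_le_one]
        rcases le_total θ 1 with h | h
        · rw [max_eq_right h, min_eq_left h]; linarith
        · rw [max_eq_left h, min_eq_right h]; linarith

theorem integrable_indicator_of_integrableOn {X E : Type*} [MeasurableSpace X] {μ : Measure X}
    [NormedAddCommGroup E] {U : Set X} {f : X → E} (hU : MeasurableSet U)
    (hf : IntegrableOn f U μ) : Integrable (U.indicator f) μ :=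
  hf.integrable_indicator hU

theorem enorm_indicator_of_normed {X E : Type*} [NormedAddCommGroup E] (U : Set X) (f : X → E)
    (x : X) : ‖U.indicator f x‖ₑ = U.indicator (fun x => ‖f x‖ₑ) x :=
  enorm_indicator_eq_indicator_enorm _ _

/-- The estimate of the difference between a function and its dilation, for weak derivatives. -/
theorem HasWeakFDeriv.lintegral_enorm_sub_comp_homothety_le [CompleteSpace F]
    {U : Set (EuclideanSpace ℝ (Fin m))} (hU : IsOpen U) {f : EuclideanSpace ℝ (Fin m) → F}
    {D : EuclideanSpace ℝ (Fin m) → EuclideanSpace ℝ (Fin m) →L[ℝ] F}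
    (h : HasWeakFDeriv U f D) (hf : IntegrableOn f U volume) (hD : IntegrableOn D U volume)
    {A : Set (EuclideanSpace ℝ (Fin m))} {c : EuclideanSpace ℝ (Fin m)} {R θ δ : ℝ}
    (hθ : 1 / 2 ≤ θ) (hθ' : θ ≤ 2) (hA : MeasurableSet A) (hR : ∀ x ∈ A, ‖x - c‖ ≤ R) (hδ : 0 < δ)
    (hAU : ∀ x ∈ A, ∀ t ∈ uIcc θ 1, Metric.closedBall (c + t • (x - c)) δ ⊆ U) :
    ∫⁻ x in A, ‖f x - f (c + θ • (x - c))‖ₑ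
      ≤ ENNReal.ofReal R * 2 ^ m * ∫⁻ x in U, ‖D x‖ₑ := by
  have hf' : Integrable (U.indicator f) volume := hf.integrable_indicator hU.measurableSet
  have hD' : Integrable (U.indicator D) volume :=
    integrable_indicator_of_integrableOn hU.measurableSet hD
  have h' : HasWeakFDeriv U (U.indicator f) (U.indicator D) := by
    refine h.congr_ae hU.measurableSet ?_ ?_ <;>
    exact (ae_restrict_iff' hU.measurableSet).2 (ae_of_all _ fun x hx =>
      (indicator_of_mem hx _).symm)
  set fk : ℕ → EuclideanSpace ℝ (Fin m) → F := fun k => mollify (shrinkingBump k) (U.indicator f)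
  have hfk : ∀ k, ContDiff ℝ ∞ (fk k) := fun k => contDiff_mollify _ hf'.locallyIntegrable
  have hDint : ∫⁻ x, ‖U.indicator D x‖ₑ = ∫⁻ x in U, ‖D x‖ₑ := by
    rw [← lintegral_indicator hU.measurableSet]
    exact lintegral_congr fun x => enorm_indicator_of_normed _ _ _
  have hev : ∀ᶠ k in atTop, ∫⁻ x in A, ‖fk k x - fk k (c + θ • (x - c))‖ₑ
      ≤ ENNReal.ofReal R * 2 ^ m * ∫⁻ x in U, ‖D x‖ₑ := by
    filter_upwards [tendsto_rOut_shrinkingBump.eventually (gt_mem_nhds hδ)] with k hk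
    refine (lintegral_enorm_sub_comp_homothety_le_of_contDiff ((hfk k).of_le (by simp)) hθ hθ' hA hR
      (H := fun x => ‖mollify (shrinkingBump k) (U.indicator D) x‖ₑ)
      (contDiff_mollify _ hD'.locallyIntegrable).continuous.enorm.measurable
      fun x hx t ht => ?_).trans ?_
    · rw [h'.fderiv_mollify hf'.locallyIntegrable hD'.locallyIntegrable]
      exact (Metric.closedBall_subset_closedBall hk.le).trans (hAU x hx t ht)
    · refine mul_le_mul_right ?_ _
      rw [← hDint]
      exact lintegral_enorm_mollify_le _ hD'.aestronglyMeasurable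
  have hae := ae_tendsto_mollify hf'.locallyIntegrable
  have hlim : ∀ᵐ x ∂(volume.restrict A), ‖f x - f (c + θ • (x - c))‖ₑ
      = liminf (fun k => ‖fk k x - fk k (c + θ • (x - c))‖ₑ) atTop := by
    rw [ae_restrict_iff' hA]
    filter_upwards [hae, ae_comp_homothety hae (by linarith : 0 < θ) c] with x hx1 hx2 hxA
    have hxU : x ∈ U := by
      have := hAU x hxA 1 right_mem_uIcc (Metric.mem_closedBall_self hδ.le)
      rwa [one_smul, add_sub_cancel] at this
    have hxU' : c + θ • (x - c) ∈ U :=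
      hAU x hxA θ left_mem_uIcc (Metric.mem_closedBall_self hδ.le)
    rw [indicator_of_mem hxU] at hx1
    rw [indicator_of_mem hxU'] at hx2
    exact ((hx1.sub hx2).enorm.liminf_eq).symm
  rw [lintegral_congr_ae hlim]
  refine (lintegral_liminf_le fun k => ?_).trans ?_
  · exact ((hfk k).continuous.sub ((hfk k).continuous.comp (by fun_prop))).enorm.measurable
  · exact liminf_le_of_frequently_le' hev.frequently

end Mollification

/-! ### Gluing weakly differentiable functions -/

section WeakGluing

open Filter Topology

variable {m : ℕ} {F : Type*} [NormedAddCommGroup F] [NormedSpace ℝ F]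

theorem ae_notMem_sphere (hm : 0 < m) (c : EuclideanSpace ℝ (Fin m)) (r : ℝ) :
    ∀ᵐ x : EuclideanSpace ℝ (Fin m), x ∉ Metric.sphere c r := by
  have : Nonempty (Fin m) := ⟨⟨0, hm⟩⟩
  exact measure_eq_zero_iff_ae_notMem.1 (Measure.addHaar_sphere _ _ _)

theorem HasWeakFDeriv.ae_eq_zero_of_notMem_ball [FiniteDimensional ℝ F] (hm : 0 < m)
    {f : EuclideanSpace ℝ (Fin m) → F}
    {D : EuclideanSpace ℝ (Fin m) → EuclideanSpace ℝ (Fin m) →L[ℝ] F} (h : HasWeakFDeriv univ f D)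
    {c : EuclideanSpace ℝ (Fin m)} {ρ : ℝ} {b : F} (hb : ∀ x ∉ Metric.ball c ρ, f x = b) :
    ∀ᵐ x, x ∉ Metric.ball c ρ → D x = 0 := by
  filter_upwards [h.ae_eq_zero_of_eqOn_const
      (Metric.isClosed_closedBall (x := c) (ε := ρ)).isOpen_compl
    (b := b) fun x hx => hb x fun h => hx (Metric.ball_subset_closedBall h),
    ae_notMem_sphere hm c ρ] with x hx hxs hxb
  refine hx fun hxc => ?_
  rcases (Metric.ball_union_sphere (x := c) (ε := ρ)).symm ▸ hxc with h | h
  · exact hxb h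
  · exact hxs h

/-- A Poincaré inequality for functions that are constant outside a ball: the ball is compared with
its dilation by the factor `2` from a centre at distance three times its radius. -/
theorem HasWeakFDeriv.lintegral_enorm_sub_const_le [FiniteDimensional ℝ F] (hm : 0 < m)
    {f : EuclideanSpace ℝ (Fin m) → F}
    {D : EuclideanSpace ℝ (Fin m) → EuclideanSpace ℝ (Fin m) →L[ℝ] F} (h : HasWeakFDeriv univ f D)
    {c : EuclideanSpace ℝ (Fin m)} {ρ : ℝ} (hρ : 0 < ρ) {b : F}
    (hb : ∀ x ∉ Metric.ball c ρ, f x = b) :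
    ∫⁻ x in Metric.ball c ρ, ‖f x - b‖ₑ ≤ ENNReal.ofReal (4 * ρ) * 2 ^ m * ∫⁻ x, ‖D x‖ₑ := by
  have : CompleteSpace F := FiniteDimensional.complete ℝ F
  have : Nonempty (Fin m) := ⟨⟨0, hm⟩⟩
  obtain ⟨e, he⟩ := exists_norm_eq (EuclideanSpace ℝ (Fin m)) (show (0 : ℝ) ≤ 3 * ρ by positivity)
  have hnorm : ∀ x ∈ Metric.ball c ρ, ‖x - (c + e)‖ ≤ 4 * ρ := fun x hx => by
    rw [Metric.mem_ball, dist_eq_norm] at hx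
    have := norm_sub_le (x - c) e
    rw [sub_sub] at this
    linarith
  have hint : ∀ {E : Type _} [NormedAddCommGroup E] {w : EuclideanSpace ℝ (Fin m) → E},
      LocallyIntegrableOn w univ volume → IntegrableOn w (Metric.ball (c + e) (10 * ρ)) volume :=
    fun hw => (hw.integrableOn_compact_subset (subset_univ _)
      (isCompact_closedBall (c + e) (10 * ρ))).mono_set Metric.ball_subset_closedBall
  have key :=
    (h.mono (subset_univ (Metric.ball (c + e) (10 * ρ)))).lintegral_enorm_sub_comp_homothety_le
    Metric.isOpen_ball (hint h.locallyIntegrableOn) (hint h.locallyIntegrableOn_deriv)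
    (A := Metric.ball c ρ) (c := c + e) (R := 4 * ρ) (θ := 2) (δ := ρ) (by norm_num) le_rfl
    measurableSet_ball hnorm hρ fun x hx t ht y hy => by
      rw [uIcc_of_ge (by norm_num)] at ht
      rw [Metric.mem_closedBall, dist_eq_norm] at hy
      rw [Metric.mem_ball, dist_eq_norm]
      have h1 : ‖t • (x - (c + e))‖ ≤ 2 * (4 * ρ) := by
        rw [norm_smul, Real.norm_of_nonneg (by linarith [ht.1])]
        exact mul_le_mul ht.2 (hnorm x hx) (norm_nonneg _) (by norm_num)
      calc ‖y - (c + e)‖ = ‖(y - (c + e + t • (x - (c + e)))) + t • (x - (c + e))‖ := by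
            congr 1; abel
        _ ≤ ρ + 2 * (4 * ρ) := (norm_add_le _ _).trans (add_le_add hy h1)
        _ < 10 * ρ := by linarith
  calc ∫⁻ x in Metric.ball c ρ, ‖f x - b‖ₑ
      = ∫⁻ x in Metric.ball c ρ, ‖f x - f (c + e + (2 : ℝ) • (x - (c + e)))‖ₑ := by
        refine setLIntegral_congr_fun measurableSet_ball fun x hx => ?_
        rw [hb (c + e + (2 : ℝ) • (x - (c + e)))]
        rw [Metric.mem_ball, dist_eq_norm, not_lt]
        rw [Metric.mem_ball, dist_eq_norm] at hx
        have h1 : c + e + (2 : ℝ) • (x - (c + e)) - c = (x - c) + (x - c) - e := by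
          rw [two_smul]; abel
        have h2 := norm_sub_norm_le e ((x - c) + (x - c))
        rw [norm_sub_rev] at h2
        have h3 := norm_add_le (x - c) (x - c)
        rw [h1]
        linarith
    _ ≤ _ := key
    _ ≤ _ := mul_le_mul_right (setLIntegral_le_lintegral _ _) _

theorem integrable_glue_zero {X E J : Type*} [MeasurableSpace X] {μ : Measure X}
    [NormedAddCommGroup E] [NormedSpace ℝ E] [Countable J] {U : J → Set X}
    (hU : Pairwise fun i j => Disjoint (U i) (U j)) (hUm : ∀ j, MeasurableSet (U j)) {u : J → X → E}
    (hu : ∀ j, IntegrableOn (u j) (U j) μ) (hs : ∑' j, ∫⁻ x in U j, ‖u j x‖ₑ ∂μ ≠ ⊤) :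
    Integrable (glue U u 0) μ ∧ ∫ x, glue U u 0 x ∂μ = ∑' j, ∫ x in U j, u j x ∂μ := by
  have heq : ∀ j, EqOn (glue U u 0) (u j) (U j) := fun j x hx => glue_of_mem hU u 0 hx
  have hon : IntegrableOn (glue U u 0) (⋃ j, U j) μ := by
    refine ⟨(aestronglyMeasurable_iUnion_iff).2 fun j => ?_, ?_⟩
    · exact ((hu j).congr_fun (heq j).symm (hUm j)).aestronglyMeasurable
    · rw [HasFiniteIntegral, lintegral_iUnion hUm hU]
      refine lt_of_le_of_lt (le_of_eq (tsum_congr fun j => ?_)) hs.lt_top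
      exact setLIntegral_congr_fun (hUm j) fun x hx => by rw [heq j hx]
  have hsupp : Function.support (glue U u 0) ⊆ ⋃ j, U j := fun x hx => by
    by_contra hxU
    rw [mem_iUnion] at hxU
    push Not at hxU
    exact hx (glue_of_notMem u 0 hxU)
  refine ⟨(integrableOn_iff_integrable_of_support_subset hsupp).1 hon, ?_⟩
  rw [← setIntegral_eq_integral_of_forall_compl_eq_zero (s := ⋃ j, U j) fun x hx =>
    Function.notMem_support.1 fun h => hx (hsupp h), integral_iUnion hUm hU hon]
  exact tsum_congr fun j => setIntegral_congr_fun (hUm j) (heq j)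

theorem smul_glue_zero {X E J : Type*} [AddCommGroup E] [Module ℝ E] {U : J → Set X}
    (hU : Pairwise fun i j => Disjoint (U i) (U j)) (u : J → X → E) (φ : X → ℝ) (x : X) :
    φ x • glue U u 0 x = glue U (fun j x => φ x • u j x) 0 x := by
  by_cases hx : ∃ j, x ∈ U j
  · obtain ⟨j, hj⟩ := hx
    rw [glue_of_mem hU _ _ hj, glue_of_mem hU _ _ hj]
  · push Not at hx
    rw [glue_of_notMem _ _ hx, glue_of_notMem _ _ hx, Pi.zero_apply, smul_zero]

theorem lintegral_enorm_smul_le {X E J : Type*} [MeasurableSpace X] {μ : Measure X}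
    [NormedAddCommGroup E] [NormedSpace ℝ E] {U : J → Set X} {u : J → X → E}
    (hs : ∑' j, ∫⁻ x in U j, ‖u j x‖ₑ ∂μ ≠ ⊤) {φ : X → ℝ} {M : ℝ≥0} (hM : ∀ x, ‖φ x‖ₑ ≤ M) :
    ∑' j, ∫⁻ x in U j, ‖φ x • u j x‖ₑ ∂μ ≠ ⊤ := by
  have h : ∑' j, ∫⁻ x in U j, ‖φ x • u j x‖ₑ ∂μ ≤ M * ∑' j, ∫⁻ x in U j, ‖u j x‖ₑ ∂μ := by
    rw [← ENNReal.tsum_mul_left]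
    refine ENNReal.tsum_le_tsum fun j => ?_
    rw [← lintegral_const_mul' _ _ ENNReal.coe_ne_top]
    refine lintegral_mono fun x => ?_
    rw [enorm_smul]
    exact mul_le_mul_left (hM x) _
  exact ne_top_of_le_ne_top (ENNReal.mul_ne_top ENNReal.coe_ne_top hs) h

/-- Gluing weakly differentiable functions along disjoint balls of the unit ball: the weak derivative
is obtained by gluing the weak derivatives. -/
theorem HasWeakFDeriv.glueBalls [FiniteDimensional ℝ F] (hm : 0 < m) {J : Type} [Countable J]
    {c : J → EuclideanSpace ℝ (Fin m)} {ρ : J → ℝ} (hB : DisjointBalls c ρ)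
    {f : J → EuclideanSpace ℝ (Fin m) → F} {f₀ : EuclideanSpace ℝ (Fin m) → F}
    {D : J → EuclideanSpace ℝ (Fin m) → EuclideanSpace ℝ (Fin m) →L[ℝ] F}
    {D₀ : EuclideanSpace ℝ (Fin m) → EuclideanSpace ℝ (Fin m) →L[ℝ] F}
    (h : ∀ j, HasWeakFDeriv univ (f j) (D j)) (h₀ : HasWeakFDeriv univ f₀ D₀) {b : J → F}
    (hb : ∀ j, ∀ x ∉ Metric.ball (c j) (ρ j), f j x = b j)
    (hb₀ : ∀ j, ∀ x ∈ Metric.ball (c j) (ρ j), f₀ x = b j)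
    (hs : ∑' j, ∫⁻ x, ‖D j x‖ₑ ≠ ⊤) :
    HasWeakFDeriv univ (glueBalls c ρ f f₀) (glueBalls c ρ D D₀) := by
  have : CompleteSpace F := FiniteDimensional.complete ℝ F
  set U : J → Set (EuclideanSpace ℝ (Fin m)) := fun j => Metric.ball (c j) (ρ j) with hUdef
  have hU : Pairwise fun i j => Disjoint (U i) (U j) := hB.disjoint_ball
  have hUm : ∀ j, MeasurableSet (U j) := fun j => measurableSet_ball
  have hint : ∀ {E : Type _} [NormedAddCommGroup E] {w : EuclideanSpace ℝ (Fin m) → E} (j : J),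
      LocallyIntegrableOn w univ volume → IntegrableOn w (U j) volume :=
    fun j hw => (hw.integrableOn_compact_subset (subset_univ _)
      (isCompact_closedBall (c j) (ρ j))).mono_set Metric.ball_subset_closedBall
  have hD0 : ∀ j, ∀ᵐ x, x ∉ U j → D j x = 0 := fun j => (h j).ae_eq_zero_of_notMem_ball hm (hb j)
  have hD₀0 : ∀ᵐ x, ∀ j, x ∈ U j → D₀ x = 0 := ae_all_iff.2 fun j =>
    h₀.ae_eq_zero_of_eqOn_const Metric.isOpen_ball (hb₀ j)
  -- the deviations from the constants are summable
  set g : J → EuclideanSpace ℝ (Fin m) → F := fun j x => f j x - b j with hg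
  have hgi : ∀ j, IntegrableOn (g j) (U j) volume := fun j =>
    hint j ((h j).locallyIntegrableOn.sub (locallyIntegrableOn_const _))
  have hρ1 : ∀ j, ρ j ≤ 2 := fun j => by
    by_contra hlt
    have : Nonempty (Fin m) := ⟨⟨0, hm⟩⟩
    obtain ⟨e, he⟩ := exists_norm_eq (EuclideanSpace ℝ (Fin m)) (hB.pos j).le
    have h1 := hB.subset j (Metric.mem_closedBall_self (hB.pos j).le)
    have h2 := hB.subset j (show c j + e ∈ Metric.closedBall (c j) (ρ j) by
      rw [Metric.mem_closedBall, dist_eq_norm, add_sub_cancel_left, he])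
    rw [mem_ball_zero_iff] at h1 h2
    have h3 := norm_sub_le (c j + e) (c j)
    rw [add_sub_cancel_left, he] at h3
    linarith
  have hgs : ∑' j, ∫⁻ x in U j, ‖g j x‖ₑ ≠ ⊤ := by
    refine ne_top_of_le_ne_top (ENNReal.mul_ne_top (a := ENNReal.ofReal 8 * 2 ^ m)
      (ENNReal.mul_ne_top ENNReal.ofReal_ne_top (by simp)) hs) ?_
    rw [← ENNReal.tsum_mul_left]
    refine ENNReal.tsum_le_tsum fun j => ((h j).lintegral_enorm_sub_const_le hm (hB.pos j)
      (hb j)).trans ?_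
    gcongr
    linarith [hρ1 j]
  have hDi : ∀ j, IntegrableOn (D j) (U j) volume := fun j => hint j (h j).locallyIntegrableOn_deriv
  have hDs : ∑' j, ∫⁻ x in U j, ‖D j x‖ₑ ≠ ⊤ :=
    ne_top_of_le_ne_top hs (ENNReal.tsum_le_tsum fun j => setLIntegral_le_lintegral _ _)
  obtain ⟨hG, -⟩ := integrable_glue_zero hU hUm hgi hgs
  obtain ⟨hH, -⟩ := integrable_glue_zero hU hUm hDi hDs
  have hfeq : ∀ x, _root_.glueBalls c ρ f f₀ x = f₀ x + glue U g 0 x := fun x => by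
    by_cases hx : ∃ j, x ∈ U j
    · obtain ⟨j, hj⟩ := hx
      rw [_root_.glueBalls, glue_of_mem hU _ _ hj, glue_of_mem hU _ _ hj, hb₀ j x hj, hg,
        add_sub_cancel]
    · push Not at hx
      rw [_root_.glueBalls, glue_of_notMem _ _ hx, glue_of_notMem _ _ hx, Pi.zero_apply, add_zero]
  have hDeq : ∀ᵐ x, D₀ x + glue U D 0 x = _root_.glueBalls c ρ D D₀ x := by
    filter_upwards [hD₀0] with x hx0
    by_cases hx : ∃ j, x ∈ U j
    · obtain ⟨j, hj⟩ := hx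
      rw [_root_.glueBalls, glue_of_mem hU _ _ hj, glue_of_mem hU _ _ hj, hx0 j hj, zero_add]
    · push Not at hx
      rw [_root_.glueBalls, glue_of_notMem _ _ hx, glue_of_notMem _ _ hx, Pi.zero_apply, add_zero]
  have main : HasWeakFDeriv univ (fun x => f₀ x + glue U g 0 x) (fun x => D₀ x + glue U D 0 x) := by
    refine ⟨h₀.locallyIntegrableOn.add (hG.locallyIntegrable.locallyIntegrableOn _),
      h₀.locallyIntegrableOn_deriv.add (hH.locallyIntegrable.locallyIntegrableOn _),
      fun φ hφ hc hsu v => ?_⟩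
    have hcv := continuous_fderiv_apply_of_contDiff hφ v
    have hcc : HasCompactSupport fun x => fderiv ℝ φ x v := hc.fderiv_apply (𝕜 := ℝ) v
    have hbd : ∀ {ψ : EuclideanSpace ℝ (Fin m) → ℝ}, Continuous ψ → HasCompactSupport ψ →
        ∃ M : ℝ≥0, ∀ x, ‖ψ x‖ₑ ≤ M := fun {ψ} hψ hψc => by
      obtain ⟨M, hM⟩ := hψc.exists_bound_of_continuous hψ
      refine ⟨M.toNNReal, fun x => ?_⟩
      rw [← ofReal_norm]
      exact ENNReal.ofReal_le_ofReal (hM x)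
    obtain ⟨M₁, hM₁⟩ := hbd hcv hcc
    obtain ⟨M₂, hM₂⟩ := hbd hφ.continuous hc
    obtain ⟨i1, e1⟩ := integrable_glue_zero hU hUm (u := fun j x => fderiv ℝ φ x v • g j x)
      (fun j => (integrable_smul_of_tsupport_subset ((h j).locallyIntegrableOn.sub
        (locallyIntegrableOn_const (b j))) hcv hcc (subset_univ _)).integrableOn)
      (lintegral_enorm_smul_le hgs hM₁)
    obtain ⟨i2, e2⟩ := integrable_glue_zero hU hUm (u := fun j x => φ x • D j x)
      (fun j => ((h j).integrable_deriv hφ.continuous hc hsu).integrableOn)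
      (lintegral_enorm_smul_le hDs hM₂)
    have e3 : (fun x => fderiv ℝ φ x v • (f₀ x + glue U g 0 x)) = fun x =>
        fderiv ℝ φ x v • f₀ x + glue U (fun j x => fderiv ℝ φ x v • g j x) 0 x := by
      ext1 x
      rw [smul_add, smul_glue_zero hU g (fun x => fderiv ℝ φ x v)]
    have e4 : (fun x => φ x • (D₀ x + glue U D 0 x)) = fun x =>
        φ x • D₀ x + glue U (fun j x => φ x • D j x) 0 x := by
      ext1 x
      rw [smul_add, smul_glue_zero hU D φ]
    have e5 : ∫ x, φ x • (D₀ x + glue U D 0 x) v = (∫ x, φ x • (D₀ x + glue U D 0 x)) v := by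
      refine (ContinuousLinearMap.integral_apply
          (φ := fun x => φ x • (D₀ x + glue U D 0 x)) ?_ v).symm
      rw [e4]
      exact (h₀.integrable_deriv hφ.continuous hc hsu).add i2
    rw [e5, e4, e3, integral_add (h₀.integrable_test hφ hc hsu v) i1,
      integral_add (h₀.integrable_deriv hφ.continuous hc hsu) i2, e1, e2,
      h₀.integral_eq φ hφ hc hsu v, _root_.add_apply, neg_add,
      ContinuousLinearMap.integral_apply (h₀.integrable_deriv hφ.continuous hc hsu)]
    congr 1
    -- termwise, the weak derivative of `f j - b j` is `D j`
    have e6 : ∀ j, ∫ x in U j, fderiv ℝ φ x v • g j x = -((∫ x in U j, φ x • D j x) v) := by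
      intro j
      rw [setIntegral_eq_integral_of_forall_compl_eq_zero,
          setIntegral_eq_integral_of_ae_compl_eq_zero,
        ContinuousLinearMap.integral_apply ((h j).integrable_deriv hφ.continuous hc hsu)]
      · have := (h j).integral_eq φ hφ hc hsu v
        have h0 := (const (m := m) (b j)).integral_eq φ hφ hc hsu v
        simp only [hg, smul_sub]
        rw [integral_sub ((h j).integrable_test hφ hc hsu v)
          ((const (m := m) (b j)).integrable_test hφ hc hsu v), this, h0]
        simp
      · filter_upwards [hD0 j] with x hx hxU
        rw [hx hxU, smul_zero]
      · intro x hx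
        rw [hg]
        simp only [hb j x hx, sub_self, smul_zero]
    simp only [e6]
    have hsum : Summable fun j => ∫ x in U j, φ x • D j x := by
      have h1 := lintegral_enorm_smul_le hDs hM₂
      have h2 : ∀ j, ∫⁻ x in U j, ‖φ x • D j x‖ₑ ≠ ⊤ := ENNReal.ne_top_of_tsum_ne_top h1
      refine Summable.of_norm_bounded (ENNReal.summable_toReal h1) fun j => ?_
      rw [← toReal_enorm]
      exact ENNReal.toReal_mono (h2 j) (enorm_integral_le_lintegral_enorm _)
    have hmap := (ContinuousLinearMap.apply ℝ F v).map_tsum hsum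
    simp only [ContinuousLinearMap.apply_apply] at hmap
    rw [hmap, tsum_neg]
  refine main.congr_ae MeasurableSet.univ ?_ ?_
  · exact ae_of_all _ fun x => (hfeq x).symm
  · rw [Measure.restrict_univ]; exact hDeq

end WeakGluing

/-! ### The energy of weakly differentiable functions on `ℝ^m` -/

section WeakEnergy

open Filter Topology

variable {m : ℕ} {F : Type*} [NormedAddCommGroup F] [NormedSpace ℝ F]

theorem enorm_eq_zero_of_normed {E : Type*} [NormedAddCommGroup E] {v : E} (hv : v = 0) :
    ‖v‖ₑ = 0 := by
  rw [hv, enorm_zero]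

theorem enorm_rpow_eq_zero_of_normed {E : Type*} [NormedAddCommGroup E] {v : E} (hv : v = 0) {p : ℝ}
    (hp : 0 < p) : ‖v‖ₑ ^ p = 0 := by
  rw [hv, enorm_zero, ENNReal.zero_rpow_of_pos hp]

/-- The integral over `ℝ^m` of the `p`-th power of the operator norm of the weak derivative, `∞` if
there is no weak derivative. -/
noncomputable def weakEnergy (p : ℝ) (f : EuclideanSpace ℝ (Fin m) → F) : ℝ≥0∞ :=
  ⨅ (D : EuclideanSpace ℝ (Fin m) → EuclideanSpace ℝ (Fin m) →L[ℝ] F)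
    (_ : HasWeakFDeriv univ f D), ∫⁻ x, ‖D x‖ₑ ^ p

theorem weakEnergy_le (p : ℝ) {f : EuclideanSpace ℝ (Fin m) → F}
    {D : EuclideanSpace ℝ (Fin m) → EuclideanSpace ℝ (Fin m) →L[ℝ] F}
    (h : HasWeakFDeriv univ f D) : weakEnergy p f ≤ ∫⁻ x, ‖D x‖ₑ ^ p :=
  iInf₂_le D h

theorem weakEnergy_eq [CompleteSpace F] (p : ℝ) {f : EuclideanSpace ℝ (Fin m) → F}
    {D : EuclideanSpace ℝ (Fin m) → EuclideanSpace ℝ (Fin m) →L[ℝ] F}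
    (h : HasWeakFDeriv univ f D) : weakEnergy p f = ∫⁻ x, ‖D x‖ₑ ^ p := by
  refine le_antisymm (weakEnergy_le p h) (le_iInf₂ fun D' h' => le_of_eq (lintegral_congr_ae ?_))
  have := h.ae_eq h' isOpen_univ
  rw [Measure.restrict_univ] at this
  exact this.mono fun x hx => by simp only [hx]

theorem exists_hasWeakFDeriv_of_weakEnergy_ne_top {p : ℝ} {f : EuclideanSpace ℝ (Fin m) → F}
    (h : weakEnergy p f ≠ ⊤) : ∃ D, HasWeakFDeriv univ f D := by
  by_contra hne
  push Not at hne
  exact h (by simp [weakEnergy, hne])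

theorem weakEnergy_congr_ae (p : ℝ) {f g : EuclideanSpace ℝ (Fin m) → F} (h : f =ᵐ[volume] g) :
    weakEnergy p f = weakEnergy p g := by
  have key : ∀ {f g : EuclideanSpace ℝ (Fin m) → F}, f =ᵐ[volume] g →
      weakEnergy p f ≤ weakEnergy p g := fun h =>
    le_iInf₂ fun D hD => weakEnergy_le p (hD.congr_ae MeasurableSet.univ
      (by rw [Measure.restrict_univ]; exact h.symm) (ae_eq_refl _))
  exact le_antisymm (key h) (key h.symm)

theorem weakEnergy_const [FiniteDimensional ℝ F] {p : ℝ} (hp : 0 < p) (b : F) :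
    weakEnergy p (fun _ : EuclideanSpace ℝ (Fin m) => b) = 0 := by
  refine le_antisymm ((weakEnergy_le p (HasWeakFDeriv.const b)).trans (le_of_eq ?_)) zero_le
  exact (lintegral_congr fun x => enorm_rpow_eq_zero_of_normed rfl hp).trans lintegral_zero

theorem locallyIntegrable_comp_rescale {E : Type*} [NormedAddCommGroup E]
    {f : EuclideanSpace ℝ (Fin m) → E} (hf : LocallyIntegrable f volume) {t : ℝ} (ht : 0 < t)
    (h : EuclideanSpace ℝ (Fin m)) : LocallyIntegrable (fun x => f (t⁻¹ • (x - h))) volume := by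
  have ht' : t⁻¹ ≠ 0 := inv_ne_zero ht.ne'
  let e : EuclideanSpace ℝ (Fin m) ≃ₜ EuclideanSpace ℝ (Fin m) :=
    (Homeomorph.subRight h).trans (Homeomorph.smulOfNeZero t⁻¹ ht')
  have hmap : Measure.map e volume
      = ENNReal.ofReal |(t⁻¹ ^ Module.finrank ℝ (EuclideanSpace ℝ (Fin m)))⁻¹| •
        (volume : Measure (EuclideanSpace ℝ (Fin m))) := by
    have h1 : Measure.map e volume =
        Measure.map (fun x : EuclideanSpace ℝ (Fin m) => t⁻¹ • x)
          (Measure.map (fun x => x - h) volume) := by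
      rw [Measure.map_map (measurable_const_smul _) (measurable_sub_const h)]
      rfl
    rw [h1, map_sub_right_eq_self, Measure.map_addHaar_smul _ ht']
  have h2 : LocallyIntegrable f (Measure.map e volume) := by
    rw [hmap]
    intro x
    obtain ⟨s, hs, hsi⟩ := hf x
    refine ⟨s, hs, ?_⟩
    rw [IntegrableOn, Measure.restrict_smul]
    exact Integrable.smul_measure hsi ENNReal.ofReal_ne_top
  exact (locallyIntegrable_map_homeomorph e).1 h2

theorem HasWeakFDeriv.comp_rescale {f : EuclideanSpace ℝ (Fin m) → F}
    {D : EuclideanSpace ℝ (Fin m) → EuclideanSpace ℝ (Fin m) →L[ℝ] F}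
    (hf : HasWeakFDeriv univ f D) {t : ℝ} (ht : 0 < t) (h : EuclideanSpace ℝ (Fin m)) :
    HasWeakFDeriv univ (fun x => f (t⁻¹ • (x - h))) (fun x => t⁻¹ • D (t⁻¹ • (x - h))) := by
  have hfl := locallyIntegrableOn_univ.1 hf.locallyIntegrableOn
  have hDl := locallyIntegrableOn_univ.1 hf.locallyIntegrableOn_deriv
  refine ⟨(locallyIntegrable_comp_rescale hfl ht h).locallyIntegrableOn _,
    ((locallyIntegrable_comp_rescale hDl ht h).smul t⁻¹).locallyIntegrableOn _,
    fun φ hφ hc hs v => ?_⟩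
  have hcov : ∀ G : EuclideanSpace ℝ (Fin m) → F, ∫ x, G (t⁻¹ • (x - h))
      = |t ^ Module.finrank ℝ (EuclideanSpace ℝ (Fin m))| • ∫ x, G x := fun G => by
    rw [integral_sub_right_eq_self (fun x => G (t⁻¹ • x)) h, Measure.integral_comp_inv_smul]
  have hinv : ∀ x : EuclideanSpace ℝ (Fin m), t • (t⁻¹ • (x - h)) + h = x := fun x => by
    rw [smul_smul, mul_inv_cancel₀ ht.ne', one_smul, sub_add_cancel]
  set ψ : EuclideanSpace ℝ (Fin m) → ℝ := fun y => φ (t • y + h) with hψ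
  have hψs : ContDiff ℝ ∞ ψ := hφ.comp ((contDiff_id.const_smul t).add contDiff_const)
  have hψc : HasCompactSupport ψ := hc.comp_homeomorph
    ((Homeomorph.smulOfNeZero t ht.ne').trans (Homeomorph.addRight h))
  have hψd : ∀ y, fderiv ℝ ψ y v = t * fderiv ℝ φ (t • y + h) v := fun y => by
    have h1 : HasFDerivAt (fun y : EuclideanSpace ℝ (Fin m) => t • y + h)
        (t • ContinuousLinearMap.id ℝ (EuclideanSpace ℝ (Fin m))) y :=
      ((hasFDerivAt_id y).const_smul t).add_const h
    have h2 := ((hφ.differentiable (by simp) (t • y + h)).hasFDerivAt).comp y h1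
    have h3 : fderiv ℝ ψ y = _ := h2.fderiv
    rw [h3]
    simp
  have key := hf.integral_eq ψ hψs hψc (subset_univ _) v
  have e1 : ∫ x, fderiv ℝ φ x v • f (t⁻¹ • (x - h)) =
      |t ^ Module.finrank ℝ (EuclideanSpace ℝ (Fin m))| • (t⁻¹ • ∫ y, fderiv ℝ ψ y v • f y) := by
    rw [← integral_smul, ← hcov fun y => t⁻¹ • (fderiv ℝ ψ y v • f y)]
    congr 1
    ext1 x
    rw [hψd, hinv, smul_smul, ← mul_assoc, inv_mul_cancel₀ ht.ne', one_mul]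
  have e2 : ∫ x, φ x • (t⁻¹ • D (t⁻¹ • (x - h))) v =
      |t ^ Module.finrank ℝ (EuclideanSpace ℝ (Fin m))| • (t⁻¹ • ∫ y, ψ y • D y v) := by
    rw [← integral_smul, ← hcov fun y => t⁻¹ • (ψ y • D y v)]
    congr 1
    ext1 x
    rw [hψ]
    simp only [hinv]
    rw [_root_.smul_apply, smul_comm]
  rw [e1, e2, key, smul_neg, smul_neg]

theorem weakEnergy_comp_rescale_le [CompleteSpace F] {p : ℝ} (hp : 0 ≤ p)
    (f : EuclideanSpace ℝ (Fin m) → F) {t : ℝ} (ht : 0 < t) (h : EuclideanSpace ℝ (Fin m)) :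
    weakEnergy p (fun x => f (t⁻¹ • (x - h)))
      ≤ ENNReal.ofReal (t ^ ((m : ℝ) - p)) * weakEnergy p f := by
  by_cases htop : weakEnergy p f = ⊤
  · rw [htop, ENNReal.mul_top]
    · exact le_top
    · rw [Ne, ENNReal.ofReal_eq_zero, not_le]; positivity
  obtain ⟨D, hD⟩ := exists_hasWeakFDeriv_of_weakEnergy_ne_top htop
  rw [weakEnergy_eq p hD]
  refine (weakEnergy_le p (hD.comp_rescale ht h)).trans (le_of_eq ?_)
  have h1 : ∀ x, ‖t⁻¹ • D (t⁻¹ • (x - h))‖ₑ ^ p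
      = ENNReal.ofReal (t ^ (-p)) * ‖D (t⁻¹ • (x - h))‖ₑ ^ p := fun x => by
    rw [enorm_smul, ENNReal.mul_rpow_of_nonneg _ _ hp, Real.enorm_of_nonneg (by positivity),
      ENNReal.ofReal_rpow_of_nonneg (by positivity) hp, Real.inv_rpow ht.le, Real.rpow_neg ht.le]
  rw [lintegral_congr h1, lintegral_const_mul' _ _ ENNReal.ofReal_ne_top,
    lintegral_comp_rescale (fun x => ‖D x‖ₑ ^ p) ht h, ← mul_assoc,
    ← ENNReal.ofReal_mul (by positivity), ← Real.rpow_natCast, ← Real.rpow_add ht]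
  congr 3
  ring

theorem enorm_le_one_add_rpow {E : Type*} [NormedAddCommGroup E] {p : ℝ} (hp : 1 ≤ p) (v : E) :
    ‖v‖ₑ ≤ 1 + ‖v‖ₑ ^ p := by
  rcases le_total ‖v‖ₑ 1 with h | h
  · exact h.trans le_self_add
  · refine le_trans ?_ le_add_self
    calc ‖v‖ₑ = ‖v‖ₑ ^ (1 : ℝ) := (ENNReal.rpow_one _).symm
      _ ≤ ‖v‖ₑ ^ p := ENNReal.rpow_le_rpow_of_exponent_le h hp

theorem weakEnergy_glueBalls_le [FiniteDimensional ℝ F] (hm : 0 < m) {p : ℝ} (hp : 1 ≤ p) {J : Type}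
    [Countable J] {c : J → EuclideanSpace ℝ (Fin m)} {ρ : J → ℝ} (hB : DisjointBalls c ρ)
    {f : J → EuclideanSpace ℝ (Fin m) → F} {f₀ : EuclideanSpace ℝ (Fin m) → F} {b : J → F}
    (hb : ∀ j, ∀ x ∉ Metric.ball (c j) (ρ j), f j x = b j)
    (hb₀ : ∀ j, ∀ x ∈ Metric.ball (c j) (ρ j), f₀ x = b j) :
    weakEnergy p (glueBalls c ρ f f₀) ≤ weakEnergy p f₀ + ∑' j, weakEnergy p (f j) := by
  have : CompleteSpace F := FiniteDimensional.complete ℝ F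
  by_cases htop : weakEnergy p f₀ + ∑' j, weakEnergy p (f j) = ⊤
  · rw [htop]; exact le_top
  obtain ⟨h0, h1⟩ := ENNReal.add_ne_top.1 htop
  obtain ⟨D₀, hD₀⟩ := exists_hasWeakFDeriv_of_weakEnergy_ne_top h0
  choose D hD using fun j => exists_hasWeakFDeriv_of_weakEnergy_ne_top
      (ENNReal.ne_top_of_tsum_ne_top h1 j)
  simp only [weakEnergy_eq p hD₀, weakEnergy_eq p (hD _)] at h1 ⊢
  have hvol : ∑' j, volume (Metric.ball (c j) (ρ j)) ≠ ⊤ := by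
    rw [← measure_iUnion hB.disjoint_ball fun j => measurableSet_ball]
    refine ((measure_mono (iUnion_subset fun j =>
      Metric.ball_subset_closedBall.trans (hB.subset j))).trans_lt measure_ball_lt_top).ne
  have hs : ∑' j, ∫⁻ x, ‖D j x‖ₑ ≠ ⊤ := by
    refine ne_top_of_le_ne_top (ENNReal.add_ne_top.2 ⟨hvol, h1⟩) ?_
    rw [← ENNReal.tsum_add]
    refine ENNReal.tsum_le_tsum fun j => ?_
    calc ∫⁻ x, ‖D j x‖ₑ = ∫⁻ x in Metric.ball (c j) (ρ j), ‖D j x‖ₑ := by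
          rw [← lintegral_indicator measurableSet_ball]
          refine lintegral_congr_ae ?_
          filter_upwards [(hD j).ae_eq_zero_of_notMem_ball hm (hb j)] with x hx
          by_cases hxb : x ∈ Metric.ball (c j) (ρ j)
          · rw [indicator_of_mem hxb]
          · rw [indicator_of_notMem hxb, enorm_eq_zero_of_normed (hx hxb)]
      _ ≤ ∫⁻ x in Metric.ball (c j) (ρ j), (1 + ‖D j x‖ₑ ^ p) :=
          lintegral_mono fun x => enorm_le_one_add_rpow hp _
      _ ≤ volume (Metric.ball (c j) (ρ j)) + ∫⁻ x, ‖D j x‖ₑ ^ p := by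
          rw [lintegral_add_left measurable_const, setLIntegral_one]
          gcongr
          exact Measure.restrict_le_self
  refine (weakEnergy_le p (HasWeakFDeriv.glueBalls hm hB hD hD₀ hb hb₀ hs)).trans ?_
  have hm' : ∀ {D : EuclideanSpace ℝ (Fin m) → EuclideanSpace ℝ (Fin m) →L[ℝ] F} {f},
      HasWeakFDeriv univ f D → AEMeasurable (fun x => ‖D x‖ₑ ^ p) volume := fun h =>
    (locallyIntegrableOn_univ.1 h.locallyIntegrableOn_deriv).aestronglyMeasurable.enorm.pow_const _
  rw [← lintegral_tsum fun j => hm' (hD j), ← lintegral_add_left' (hm' hD₀)]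
  refine lintegral_mono fun x => ?_
  by_cases hx : ∃ j, x ∈ Metric.ball (c j) (ρ j)
  · obtain ⟨j, hj⟩ := hx
    rw [glueBalls, glue_of_mem hB.disjoint_ball _ _ hj]
    exact (ENNReal.le_tsum (f := fun j => ‖D j x‖ₑ ^ p) j).trans le_add_self
  · push Not at hx
    rw [glueBalls, glue_of_notMem _ _ hx]
    exact le_self_add

theorem comp_glueBalls {N N' : Type*} (ι : N → N') {J : Type} (c : J → EuclideanSpace ℝ (Fin m))
    (ρ : J → ℝ) (w : J → EuclideanSpace ℝ (Fin m) → N) (h₀ : EuclideanSpace ℝ (Fin m) → N) :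
    ι ∘ glueBalls c ρ w h₀ = glueBalls c ρ (fun j => ι ∘ w j) (ι ∘ h₀) := by
  ext1 x
  rw [Function.comp_apply, glueBalls, glueBalls, glue, glue]
  split_ifs <;> rfl

/-- The first-order energy on `ℝ^m` is a gluing energy. -/
theorem isGluingEnergy_weakEnergy [FiniteDimensional ℝ F] (hm : 0 < m) {p : ℝ} (hp : 1 ≤ p)
    {N : Type*} [MeasurableSpace N] (ι : N → F) :
    IsGluingEnergy (m := m) ((m : ℝ) - p) (fun w => weakEnergy p (ι ∘ w)) where
  scale w _ t ht h := by
    have : CompleteSpace F := FiniteDimensional.complete ℝ F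
    exact weakEnergy_comp_rescale_le (by linarith) (ι ∘ w) ht h
  const b := weakEnergy_const (by linarith) (ι b)
  glue := by
    refine ⟨1, le_rfl, fun c ρ hB w h₀ b _ _ hwb hhb => ?_⟩
    rw [ENNReal.coe_one, one_mul, comp_glueBalls]
    exact weakEnergy_glueBalls_le hm hp hB (b := fun j => ι (b j))
      (fun j x hx => by rw [Function.comp_apply, hwb j x hx])
      (fun j x hx => by rw [Function.comp_apply, hhb j x hx])

theorem norm_fderiv_comp_logCutoff_le {L : ℝ} (hL : 0 < L) {K : ℝ≥0} {g : ℝ → F}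
    (hg : LipschitzWith K g) {x : EuclideanSpace ℝ (Fin m)} (hx : 0 < ‖x‖) :
    ‖fderiv ℝ (g ∘ logCutoff L) x‖ ≤ 2 * K * L⁻¹ * ‖x‖⁻¹ := by
  refine norm_fderiv_le_of_lip' ℝ (by positivity) ?_
  have hev : ∀ᶠ y in 𝓝 x, ‖x‖ / 2 < ‖y‖ :=
    continuous_norm.continuousAt.eventually (lt_mem_nhds (by linarith))
  have key : ∀ {a b : EuclideanSpace ℝ (Fin m)}, ‖x‖ / 2 < ‖a‖ → ‖a‖ ≤ ‖b‖ →
      |logCutoff L a - logCutoff L b| ≤ L⁻¹ * (2 * ‖x‖⁻¹ * ‖b - a‖) := by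
    intro a b ha hab
    have ha0 : 0 < ‖a‖ := by linarith
    refine (abs_logCutoff_sub_le hL ha0 hab).trans ?_
    refine mul_le_mul_of_nonneg_left ?_ (by positivity)
    have h1 : Real.log (‖b‖ / ‖a‖) ≤ ‖b‖ / ‖a‖ - 1 :=
      Real.log_le_sub_one_of_pos (div_pos (ha0.trans_le hab) ha0)
    have h2 : ‖b‖ / ‖a‖ - 1 = ‖a‖⁻¹ * (‖b‖ - ‖a‖) := by field_simp
    have h3 : ‖a‖⁻¹ ≤ 2 * ‖x‖⁻¹ := by
      rw [inv_le_comm₀ ha0 (by positivity), mul_inv, inv_inv]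
      linarith
    have h4 := norm_sub_norm_le b a
    rw [h2] at h1
    exact h1.trans (mul_le_mul h3 h4 (sub_nonneg.2 hab) (by positivity))
  filter_upwards [hev] with y hy
  have h1 : |logCutoff L y - logCutoff L x| ≤ L⁻¹ * (2 * ‖x‖⁻¹ * ‖y - x‖) := by
    rcases le_total ‖y‖ ‖x‖ with h | h
    · have := key hy h
      rwa [norm_sub_rev] at this
    · rw [abs_sub_comm]
      exact key (by linarith) h
  have h2 := hg.dist_le_mul (logCutoff L y) (logCutoff L x)
  rw [dist_eq_norm, Real.dist_eq] at h2
  refine h2.trans ((mul_le_mul_of_nonneg_left h1 (NNReal.coe_nonneg K)).trans (le_of_eq ?_))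
  ring

/-- The energy of a transition along a Lipschitz path by means of the logarithmic cutoff. -/
theorem weakEnergy_comp_logCutoff_le [FiniteDimensional ℝ F] (hm : 0 < m) {p : ℝ} (hp : 0 < p)
    {L : ℝ} (hL : 0 < L) {K : ℝ≥0} {g : ℝ → F} (hg : LipschitzWith K g) :
    weakEnergy p (g ∘ logCutoff (m := m) L) ≤ ENNReal.ofReal (2 ^ p) *
      ((K : ℝ≥0∞) ^ p * (ENNReal.ofReal (L ^ (-p)) * (1 + annulusIntegral m p L))) := by
  have hlip : LipschitzWith (K * (L⁻¹ * Real.exp L).toNNReal) (g ∘ logCutoff (m := m) L) :=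
    hg.comp (lipschitzWith_logCutoff hL)
  refine (weakEnergy_le p (HasWeakFDeriv.of_lipschitzWith hlip)).trans ?_
  set A : Set (EuclideanSpace ℝ (Fin m)) := {x | Real.exp (-L) < ‖x‖ ∧ ‖x‖ < 2} with hA
  have hzero : ∀ {x : EuclideanSpace ℝ (Fin m)} {b : ℝ}, (∀ᶠ y in 𝓝 x, logCutoff L y = b) →
      fderiv ℝ (g ∘ logCutoff L) x = 0 := fun {x b} h => by
    have : (g ∘ logCutoff L) =ᶠ[𝓝 x] fun _ => g b := h.mono fun y hy => by
      rw [Function.comp_apply, hy]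
    rw [this.fderiv_eq, fderiv_fun_const, Pi.zero_apply]
  have hae : ∀ᵐ x : EuclideanSpace ℝ (Fin m), ‖fderiv ℝ (g ∘ logCutoff L) x‖ₑ ^ p
      ≤ A.indicator (fun x => ENNReal.ofReal ((2 * K * L⁻¹) ^ p) * ‖x‖ₑ ^ (-p)) x := by
    filter_upwards [ae_notMem_sphere hm 0 (Real.exp (-L))] with x hxs
    rw [mem_sphere_zero_iff_norm] at hxs
    by_cases hx : x ∈ A
    · have hx0 : 0 < ‖x‖ := (Real.exp_pos _).trans hx.1
      rw [indicator_of_mem hx, enorm_rpow_eq_ofReal (norm_pos_iff.1 hx0),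
        ← ENNReal.ofReal_mul (by positivity), ← ofReal_norm,
        ENNReal.ofReal_rpow_of_nonneg (norm_nonneg _) hp.le, Real.rpow_neg hx0.le,
        ← Real.inv_rpow hx0.le, ← Real.mul_rpow (by positivity) (by positivity)]
      exact ENNReal.ofReal_le_ofReal (Real.rpow_le_rpow (norm_nonneg _)
        (norm_fderiv_comp_logCutoff_le hL hg hx0) hp.le)
    · rw [indicator_of_notMem hx]
      have h0 : fderiv ℝ (g ∘ logCutoff L) x = 0 := by
        rcases lt_or_gt_of_ne hxs with h | h
        · refine hzero (b := 0) ?_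
          filter_upwards [continuous_norm.continuousAt.eventually (gt_mem_nhds h)] with y hy
          exact logCutoff_of_le hL hy.le
        · have h2 : 1 < ‖x‖ := by
            by_contra hlt
            exact hx ⟨h, by linarith⟩
          refine hzero (b := 1) ?_
          filter_upwards [continuous_norm.continuousAt.eventually (lt_mem_nhds h2)] with y hy
          exact logCutoff_of_ge hL hy.le
      exact (enorm_rpow_eq_zero_of_normed h0 hp).le
  refine (lintegral_mono_ae hae).trans ?_
  rw [lintegral_indicator (measurableSet_annulus _ _),
      lintegral_const_mul' _ _ ENNReal.ofReal_ne_top,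
    Real.mul_rpow (by positivity) (by positivity), Real.mul_rpow (by positivity) (by positivity),
    ENNReal.ofReal_mul (by positivity), ENNReal.ofReal_mul (by positivity), mul_assoc, mul_assoc,
    ← ENNReal.ofReal_rpow_of_nonneg (NNReal.coe_nonneg K) hp.le, ENNReal.ofReal_coe_nnreal,
    Real.inv_rpow hL.le, ← Real.rpow_neg hL.le]
  refine mul_le_mul_right (mul_le_mul_right (mul_le_mul_right ?_ _) _) _
  exact le_add_self

end WeakEnergy

/-! ### Smooth approximation in the unit ball -/

section Approximation

open Filter Topology

variable {m : ℕ} {F : Type*} [NormedAddCommGroup F] [NormedSpace ℝ F]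

theorem shrinkingBump_rOut (k : ℕ) : (shrinkingBump (m := m) k).rOut = 1 / ((k : ℝ) + 1) := rfl

theorem half_le_one_sub_rOut (k : ℕ) : 1 / 2 ≤ 1 - (shrinkingBump (m := m) (k + 1)).rOut := by
  rw [shrinkingBump_rOut]
  have : 1 / (((k + 1 : ℕ) : ℝ) + 1) ≤ 1 / 2 :=
    one_div_le_one_div_of_le (by norm_num) (by push_cast; linarith [k.cast_nonneg (α := ℝ)])
  linarith

/-- Regularization at a small scale, combined with a dilation that keeps the unit ball away from
its boundary, approximates the identity of `L¹`. -/
theorem tendsto_lintegral_enorm_mollify_smul_sub [CompleteSpace F]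
    {g : EuclideanSpace ℝ (Fin m) → F} (hg : Integrable g volume) :
    Tendsto (fun k => ∫⁻ x in Metric.ball 0 1,
      ‖mollify (shrinkingBump (k + 1)) g ((1 - (shrinkingBump (m := m) (k + 1)).rOut) • x) - g x‖ₑ)
      atTop (𝓝 0) := by
  set r : ℕ → ℝ := fun k => (shrinkingBump (m := m) (k + 1)).rOut with hr
  have hr0 : Tendsto r atTop (𝓝 0) := (tendsto_add_atTop_iff_nat 1).2 tendsto_rOut_shrinkingBump
  have hrpos : ∀ k, 0 < r k := fun k => (shrinkingBump (m := m) (k + 1)).rOut_pos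
  have hθ : ∀ k, 1 / 2 ≤ 1 - r k := half_le_one_sub_rOut
  set V := volume (Metric.ball (0 : EuclideanSpace ℝ (Fin m)) 1) with hV
  have hVt : V ≠ ⊤ := measure_ball_lt_top.ne
  have hT : ∀ k {w : EuclideanSpace ℝ (Fin m) → F}, AEStronglyMeasurable w volume →
      ∫⁻ x in Metric.ball 0 1, ‖mollify (shrinkingBump (k + 1)) w ((1 - r k) • x)‖ₑ
        ≤ 2 ^ m * ∫⁻ x, ‖w x‖ₑ := by
    intro k w hw
    refine (setLIntegral_le_lintegral _ _).trans ?_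
    have h1 := lintegral_comp_homothety (fun x => ‖mollify (shrinkingBump (m := m) (k + 1)) w x‖ₑ)
      (t := 1 - r k) (by linarith [hθ k]) 0
    simp only [sub_zero, zero_add] at h1
    rw [h1]
    refine mul_le_mul' ?_ (lintegral_enorm_mollify_le _ hw)
    refine (ENNReal.ofReal_le_ofReal (pow_le_pow_left₀ (inv_nonneg.2 (by linarith [hθ k]))
      (inv_anti₀ (by norm_num) (hθ k)) m)).trans (le_of_eq ?_)
    rw [ENNReal.ofReal_pow (by norm_num)]
    norm_num
  rw [ENNReal.tendsto_nhds_zero]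
  intro ε hε
  obtain ⟨η, hη0, hη⟩ : ∃ η : ℝ≥0, 0 < η ∧ (η : ℝ≥0∞) * (2 ^ m + 1 + V) ≤ ε := by
    obtain ⟨η, h0, h1⟩ := ENNReal.exists_nnreal_pos_mul_lt (a := 2 ^ m + 1 + V) (b := ε)
      (by simp [hVt]) hε.ne'
    exact ⟨η, h0, h1.le⟩
  obtain ⟨h, hhc, hgh, hhcont, hhi⟩ := hg.exists_hasCompactSupport_lintegral_sub_le
    (ε := (η : ℝ≥0∞)) (by simpa using hη0.ne')
  have hhu := hhc.uniformContinuous_of_continuous hhcont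
  obtain ⟨δ, hδ, hhδ⟩ := Metric.uniformContinuous_iff.1 hhu (η / 2) (by positivity)
  filter_upwards [hr0.eventually (gt_mem_nhds hδ)] with k hk
  have hunif : ∀ x ∈ Metric.ball (0 : EuclideanSpace ℝ (Fin m)) 1,
      ‖mollify (shrinkingBump (k + 1)) h ((1 - r k) • x) - h x‖ₑ ≤ η := by
    intro x hx
    have h1 : dist (mollify (shrinkingBump (k + 1)) h ((1 - r k) • x)) (h ((1 - r k) • x))
        ≤ (η : ℝ) / 2 := by
      rw [mollify_eq_convolution]
      exact ContDiffBump.dist_normed_convolution_le hhi.aestronglyMeasurable fun y hy =>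
        (hhδ ((Metric.mem_ball.1 hy).trans hk)).le
    have h2 : dist (h ((1 - r k) • x)) (h x) ≤ (η : ℝ) / 2 := by
      refine (hhδ (lt_of_le_of_lt ?_ hk)).le
      rw [dist_eq_norm, show (1 - r k) • x - x = -(r k • x) by module, norm_neg, norm_smul,
        Real.norm_of_nonneg (hrpos k).le]
      exact mul_le_of_le_one_right (hrpos k).le (mem_ball_zero_iff.1 hx).le
    rw [← edist_eq_enorm_sub, edist_dist]
    refine (ENNReal.ofReal_le_ofReal ((dist_triangle _ _ _).trans (add_le_add h1 h2))).trans ?_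
    rw [add_halves, ENNReal.ofReal_coe_nnreal]
  have hsub : AEStronglyMeasurable (fun x => g x - h x) volume :=
    hg.aestronglyMeasurable.sub hhi.aestronglyMeasurable
  refine le_trans ?_ hη
  calc ∫⁻ x in Metric.ball 0 1, ‖mollify (shrinkingBump (k + 1)) g ((1 - r k) • x) - g x‖ₑ
      ≤ ∫⁻ x in Metric.ball 0 1,
          (‖mollify (shrinkingBump (k + 1)) (fun y => g y - h y) ((1 - r k) • x)‖ₑ +
          ‖g x - h x‖ₑ + η) := by
        refine setLIntegral_mono_ae' measurableSet_ball (ae_of_all _ fun x hx => ?_)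
        rw [mollify_sub _ hg.locallyIntegrable hhi.locallyIntegrable]
        refine le_trans ?_ (add_le_add_right (hunif x hx) _)
        generalize mollify (shrinkingBump (k + 1)) g ((1 - r k) • x) = a
        generalize mollify (shrinkingBump (k + 1)) h ((1 - r k) • x) = b
        rw [show a - g x = (a - b) - (g x - h x) + (b - h x) by abel]
        exact (enorm_add_le _ _).trans (add_le_add_left (enorm_sub_le) _)
    _ = (∫⁻ x in Metric.ball 0 1,
          ‖mollify (shrinkingBump (k + 1)) (fun y => g y - h y) ((1 - r k) • x)‖ₑ) +
          (∫⁻ x in Metric.ball 0 1, ‖g x - h x‖ₑ) + η * V := by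
        rw [lintegral_add_right _ measurable_const, setLIntegral_const,
          lintegral_add_right' _ hsub.enorm.restrict]
    _ ≤ 2 ^ m * η + η + η * V := by
        gcongr
        · exact (hT k hsub).trans (mul_le_mul_right hgh _)
        · exact (setLIntegral_le_lintegral _ _).trans hgh
    _ = η * (2 ^ m + 1 + V) := by ring

/-- A weakly differentiable function on the unit ball whose derivative is integrable is itself
integrable: near the boundary it is compared with its values on the ball of half the size. -/
theorem HasWeakFDeriv.integrableOn_ball [CompleteSpace F] {f : EuclideanSpace ℝ (Fin m) → F}
    {D : EuclideanSpace ℝ (Fin m) → EuclideanSpace ℝ (Fin m) →L[ℝ] F}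
    (h : HasWeakFDeriv (Metric.ball 0 1) f D) (hD : IntegrableOn D (Metric.ball 0 1) volume) :
    IntegrableOn f (Metric.ball 0 1) volume := by
  have hm : AEStronglyMeasurable f (volume.restrict (Metric.ball 0 1)) :=
    h.locallyIntegrableOn.aestronglyMeasurable
  have hsubc : ∀ {r : ℝ}, r < 1 → IntegrableOn f (Metric.ball 0 r) volume := fun hr =>
    (h.locallyIntegrableOn.integrableOn_compact_subset (Metric.closedBall_subset_ball hr)
      (isCompact_closedBall _ _)).mono_set Metric.ball_subset_closedBall
  refine ⟨hm, ?_⟩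
  set M : ℝ≥0∞ := 2 ^ m * (∫⁻ x in Metric.ball 0 1, ‖D x‖ₑ)
    + 2 ^ m * ∫⁻ x in Metric.ball 0 (1 / 2), ‖f x‖ₑ with hM
  have hMt : M ≠ ⊤ := ENNReal.add_ne_top.2 ⟨ENNReal.mul_ne_top (by simp) hD.2.ne,
    ENNReal.mul_ne_top (by simp) (hsubc (by norm_num : (1 / 2 : ℝ) < 1)).2.ne⟩
  have hρ : ∀ ρ : ℝ, ρ < 1 → ∫⁻ x in Metric.ball 0 ρ, ‖f x‖ₑ ≤ M := by
    intro ρ hρ1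
    set r := (1 + ρ) / 2 with hr
    have hr1 : r < 1 := by rw [hr]; linarith
    have hρr : 0 < r - ρ := by rw [hr]; linarith
    have hsub : Metric.ball (0 : EuclideanSpace ℝ (Fin m)) r ⊆ Metric.ball 0 1 :=
      Metric.ball_subset_ball hr1.le
    have h1 := (h.mono hsub).lintegral_enorm_sub_comp_homothety_le Metric.isOpen_ball (hsubc hr1)
      (hD.mono_set hsub) (A := Metric.ball 0 ρ) (c := 0) (R := 1) (θ := 1 / 2) (δ := (r - ρ) / 2)
      le_rfl (by norm_num) measurableSet_ball
      (fun x hx => by rw [sub_zero]; exact ((mem_ball_zero_iff.1 hx).trans hρ1).le) (by linarith)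
      (fun x hx t ht y hy => by
        rw [uIcc_of_le (by norm_num)] at ht
        rw [zero_add, sub_zero, Metric.mem_closedBall, dist_eq_norm] at hy
        rw [mem_ball_zero_iff] at hx ⊢
        have h1 : ‖t • x‖ ≤ ‖x‖ := by
          rw [norm_smul, Real.norm_of_nonneg (by linarith [ht.1])]
          exact mul_le_of_le_one_left (norm_nonneg _) ht.2
        have h2 := norm_add_le (y - t • x) (t • x)
        rw [sub_add_cancel] at h2
        linarith)
    simp only [zero_add, sub_zero, ENNReal.ofReal_one, one_mul] at h1
    have h2 : ∫⁻ x in Metric.ball 0 ρ, ‖f ((1 / 2 : ℝ) • x)‖ₑ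
        ≤ 2 ^ m * ∫⁻ x in Metric.ball 0 (1 / 2), ‖f x‖ₑ := by
      have h3 := lintegral_comp_homothety
        ((Metric.ball (0 : EuclideanSpace ℝ (Fin m)) (1 / 2)).indicator fun x => ‖f x‖ₑ)
        (t := 1 / 2) (by norm_num) 0
      rw [lintegral_indicator measurableSet_ball] at h3
      have h4 : ENNReal.ofReal ((1 / 2 : ℝ)⁻¹ ^ m) = 2 ^ m := by
        rw [ENNReal.ofReal_pow (by norm_num)]; norm_num
      rw [← h4, ← h3, ← lintegral_indicator measurableSet_ball]
      refine lintegral_mono fun x => ?_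
      rw [zero_add, sub_zero]
      by_cases hx : x ∈ Metric.ball (0 : EuclideanSpace ℝ (Fin m)) ρ
      · rw [indicator_of_mem hx, indicator_of_mem]
        rw [mem_ball_zero_iff] at hx ⊢
        rw [norm_smul]
        norm_num
        linarith
      · rw [indicator_of_notMem hx]; exact zero_le
    have hfm : AEMeasurable (fun x => ‖f x - f ((1 / 2 : ℝ) • x)‖ₑ)
        (volume.restrict (Metric.ball 0 ρ)) := by
      have h5 : AEStronglyMeasurable ((Metric.ball 0 (1 / 2)).indicator f) volume :=
        (aestronglyMeasurable_indicator_iff measurableSet_ball).2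
          (hsubc (by norm_num : (1 / 2 : ℝ) < 1)).aestronglyMeasurable
      have h6 : AEStronglyMeasurable (fun x =>
          (Metric.ball 0 (1 / 2)).indicator f ((1 / 2 : ℝ) • x))
          volume := by
        refine h5.comp_quasiMeasurePreserving ⟨measurable_const_smul _, ?_⟩
        rw [Measure.map_addHaar_smul _ (by norm_num)]
        exact Measure.smul_absolutelyContinuous
      refine ((hsubc hρ1).aestronglyMeasurable.sub (h6.restrict.congr ?_)).enorm
      refine (ae_restrict_iff' measurableSet_ball).2 (ae_of_all _ fun x hx => ?_)
      beta_reduce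
      rw [indicator_of_mem]
      rw [mem_ball_zero_iff] at hx ⊢
      rw [norm_smul]
      norm_num
      linarith
    calc ∫⁻ x in Metric.ball 0 ρ, ‖f x‖ₑ
        ≤ ∫⁻ x in Metric.ball 0 ρ, (‖f x - f ((1 / 2 : ℝ) • x)‖ₑ + ‖f ((1 / 2 : ℝ) • x)‖ₑ) := by
          refine lintegral_mono fun x => ?_
          have := enorm_add_le (f x - f ((1 / 2 : ℝ) • x)) (f ((1 / 2 : ℝ) • x))
          rwa [sub_add_cancel] at this
      _ = (∫⁻ x in Metric.ball 0 ρ, ‖f x - f ((1 / 2 : ℝ) • x)‖ₑ) +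
            ∫⁻ x in Metric.ball 0 ρ, ‖f ((1 / 2 : ℝ) • x)‖ₑ := lintegral_add_left' hfm _
      _ ≤ M := by
          refine add_le_add (h1.trans (mul_le_mul_right ?_ _)) h2
          exact lintegral_mono_set hsub
  have hU : Metric.ball (0 : EuclideanSpace ℝ (Fin m)) 1
      = ⋃ n : ℕ, Metric.ball 0 (1 - 1 / ((n : ℝ) + 1)) := by
    refine Subset.antisymm (fun x hx => ?_) (iUnion_subset fun n => Metric.ball_subset_ball ?_)
    · rw [mem_ball_zero_iff] at hx
      obtain ⟨n, hn⟩ := exists_nat_one_div_lt (sub_pos.2 hx)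
      exact mem_iUnion.2 ⟨n, mem_ball_zero_iff.2 (by linarith)⟩
    · have : 0 < 1 / ((n : ℝ) + 1) := by positivity
      linarith
  rw [HasFiniteIntegral, hU, setLIntegral_iUnion_of_directed]
  · refine lt_of_le_of_lt (iSup_le fun n => hρ _ ?_) hMt.lt_top
    have : 0 < 1 / ((n : ℝ) + 1) := by positivity
    linarith
  · refine directed_of_isDirected_le fun n k hnk => Metric.ball_subset_ball ?_
    have : 1 / ((k : ℝ) + 1) ≤ 1 / ((n : ℝ) + 1) :=
      one_div_le_one_div_of_le (by positivity) (by gcongr)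
    linarith

/-- Smooth functions are dense among the weakly differentiable functions on the unit ball. -/
theorem HasWeakFDeriv.exists_contDiff_tendsto [CompleteSpace F] {f : EuclideanSpace ℝ (Fin m) → F}
    {D : EuclideanSpace ℝ (Fin m) → EuclideanSpace ℝ (Fin m) →L[ℝ] F}
    (h : HasWeakFDeriv (Metric.ball 0 1) f D) (hf : IntegrableOn f (Metric.ball 0 1) volume)
    (hD : IntegrableOn D (Metric.ball 0 1) volume) :
    ∃ fk : ℕ → EuclideanSpace ℝ (Fin m) → F, (∀ k, ContDiff ℝ 1 (fk k)) ∧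
      Tendsto (fun k => ∫⁻ x in Metric.ball 0 1, ‖fk k x - f x‖ₑ) atTop (𝓝 0) ∧
      Tendsto (fun k => ∫⁻ x in Metric.ball 0 1, ‖fderiv ℝ (fk k) x - D x‖ₑ) atTop (𝓝 0) := by
  set B := Metric.ball (0 : EuclideanSpace ℝ (Fin m)) 1 with hB
  have hBm : MeasurableSet B := measurableSet_ball
  set r : ℕ → ℝ := fun k => (shrinkingBump (m := m) (k + 1)).rOut with hr
  have hr0 : Tendsto r atTop (𝓝 0) := (tendsto_add_atTop_iff_nat 1).2 tendsto_rOut_shrinkingBump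
  have hrpos : ∀ k, 0 < r k := fun k => (shrinkingBump (m := m) (k + 1)).rOut_pos
  have hθ : ∀ k, 1 / 2 ≤ 1 - r k := half_le_one_sub_rOut
  have hfi : Integrable (B.indicator f) volume := integrable_indicator_of_integrableOn hBm hf
  have hDi : Integrable (B.indicator D) volume := integrable_indicator_of_integrableOn hBm hD
  have hind : HasWeakFDeriv B (B.indicator f) (B.indicator D) := h.congr_ae hBm
    ((ae_restrict_iff' hBm).2 (ae_of_all _ fun x hx => (indicator_of_mem hx f).symm))
    ((ae_restrict_iff' hBm).2 (ae_of_all _ fun x hx => (indicator_of_mem hx D).symm))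
  have hfd : ∀ k, ∀ x ∈ B,
      fderiv ℝ (fun x => mollify (shrinkingBump (k + 1)) (B.indicator f) ((1 - r k) • x)) x
        = (1 - r k) • mollify (shrinkingBump (k + 1)) (B.indicator D) ((1 - r k) • x) := by
    intro k x hx
    have h1 : Metric.closedBall ((1 - r k) • x) (shrinkingBump (m := m) (k + 1)).rOut ⊆ B := by
      refine Metric.closedBall_subset_ball' ?_
      rw [dist_zero_right, norm_smul, Real.norm_of_nonneg (by linarith [hθ k])]
      change r k + _ < 1
      have := mul_lt_mul_of_pos_left (mem_ball_zero_iff.1 hx) (by linarith [hθ k] : 0 < 1 - r k)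
      linarith
    have h2 := hind.fderiv_mollify hfi.locallyIntegrable hDi.locallyIntegrable _ h1
    have h3 := (((contDiff_mollify (shrinkingBump (k + 1)) hfi.locallyIntegrable).differentiable
      (by simp) ((1 - r k) • x)).hasFDerivAt).comp x ((hasFDerivAt_id x).const_smul (1 - r k))
    rw [h2] at h3
    have h4 := h3.fderiv
    refine Eq.trans h4 ?_
    ext v
    simp
  refine ⟨fun k x => mollify (shrinkingBump (k + 1)) (B.indicator f) ((1 - r k) • x), fun k => ?_,
    ?_, ?_⟩
  · exact ((contDiff_mollify _ hfi.locallyIntegrable).of_le (by simp)).comp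
      (contDiff_id.const_smul (1 - r k))
  · refine (tendsto_lintegral_enorm_mollify_smul_sub hfi).congr fun k => ?_
    exact setLIntegral_congr_fun hBm fun x hx => by
      simp only [indicator_of_mem (show x ∈ B from hx), hr]
  · have hlim := (tendsto_lintegral_enorm_mollify_smul_sub hDi).add
      (ENNReal.Tendsto.mul_const (ENNReal.tendsto_ofReal hr0) (Or.inr hD.2.ne))
    rw [ENNReal.ofReal_zero, zero_mul, add_zero] at hlim
    refine tendsto_of_tendsto_of_tendsto_of_le_of_le tendsto_const_nhds hlim
      (fun _ => zero_le) fun k => ?_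
    simp only
    rw [← lintegral_const_mul' _ _ ENNReal.ofReal_ne_top,
      ← lintegral_add_right' _ (hD.aestronglyMeasurable.enorm.const_mul _)]
    refine setLIntegral_mono_ae' hBm (ae_of_all _ fun x hx => ?_)
    rw [hfd k x hx, indicator_of_mem hx]
    change ‖(1 - r k) • mollify (shrinkingBump (k + 1)) (B.indicator D) ((1 - r k) • x) - D x‖ₑ
      ≤ ‖mollify (shrinkingBump (k + 1)) (B.indicator D) ((1 - r k) • x) - D x‖ₑ + _
    generalize mollify (shrinkingBump (k + 1)) (B.indicator D) ((1 - r k) • x) = a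
    rw [show (1 - r k) • a - D x = (1 - r k) • (a - D x) - r k • D x by module]
    refine (enorm_sub_le).trans (add_le_add ?_ ?_)
    · rw [enorm_smul]
      refine mul_le_of_le_one_left zero_le ?_
      rw [Real.enorm_of_nonneg (by linarith [hθ k]), ENNReal.ofReal_le_one]
      linarith [hrpos k]
    · rw [enorm_smul, Real.enorm_of_nonneg (hrpos k).le]

end Approximation

/-! ### Extension of weakly differentiable functions from the unit ball -/

section WeakExtension

open Filter Topology

variable {m : ℕ} {F : Type*} [NormedAddCommGroup F] [NormedSpace ℝ F]

theorem lipschitzWith_comp_foldToward_of_contDiff {g : EuclideanSpace ℝ (Fin m) → F}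
    (hg : ContDiff ℝ 1 g) {a : EuclideanSpace ℝ (Fin m)} (ha : ‖a‖ < 1 / 4) :
    ∃ K : ℝ≥0, LipschitzWith K (g ∘ foldToward a) := by
  obtain ⟨M, hM⟩ :=
    (isCompact_closedBall (0 : EuclideanSpace ℝ (Fin m)) 1).exists_bound_of_continuousOn
    (hg.continuous_fderiv (by simp)).continuousOn
  have h1 : LipschitzOnWith M.toNNReal g (Metric.closedBall 0 1) :=
    Convex.lipschitzOnWith_of_nnnorm_fderiv_le (𝕜 := ℝ)
      (fun x _ => (hg.differentiable (by simp)) x)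
      (fun x hx => by
        rw [← NNReal.coe_le_coe, coe_nnnorm]
        exact (hM x hx).trans (Real.le_coe_toNNReal M)) (convex_closedBall _ _)
  refine ⟨M.toNNReal * 6, lipschitzOnWith_univ.1 (h1.comp
    (lipschitzWith_foldToward ha).lipschitzOnWith fun x _ => ?_)⟩
  exact mem_closedBall_zero_iff.2 (norm_foldToward_le ha x)

theorem enorm_fderiv_foldToward_le {a : EuclideanSpace ℝ (Fin m)} (ha : ‖a‖ < 1 / 4)
    (x : EuclideanSpace ℝ (Fin m)) : ‖fderiv ℝ (foldToward a) x‖ₑ ≤ 6 := by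
  have h := norm_fderiv_le_of_lipschitz ℝ (x₀ := x) (lipschitzWith_foldToward ha)
  rw [← ofReal_norm, ← ENNReal.ofReal_ofNat 6]
  exact ENNReal.ofReal_le_ofReal (by exact_mod_cast h)

theorem enorm_comp_le_of_normed {E : Type*} [NormedAddCommGroup E] [NormedSpace ℝ E]
    (A : E →L[ℝ] F) (T : E →L[ℝ] E) : ‖A.comp T‖ₑ ≤ ‖A‖ₑ * ‖T‖ₑ := by
  rw [← ofReal_norm, ← ofReal_norm, ← ofReal_norm, ← ENNReal.ofReal_mul (norm_nonneg _)]
  exact ENNReal.ofReal_le_ofReal (A.opNorm_comp_le T)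

theorem enorm_comp_sub_comp_le_of_normed {E : Type*} [NormedAddCommGroup E] [NormedSpace ℝ E]
    (A A' : E →L[ℝ] F) (T : E →L[ℝ] E) : ‖A.comp T - A'.comp T‖ₑ ≤ ‖A - A'‖ₑ * ‖T‖ₑ := by
  rw [← ContinuousLinearMap.sub_comp]
  exact enorm_comp_le_of_normed _ _

/-- A strongly measurable function whose norm has a finite integral on every ball around the origin
is locally integrable. -/
theorem locallyIntegrable_of_lintegral_ball_ne_top {E : Type*} [NormedAddCommGroup E]
    {f : EuclideanSpace ℝ (Fin m) → E} (hf : StronglyMeasurable f)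
    (h : ∀ R : ℕ, ∫⁻ x in Metric.ball 0 (R : ℝ), ‖f x‖ₑ ≠ ⊤) : LocallyIntegrable f volume := by
  intro x
  obtain ⟨R, hR⟩ := exists_nat_gt ‖x‖
  exact ⟨Metric.ball 0 R, Metric.isOpen_ball.mem_nhds (mem_ball_zero_iff.2 hR),
    hf.aestronglyMeasurable, (h R).lt_top⟩

/-- If smooth functions approximate `f` so fast that the errors, composed with `foldToward a`, are
summable in `L¹` on balls, then the chain rule holds for `f ∘ foldToward a`. -/
theorem hasWeakFDeriv_comp_foldToward [FiniteDimensional ℝ F]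
    {f : EuclideanSpace ℝ (Fin m) → F} (hf : StronglyMeasurable f)
    {D : EuclideanSpace ℝ (Fin m) → EuclideanSpace ℝ (Fin m) →L[ℝ] F} (hD : StronglyMeasurable D)
    {fk : ℕ → EuclideanSpace ℝ (Fin m) → F} (hfk : ∀ k, ContDiff ℝ 1 (fk k))
    {a : EuclideanSpace ℝ (Fin m)} (ha : ‖a‖ < 1 / 4)
    (h0 : ∀ R : ℕ, ∫⁻ x in Metric.ball 0 (R : ℝ),
      (‖f (foldToward a x)‖ₑ + ‖D (foldToward a x)‖ₑ) ≠ ⊤)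
    (h1 : ∀ R : ℕ, Tendsto (fun k => ∫⁻ x in Metric.ball 0 (R : ℝ),
      (‖fk k (foldToward a x) - f (foldToward a x)‖ₑ +
        ‖fderiv ℝ (fk k) (foldToward a x) - D (foldToward a x)‖ₑ)) atTop (𝓝 0)) :
    HasWeakFDeriv univ (f ∘ foldToward a)
      (fun x => (D (foldToward a x)).comp (fderiv ℝ (foldToward a) x)) := by
  have hΦ := lipschitzWith_foldToward ha
  have hΦm : Measurable (foldToward a) := hΦ.continuous.measurable
  have hfm : StronglyMeasurable (f ∘ foldToward a) := hf.comp_measurable hΦm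
  have hDm : StronglyMeasurable
      (fun x => (D (foldToward a x)).comp (fderiv ℝ (foldToward a) x)) :=
    isBoundedBilinearMap_comp.continuous.comp_stronglyMeasurable
      ((hD.comp_measurable hΦm).prodMk (stronglyMeasurable_fderiv_of_finiteDimensional
          (foldToward a)))
  choose K hK using fun k => lipschitzWith_comp_foldToward_of_contDiff (hfk k) ha
  have hchain : ∀ k, HasWeakFDeriv univ (fk k ∘ foldToward a)
      (fun x => (fderiv ℝ (fk k) (foldToward a x)).comp (fderiv ℝ (foldToward a) x)) := fun k => by
    refine (HasWeakFDeriv.of_lipschitzWith (hK k)).congr_ae MeasurableSet.univ (ae_eq_refl _) ?_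
    rw [Measure.restrict_univ]
    exact hΦ.ae_differentiableAt.mono fun x hx =>
      fderiv_comp x ((hfk k).differentiable (by simp) _) hx
  have htends : ∀ {u : ℕ → EuclideanSpace ℝ (Fin m) → ℝ≥0∞}, (∀ k x, u k x ≤
      6 * (‖fk k (foldToward a x) - f (foldToward a x)‖ₑ +
        ‖fderiv ℝ (fk k) (foldToward a x) - D (foldToward a x)‖ₑ)) →
      ∀ R : ℝ, Tendsto (fun k => ∫⁻ x in Metric.ball 0 R, u k x) atTop (𝓝 0) := by
    intro u hu R
    obtain ⟨n, hn⟩ := exists_nat_ge R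
    have h2 := ENNReal.Tendsto.const_mul (h1 n) (Or.inr (by simp : (6 : ℝ≥0∞) ≠ ⊤))
    rw [mul_zero] at h2
    refine tendsto_of_tendsto_of_tendsto_of_le_of_le tendsto_const_nhds h2
      (fun _ => zero_le) fun k => ?_
    simp only
    rw [← lintegral_const_mul' _ _ (by simp)]
    exact (lintegral_mono_set (Metric.ball_subset_ball hn)).trans (lintegral_mono fun x => hu k x)
  have hle : ∀ {s t : ℝ≥0∞}, s ≤ 6 * (s + t) := fun {s t} =>
    (le_self_add (b := t)).trans (le_mul_of_one_le_left zero_le (by norm_num))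
  refine HasWeakFDeriv.of_tendsto hchain ?_ ?_ ?_ ?_
  · exact locallyIntegrable_of_lintegral_ball_ne_top hfm fun R =>
      ne_top_of_le_ne_top (h0 R) (lintegral_mono fun x => le_self_add)
  · refine locallyIntegrable_of_lintegral_ball_ne_top hDm fun R =>
      ne_top_of_le_ne_top (ENNReal.mul_ne_top (h0 R) (by simp : (6 : ℝ≥0∞) ≠ ⊤)) ?_
    rw [← lintegral_mul_const' _ _ (by simp)]
    refine lintegral_mono fun x => (enorm_comp_le_of_normed _ _).trans ?_
    exact mul_le_mul' le_add_self (enorm_fderiv_foldToward_le ha x)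
  · exact htends fun k x => hle
  · refine htends fun k x => (enorm_comp_sub_comp_le_of_normed _ _ _).trans ?_
    rw [mul_comm]
    exact mul_le_mul' (enorm_fderiv_foldToward_le ha x) le_add_self

theorem lintegral_enorm_comp_fderiv_foldToward_le {p : ℝ} (hp : 0 < p)
    (D : EuclideanSpace ℝ (Fin m) → EuclideanSpace ℝ (Fin m) →L[ℝ] F)
    {a : EuclideanSpace ℝ (Fin m)} (ha : ‖a‖ < 1 / 4) :
    ∫⁻ x, ‖(D (foldToward a x)).comp (fderiv ℝ (foldToward a) x)‖ₑ ^ p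
      ≤ 6 ^ p * ∫⁻ x in Metric.ball 0 2, ‖D (foldToward a x)‖ₑ ^ p := by
  rw [← lintegral_indicator measurableSet_ball,
    ← lintegral_const_mul' _ _ (ENNReal.rpow_ne_top_of_nonneg hp.le (by simp))]
  refine lintegral_mono fun x => ?_
  by_cases hx : x ∈ Metric.ball (0 : EuclideanSpace ℝ (Fin m)) 2
  · rw [indicator_of_mem hx, mul_comm, ← ENNReal.mul_rpow_of_nonneg _ _ hp.le]
    refine ENNReal.rpow_le_rpow ((enorm_comp_le_of_normed _ _).trans ?_) hp.le
    exact mul_le_mul_right (enorm_fderiv_foldToward_le ha x) _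
  · have h2 : 3 / 2 < ‖x‖ := by
      rw [mem_ball_zero_iff, not_lt] at hx
      linarith
    have h3 : fderiv ℝ (foldToward a) x = 0 := by
      have : foldToward a =ᶠ[𝓝 x] fun _ => a := by
        filter_upwards [continuous_norm.continuousAt.eventually (lt_mem_nhds h2)] with y hy
        exact foldToward_of_ge a hy.le
      rw [this.fderiv_eq, fderiv_fun_const, Pi.zero_apply]
    refine (enorm_rpow_eq_zero_of_normed ?_ hp).le.trans zero_le
    rw [h3, ContinuousLinearMap.comp_zero]

/-- The summability makes the errors summable after composition with almost every `foldToward a`. -/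
theorem exists_fast_approximation [FiniteDimensional ℝ F] {f : EuclideanSpace ℝ (Fin m) → F}
    {D : EuclideanSpace ℝ (Fin m) → EuclideanSpace ℝ (Fin m) →L[ℝ] F}
    (h : HasWeakFDeriv (Metric.ball 0 1) f D) (hf : IntegrableOn f (Metric.ball 0 1) volume)
    (hD : IntegrableOn D (Metric.ball 0 1) volume) :
    ∃ fk : ℕ → EuclideanSpace ℝ (Fin m) → F, (∀ k, ContDiff ℝ 1 (fk k)) ∧
      ∑' k, ∫⁻ x in Metric.ball 0 1, (‖fk k x - f x‖ₑ + ‖fderiv ℝ (fk k) x - D x‖ₑ) ≠ ⊤ := by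
  have : CompleteSpace F := FiniteDimensional.complete ℝ F
  obtain ⟨g, hg, hg1, hg2⟩ := h.exists_contDiff_tendsto hf hD
  have hlim := hg1.add hg2
  rw [add_zero] at hlim
  obtain ⟨ε, hε, hεs⟩ := ENNReal.exists_pos_sum_of_countable (ε := 1) one_ne_zero ℕ
  have hex : ∀ k, ∃ n, (∫⁻ x in Metric.ball 0 1, ‖g n x - f x‖ₑ) +
      ∫⁻ x in Metric.ball 0 1, ‖fderiv ℝ (g n) x - D x‖ₑ ≤ ε k := fun k =>
    ((ENNReal.tendsto_nhds_zero.1 hlim) (ε k) (by exact_mod_cast hε k)).exists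
  choose n hn using hex
  refine ⟨fun k => g (n k), fun k => hg _, ne_top_of_le_ne_top (hεs.trans_le le_top).ne
    (ENNReal.tsum_le_tsum fun k => ?_)⟩
  refine le_trans (le_of_eq ?_) (hn k)
  exact lintegral_add_left'
    ((hg _).continuous.aestronglyMeasurable.sub hf.aestronglyMeasurable).enorm _

/-- The extension of a weakly differentiable function on the unit ball by composition with
`foldToward a`, for a suitable `a`. -/
theorem exists_foldToward_weakEnergy_le [FiniteDimensional ℝ F] {p : ℝ} (hp : 1 ≤ p) :
    ∃ C : ℝ≥0, ∀ (f : EuclideanSpace ℝ (Fin m) → F)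
      (D : EuclideanSpace ℝ (Fin m) → EuclideanSpace ℝ (Fin m) →L[ℝ] F), StronglyMeasurable f →
      HasWeakFDeriv (Metric.ball 0 1) f D → ∫⁻ x in Metric.ball 0 1, ‖D x‖ₑ ^ p ≠ ⊤ →
      ∃ a : EuclideanSpace ℝ (Fin m), ‖a‖ < 1 / 4 ∧
        weakEnergy p (f ∘ foldToward a) ≤ C * ∫⁻ x in Metric.ball 0 1, ‖D x‖ₑ ^ p := by
  have : CompleteSpace F := FiniteDimensional.complete ℝ F
  have hp0 : 0 < p := by linarith
  choose C hC using exists_lintegral_foldToward_le m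
  set V := volume (Metric.ball (0 : EuclideanSpace ℝ (Fin m)) (1 / 4)) with hV
  have hV0 : V ≠ 0 := (Metric.measure_ball_pos _ _ (by norm_num)).ne'
  refine ⟨6 ^ p * (V⁻¹.toNNReal * C 2), fun f D₀ hf h₀ hfin₀ => ?_⟩
  set B := Metric.ball (0 : EuclideanSpace ℝ (Fin m)) 1 with hB
  have hBm : MeasurableSet B := measurableSet_ball
  have hD₀ := h₀.locallyIntegrableOn_deriv.aestronglyMeasurable
  obtain ⟨D, hDm, hDD⟩ := hD₀
  have h : HasWeakFDeriv B f D := h₀.congr_ae hBm (ae_eq_refl _) hDD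
  have hE : ∫⁻ x in B, ‖D₀ x‖ₑ ^ p = ∫⁻ x in B, ‖D x‖ₑ ^ p :=
    lintegral_congr_ae (hDD.mono fun x hx => by simp only [hx])
  rw [hE] at hfin₀ ⊢
  have hDi : IntegrableOn D B volume := by
    refine ⟨hDm.aestronglyMeasurable, ?_⟩
    refine lt_of_le_of_lt (lintegral_mono fun x => enorm_le_one_add_rpow hp (D x)) ?_
    rw [lintegral_add_left measurable_const, setLIntegral_one]
    exact ENNReal.add_lt_top.2 ⟨measure_ball_lt_top, hfin₀.lt_top⟩
  have hfi := h.integrableOn_ball hDi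
  obtain ⟨fk, hfk, hsum⟩ := exists_fast_approximation h hfi hDi
  have hgkm : ∀ k, Measurable fun y => ‖fk k y - f y‖ₑ + ‖fderiv ℝ (fk k) y - D y‖ₑ := fun k =>
    (((hfk k).continuous.stronglyMeasurable.sub hf).enorm).add
      (((stronglyMeasurable_fderiv_of_finiteDimensional (fk k)).sub hDm).enorm)
  obtain ⟨gk, hgk⟩ : ∃ gk : ℕ → EuclideanSpace ℝ (Fin m) → ℝ≥0∞, gk = fun k y =>
    ‖fk k y - f y‖ₑ + ‖fderiv ℝ (fk k) y - D y‖ₑ := ⟨_, rfl⟩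
  have hgm : ∀ k, Measurable (gk k) := fun k => by rw [hgk]; exact hgkm k
  obtain ⟨g₀, hg₀⟩ : ∃ g₀ : EuclideanSpace ℝ (Fin m) → ℝ≥0∞, g₀ = fun y => ‖f y‖ₑ + ‖D y‖ₑ :=
    ⟨_, rfl⟩
  have hg₀m : Measurable g₀ := by rw [hg₀]; exact hf.enorm.add hDm.enorm
  have hav : ∀ (g : EuclideanSpace ℝ (Fin m) → ℝ≥0∞), Measurable g → ∫⁻ y in B, g y ≠ ⊤ →
      ∀ᵐ a ∂volume.restrict (Metric.ball (0 : EuclideanSpace ℝ (Fin m)) (1 / 4)), ∀ R : ℕ,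
        ∫⁻ x in Metric.ball 0 (R : ℝ), g (foldToward a x) ≠ ⊤ := by
    intro g hg hgt
    refine ae_all_iff.2 fun R => ?_
    have h1 : Measurable fun a : EuclideanSpace ℝ (Fin m) =>
        ∫⁻ x in Metric.ball 0 (R : ℝ), g (foldToward a x) :=
      (hg.comp continuous_foldToward.measurable).lintegral_prod_right'
    refine (ae_lt_top h1 (ne_top_of_le_ne_top (ENNReal.mul_ne_top ENNReal.coe_ne_top hgt)
      (hC R g hg))).mono fun a ha => ha.ne
  have hsum' : ∫⁻ y in B, ∑' k, gk k y ≠ ⊤ := by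
    rw [lintegral_tsum fun k => (hgm k).aemeasurable, hgk]
    exact hsum
  have hg₀i : ∫⁻ y in B, g₀ y ≠ ⊤ := by
    rw [hg₀, lintegral_add_left hf.enorm]
    exact ENNReal.add_ne_top.2 ⟨hfi.2.ne, hDi.2.ne⟩
  have hgood := (hav _ (Measurable.tsum hgm) hsum').and (hav _ hg₀m hg₀i)
  have hJm : Measurable fun a : EuclideanSpace ℝ (Fin m) =>
      ∫⁻ x in Metric.ball 0 2, ‖D (foldToward a x)‖ₑ ^ p :=
    ((hDm.enorm.pow_const p).comp continuous_foldToward.measurable).lintegral_prod_right'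
  have hμ : volume.restrict (Metric.ball (0 : EuclideanSpace ℝ (Fin m)) (1 / 4)) ≠ 0 := fun h0 =>
    hV0 (Measure.restrict_eq_zero.1 h0)
  have : IsFiniteMeasure (volume.restrict (Metric.ball (0 : EuclideanSpace ℝ (Fin m)) (1 / 4))) :=
    ⟨by rw [Measure.restrict_apply_univ]; exact measure_ball_lt_top⟩
  have hgood' := hgood.and (ae_restrict_mem measurableSet_ball)
  obtain ⟨a, haN, hle⟩ := exists_notMem_null_le_laverage hμ hJm.aemeasurable hgood'
  rw [mem_compl_iff, not_not] at haN
  obtain ⟨⟨hsa, h0a⟩, ha⟩ := haN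
  rw [mem_ball_zero_iff] at ha
  refine ⟨a, ha, ?_⟩
  have hw := hasWeakFDeriv_comp_foldToward hf hDm hfk ha
    (fun R => by have := h0a R; rwa [hg₀] at this) fun R => by
      have h2 := hsa R
      rw [lintegral_tsum (f := fun k x => gk k (foldToward a x)) fun k => ((hgm k).comp
        (lipschitzWith_foldToward ha).continuous.measurable).aemeasurable, hgk] at h2
      exact ENNReal.tendsto_atTop_zero_of_tsum_ne_top h2
  refine (weakEnergy_le p hw).trans ((lintegral_enorm_comp_fderiv_foldToward_le hp0 D ha).trans ?_)
  rw [ENNReal.coe_mul, ENNReal.coe_rpow_of_nonneg _ hp0.le, mul_assoc]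
  refine mul_le_mul_right (hle.trans ?_) _
  rw [setLAverage_eq, ENNReal.div_eq_inv_mul, ENNReal.coe_mul, ENNReal.coe_toNNReal (by simp [hV0]),
    mul_assoc]
  exact mul_le_mul_right (hC 2 _ (hDm.enorm.pow_const p)) _

end WeakExtension

/-! ### Weak derivatives and weak partial derivatives -/

section Partials

open Filter Topology

variable {m ν : ℕ} {A : Set (EuclideanSpace ℝ (Fin m))}

theorem LocallyIntegrable.continuousLinearMap_comp {X E E' : Type*} [MeasurableSpace X]
    [TopologicalSpace X] {μ : Measure X} [NormedAddCommGroup E] [NormedSpace ℝ E]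
    [NormedAddCommGroup E'] [NormedSpace ℝ E'] (T : E →L[ℝ] E') {f : X → E}
    (hf : LocallyIntegrable f μ) : LocallyIntegrable (fun x => T (f x)) μ := fun x =>
  let ⟨s, hs, hi⟩ := hf x
  ⟨s, hs, T.integrable_comp hi⟩

theorem LocallyIntegrable.sum_continuousLinearMap_comp {X E E' J : Type*} [MeasurableSpace X]
    [TopologicalSpace X] {μ : Measure X} [NormedAddCommGroup E] [NormedSpace ℝ E]
    [NormedAddCommGroup E'] [NormedSpace ℝ E'] (S : Finset J) (T : J → E →L[ℝ] E') {f : J → X → E}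
    (hf : ∀ i, LocallyIntegrable (f i) μ) :
    LocallyIntegrable (fun x => ∑ i ∈ S, T i (f i x)) μ :=
  locallyIntegrable_finsetSum S fun i _ =>
    LocallyIntegrable.continuousLinearMap_comp (T i) (hf i)

theorem integral_subtype_smul_of_tsupport_subset {E : Type*} [NormedAddCommGroup E]
    [NormedSpace ℝ E] (hA : MeasurableSet A) {φ : EuclideanSpace ℝ (Fin m) → ℝ}
    (hφ : tsupport φ ⊆ A) (f : EuclideanSpace ℝ (Fin m) → E) :
    ∫ x : A, φ x • f x = ∫ x, φ x • f x := by
  refine (integral_subtype_comap hA fun x => φ x • f x).trans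
    (setIntegral_eq_integral_of_forall_compl_eq_zero fun x hx => ?_)
  rw [image_eq_zero_of_notMem_tsupport fun h => hx (hφ h), zero_smul]

theorem HasWeakFDeriv.hasWeakPartials (hA : MeasurableSet A)
    {f : EuclideanSpace ℝ (Fin m) → EuclideanSpace ℝ (Fin ν)}
    {D : EuclideanSpace ℝ (Fin m) → EuclideanSpace ℝ (Fin m) →L[ℝ] EuclideanSpace ℝ (Fin ν)}
    (h : HasWeakFDeriv A f D) :
    HasWeakPartials A (fun x => f x) (fun i x => D x (EuclideanSpace.single i 1)) where
  locallyIntegrable := (locallyIntegrable_comap hA).2 h.locallyIntegrableOn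
  locallyIntegrable_deriv i := LocallyIntegrable.continuousLinearMap_comp
    (ContinuousLinearMap.apply ℝ (EuclideanSpace ℝ (Fin ν)) (EuclideanSpace.single i (1 : ℝ)))
    ((locallyIntegrable_comap hA).2 h.locallyIntegrableOn_deriv)
  integral_eq φ hφ hc hs i := by
    rw [integral_subtype_smul_of_tsupport_subset hA
      ((tsupport_fderiv_apply_subset ℝ (EuclideanSpace.single i (1 : ℝ))).trans hs),
      integral_subtype_smul_of_tsupport_subset hA hs fun x => D x (EuclideanSpace.single i 1)]
    exact h.integral_eq φ hφ hc hs _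

/-- The linear map with given images of the basis vectors. -/
noncomputable def fderivOfPartials (G : Fin m → EuclideanSpace ℝ (Fin ν)) :
    EuclideanSpace ℝ (Fin m) →L[ℝ] EuclideanSpace ℝ (Fin ν) :=
  ∑ i, ContinuousLinearMap.smulRightL ℝ _ _ (EuclideanSpace.proj i) (G i)

theorem fderivOfPartials_apply (G : Fin m → EuclideanSpace ℝ (Fin ν))
    (v : EuclideanSpace ℝ (Fin m)) : fderivOfPartials G v = ∑ i, v i • G i := by
  simp [fderivOfPartials]

theorem norm_fderivOfPartials_le (G : Fin m → EuclideanSpace ℝ (Fin ν)) :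
    ‖fderivOfPartials G‖ ≤ ∑ i, ‖G i‖ := by
  refine ContinuousLinearMap.opNorm_le_bound _ (Finset.sum_nonneg fun i _ => norm_nonneg _)
    fun v => ?_
  rw [fderivOfPartials_apply, Finset.sum_mul]
  refine (norm_sum_le _ _).trans (Finset.sum_le_sum fun i _ => ?_)
  rw [norm_smul, mul_comm]
  exact mul_le_mul_of_nonneg_left (PiLp.norm_apply_le v i) (norm_nonneg _)

theorem enorm_fderivOfPartials_rpow_le {p : ℝ} (hp : 0 ≤ p) (G : Fin m → EuclideanSpace ℝ (Fin ν)) :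
    ‖fderivOfPartials G‖ₑ ^ p ≤ (m : ℝ≥0∞) ^ p * (∑ i, ‖G i‖ₑ ^ 2) ^ (p / 2) := by
  have h1 : ‖fderivOfPartials G‖ₑ ≤ ∑ i, ‖G i‖ₑ := by
    simp_rw [← ofReal_norm]
    rw [← ENNReal.ofReal_sum_of_nonneg fun i _ => norm_nonneg _]
    exact ENNReal.ofReal_le_ofReal (norm_fderivOfPartials_le G)
  have h2 : ∀ i, ‖G i‖ₑ ≤ (∑ j, ‖G j‖ₑ ^ 2) ^ (2⁻¹ : ℝ) := fun i => by
    rw [ENNReal.le_rpow_inv_iff (by norm_num)]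
    rw [ENNReal.rpow_ofNat]
    exact Finset.single_le_sum (f := fun j => ‖G j‖ₑ ^ (2 : ℕ)) (fun j _ => zero_le)
      (Finset.mem_univ i)
  have h3 : ∑ i, ‖G i‖ₑ ≤ m * (∑ j, ‖G j‖ₑ ^ 2) ^ (2⁻¹ : ℝ) := by
    refine (Finset.sum_le_sum fun i _ => h2 i).trans (le_of_eq ?_)
    rw [Finset.sum_const, Finset.card_univ, Fintype.card_fin, nsmul_eq_mul]
  refine (ENNReal.rpow_le_rpow (h1.trans h3) hp).trans (le_of_eq ?_)
  rw [ENNReal.mul_rpow_of_nonneg _ _ hp, ← ENNReal.rpow_mul]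
  congr 2
  ring

theorem sum_enorm_apply_single_rpow_le {p : ℝ} (hp : 0 ≤ p)
    (T : EuclideanSpace ℝ (Fin m) →L[ℝ] EuclideanSpace ℝ (Fin ν)) :
    (∑ i, ‖T (EuclideanSpace.single i 1)‖ₑ ^ 2) ^ (p / 2) ≤ (m : ℝ≥0∞) ^ (p / 2) * ‖T‖ₑ ^ p := by
  have h1 : ∀ i : Fin m, ‖T (EuclideanSpace.single i 1)‖ₑ ^ 2 ≤ ‖T‖ₑ ^ 2 := fun i => by
    gcongr
    rw [← ofReal_norm, ← ofReal_norm]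
    refine ENNReal.ofReal_le_ofReal ((T.le_opNorm _).trans (le_of_eq ?_))
    rw [PiLp.norm_single, norm_one, mul_one]
  have h2 : ∑ i, ‖T (EuclideanSpace.single i 1)‖ₑ ^ 2 ≤ m * ‖T‖ₑ ^ 2 := by
    refine (Finset.sum_le_sum fun i _ => h1 i).trans (le_of_eq ?_)
    rw [Finset.sum_const, Finset.card_univ, Fintype.card_fin, nsmul_eq_mul]
  refine (ENNReal.rpow_le_rpow h2 (by positivity)).trans (le_of_eq ?_)
  rw [ENNReal.mul_rpow_of_nonneg _ _ (by positivity), ← ENNReal.rpow_natCast, ← ENNReal.rpow_mul]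
  congr 2
  push_cast
  ring

/-- Weak partial derivatives, extended arbitrarily outside of the open set, give a weak
derivative. -/
theorem HasWeakPartials.hasWeakFDeriv (hA : MeasurableSet A)
    {f : EuclideanSpace ℝ (Fin m) → EuclideanSpace ℝ (Fin ν)}
    {G : Fin m → EuclideanSpace ℝ (Fin m) → EuclideanSpace ℝ (Fin ν)}
    (h : HasWeakPartials A (fun x => f x) (fun i x => G i x)) :
    HasWeakFDeriv A f (fun x => fderivOfPartials fun i => G i x) where
  locallyIntegrableOn := (locallyIntegrable_comap hA).1 h.locallyIntegrable
  locallyIntegrableOn_deriv := by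
    refine (locallyIntegrable_comap hA).1 ?_
    exact LocallyIntegrable.sum_continuousLinearMap_comp Finset.univ
      (fun i => ContinuousLinearMap.smulRightL ℝ (EuclideanSpace ℝ (Fin m))
        (EuclideanSpace ℝ (Fin ν)) (EuclideanSpace.proj i)) h.locallyIntegrable_deriv
  integral_eq φ hφ hc hs v := by
    have hfl := (locallyIntegrable_comap hA).1 h.locallyIntegrable
    have hGl := fun i => (locallyIntegrable_comap hA).1 (h.locallyIntegrable_deriv i)
    have hv : v = ∑ i, v i • EuclideanSpace.single i (1 : ℝ) := by
      ext j
      simp [Finset.sum_apply, Pi.single_apply]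
    have e1 : ∀ x, fderiv ℝ φ x v • f x
        = ∑ i, v i • (fderiv ℝ φ x (EuclideanSpace.single i 1) • f x) := fun x => by
      conv_lhs => rw [hv]
      rw [map_sum, Finset.sum_smul]
      exact Finset.sum_congr rfl fun i _ => by rw [map_smul, smul_assoc]
    have e2 : ∀ x, φ x • fderivOfPartials (fun i => G i x) v = ∑ i, v i • (φ x • G i x) :=
      fun x => by
        rw [fderivOfPartials_apply, Finset.smul_sum]
        exact Finset.sum_congr rfl fun i _ => smul_comm _ _ _
    simp only [e1, e2]
    have i1 : ∀ i ∈ Finset.univ, Integrable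
        (fun x => v i • (fderiv ℝ φ x (EuclideanSpace.single i 1) • f x)) volume := fun i _ =>
      (integrable_smul_of_tsupport_subset hfl
        (continuous_fderiv_apply_of_contDiff hφ (EuclideanSpace.single i 1))
        (hc.fderiv_apply (𝕜 := ℝ) _) ((tsupport_fderiv_apply_subset ℝ _).trans hs)).smul (v i)
    have i2 : ∀ i ∈ Finset.univ, Integrable (fun x => v i • (φ x • G i x)) volume := fun i _ =>
      (integrable_smul_of_tsupport_subset (hGl i) hφ.continuous hc hs).smul (v i)
    rw [integral_finsetSum _ i1, integral_finsetSum _ i2, ← Finset.sum_neg_distrib]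
    refine Finset.sum_congr rfl fun i _ => ?_
    have key := h.integral_eq φ hφ hc hs i
    rw [integral_subtype_smul_of_tsupport_subset hA
      ((tsupport_fderiv_apply_subset ℝ (EuclideanSpace.single i (1 : ℝ))).trans hs),
      integral_subtype_smul_of_tsupport_subset hA hs (G i)] at key
    rw [integral_smul, integral_smul, key, smul_neg]

theorem dirichletEnergy_le_weakEnergy (hm : 0 < m) (hA : MeasurableSet A) {p : ℝ} (hp : 0 ≤ p)
    (f : EuclideanSpace ℝ (Fin m) → EuclideanSpace ℝ (Fin ν)) :
    dirichletEnergy p A (fun x => f x) ≤ (m : ℝ≥0∞) ^ (p / 2) * weakEnergy p f := by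
  have hm0 : (m : ℝ≥0∞) ^ (p / 2) ≠ 0 := (ENNReal.rpow_pos (by exact_mod_cast hm) (by simp)).ne'
  have hmt : (m : ℝ≥0∞) ^ (p / 2) ≠ ⊤ := ENNReal.rpow_ne_top_of_nonneg (by positivity) (by simp)
  by_cases htop : weakEnergy p f = ⊤
  · rw [htop, ENNReal.mul_top hm0]
    exact le_top
  obtain ⟨D, hD⟩ := exists_hasWeakFDeriv_of_weakEnergy_ne_top htop
  rw [weakEnergy_eq p hD, ← lintegral_const_mul' _ _ hmt]
  refine (iInf₂_le _ ((hD.mono (subset_univ A)).hasWeakPartials hA)).trans ?_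
  refine (le_of_eq (lintegral_subtype_comap hA fun x =>
    (∑ i, ‖D x (EuclideanSpace.single i 1)‖ₑ ^ 2) ^ (p / 2))).trans ?_
  exact (setLIntegral_le_lintegral _ _).trans
    (lintegral_mono fun x => sum_enorm_apply_single_rpow_le hp _)

theorem exists_hasWeakFDeriv_le_dirichletEnergy (hA : MeasurableSet A) {p : ℝ} (hp : 0 ≤ p)
    {f : EuclideanSpace ℝ (Fin m) → EuclideanSpace ℝ (Fin ν)}
    (h0 : dirichletEnergy p A (fun x => f x) ≠ 0) (ht : dirichletEnergy p A (fun x => f x) ≠ ⊤) :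
    ∃ D, HasWeakFDeriv A f D ∧
      ∫⁻ x in A, ‖D x‖ₑ ^ p ≤ (m : ℝ≥0∞) ^ p * (2 * dirichletEnergy p A (fun x => f x)) := by
  classical
  have hlt : dirichletEnergy p A (fun x => f x) < 2 * dirichletEnergy p A (fun x => f x) := by
    rw [two_mul]
    exact ENNReal.lt_add_right ht h0
  conv_lhs at hlt => rw [dirichletEnergy]
  simp only [iInf_lt_iff] at hlt
  obtain ⟨G, hG, hle⟩ := hlt
  obtain ⟨H, rfl⟩ : ∃ H : Fin m → EuclideanSpace ℝ (Fin m) → EuclideanSpace ℝ (Fin ν),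
      G = fun i (x : A) => H i x :=
    ⟨fun i x => if hx : x ∈ A then G i ⟨x, hx⟩ else 0, by ext1 i; ext1 x; simp only [dif_pos x.2]⟩
  refine ⟨_, hG.hasWeakFDeriv hA, ?_⟩
  refine (lintegral_mono fun x => enorm_fderivOfPartials_rpow_le hp _).trans ?_
  rw [lintegral_const_mul' _ _ (ENNReal.rpow_ne_top_of_nonneg hp (by simp))]
  refine mul_le_mul_right (le_trans (le_of_eq ?_) hle.le) _
  exact (lintegral_subtype_comap hA fun x => (∑ i, ‖H i x‖ₑ ^ 2) ^ (p / 2)).symm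

theorem dirichletEnergy_congr_ae (p : ℝ) {f g : A → EuclideanSpace ℝ (Fin ν)}
    (h : f =ᵐ[volume] g) : dirichletEnergy p A f = dirichletEnergy p A g := by
  have key : ∀ {f g : A → EuclideanSpace ℝ (Fin ν)}, f =ᵐ[volume] g →
      dirichletEnergy p A f ≤ dirichletEnergy p A g := fun {f g} h =>
    le_iInf₂ fun D hD => iInf₂_le D ⟨hD.locallyIntegrable.congr h.symm, hD.locallyIntegrable_deriv,
      fun φ hφ hc hs i => by
        rw [← hD.integral_eq φ hφ hc hs i]
        exact integral_congr_ae (h.mono fun x hx => by simp only [hx])⟩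
  exact le_antisymm (key h) (key h.symm)

theorem IsGluingEnergy.const_mul {N : Type*} [MeasurableSpace N] {α : ℝ}
    {𝓔 : (EuclideanSpace ℝ (Fin m) → N) → ℝ≥0∞} (h : IsGluingEnergy α 𝓔) (c : ℝ≥0∞) :
    IsGluingEnergy α (fun w => c * 𝓔 w) where
  scale w hw t ht z := by
    rw [mul_left_comm]
    exact mul_le_mul_right (h.scale w hw t ht z) _
  const b := by rw [h.const, mul_zero]
  glue := by
    obtain ⟨C, hC, hglue⟩ := h.glue
    refine ⟨C, hC, fun a ρ hB w h₀ b hw hh hwb hhb => ?_⟩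
    rw [ENNReal.tsum_mul_left, ← mul_add, mul_left_comm]
    exact mul_le_mul_right (hglue a ρ hB w h₀ b hw hh hwb hhb) _

/-- The extension of maps from the unit ball, for the first-order energy. -/
theorem exists_foldToward_weakEnergy_le_dirichletEnergy {N : Type*} [TopologicalSpace N]
    [MeasurableSpace N] [BorelSpace N] {ι : N → EuclideanSpace ℝ (Fin ν)} (hι : Continuous ι)
    {p : ℝ} (hp : 1 ≤ p) :
    ∃ C : ℝ≥0, ∀ w : EuclideanSpace ℝ (Fin m) → N, Measurable w →
      dirichletEnergy p (Metric.ball 0 1)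
        (fun x : Metric.ball (0 : EuclideanSpace ℝ (Fin m)) 1 => ι (w x)) ≠ 0 →
      dirichletEnergy p (Metric.ball 0 1)
        (fun x : Metric.ball (0 : EuclideanSpace ℝ (Fin m)) 1 => ι (w x)) ≠ ⊤ →
      ∃ a : EuclideanSpace ℝ (Fin m), ‖a‖ < 1 / 4 ∧ weakEnergy p (ι ∘ (w ∘ foldToward a))
        ≤ C * dirichletEnergy p (Metric.ball 0 1)
          (fun x : Metric.ball (0 : EuclideanSpace ℝ (Fin m)) 1 => ι (w x)) := by
  have hp0 : 0 ≤ p := by linarith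
  obtain ⟨C, hC⟩ := exists_foldToward_weakEnergy_le (m := m) (F := EuclideanSpace ℝ (Fin ν)) hp
  refine ⟨C * ((m : ℝ≥0) ^ p * 2), fun w hw h0 ht => ?_⟩
  obtain ⟨D, hD, hle⟩ := exists_hasWeakFDeriv_le_dirichletEnergy (f := fun x => ι (w x))
    measurableSet_ball hp0 h0 ht
  have hmt : (m : ℝ≥0∞) ^ p ≠ ⊤ := ENNReal.rpow_ne_top_of_nonneg hp0 (by simp)
  obtain ⟨a, ha, hwa⟩ := hC (ι ∘ w) D (hι.measurable.comp hw).stronglyMeasurable hD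
    (ne_top_of_le_ne_top (ENNReal.mul_ne_top hmt (ENNReal.mul_ne_top (by simp) ht)) hle)
  refine ⟨a, ha, hwa.trans ((mul_le_mul_right hle _).trans (le_of_eq ?_))⟩
  push_cast
  rw [ENNReal.coe_rpow_of_nonneg _ hp0, ENNReal.coe_natCast, mul_assoc, mul_assoc]

end Partials

/-! ### Nonlinear uniform boundedness for Sobolev energies -/

section SobolevEnergies

open Filter Topology

variable {m : ℕ} {N : Type*} [EMetricSpace N] [MeasurableSpace N] [BorelSpace N]

/-- The nonlinear uniform boundedness principle for the fractional energy, with values in a space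
in which nearby points are joined by short paths. -/
theorem uniform_boundedness_gagliardoEnergy [SecondCountableTopology N] (hm : 0 < m) {s p : ℝ}
    (hs : 0 < s) (hs1 : s < 1) (hp : 1 ≤ p)
    (hpath : ∀ c b : N, ∃ (K : ℝ≥0) (γ : ℝ → N), LipschitzWith K γ ∧ (∀ t ≤ 0, γ t = c) ∧
      ∀ t, 1 ≤ t → γ t = b)
    (hloc : ∀ (b : N) (K : ℝ≥0), 0 < K → ∀ᶠ c in 𝓝 b, ∃ γ : ℝ → N, LipschitzWith K γ ∧
      (∀ t ≤ 0, γ t = c) ∧ ∀ t, 1 ≤ t → γ t = b)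
    (hN : (s * p < m ∨ (s * p = m ∧ 1 < p)) ∨ CompactSpace N)
    {G : MapEnergy m N} (hsuper : G.Superadditive) (hscale : G.ScalesWith ((m : ℝ) - s * p))
    (hfin : ∀ u : Metric.ball (0 : EuclideanSpace ℝ (Fin m)) 1 → N, NullMeasurable u volume →
      gagliardoEnergy s p (Metric.ball 0 1) u < ⊤ → G.toFun (Metric.ball 0 1) u < ⊤)
    (hzero : ∀ u : Metric.ball (0 : EuclideanSpace ℝ (Fin m)) 1 → N, NullMeasurable u volume →
      gagliardoEnergy s p (Metric.ball 0 1) u = 0 → G.toFun (Metric.ball 0 1) u = 0) :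
    ∃ C : ℝ≥0, ∀ u : Metric.ball (0 : EuclideanSpace ℝ (Fin m)) 1 → N, NullMeasurable u volume →
      (0 < (m : ℝ) - s * p ∨ gagliardoEnergy s p (Metric.ball 0 1) u ≤ (C : ℝ≥0∞)⁻¹) →
        G.toFun (Metric.ball 0 1) u ≤ C * gagliardoEnergy s p (Metric.ball 0 1) u := by
  have hp0 : 0 < p := by linarith
  have hσ : 0 < s * p := mul_pos hs hp0
  have hE : ∀ w : EuclideanSpace ℝ (Fin m) → N, gagliardoEnergy s p (Metric.ball 0 1)
      (fun x : Metric.ball (0 : EuclideanSpace ℝ (Fin m)) 1 => w x) =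
          gagliardoOn ((m : ℝ) + s * p) p (Metric.ball 0 1) w :=
    gagliardoEnergy_eq_gagliardoOn measurableSet_ball
  refine uniform_boundedness_of_gluing hm (by linarith) (isGluingEnergy_gagliardoOn hp0) hsuper
    hscale (gagliardoEnergy s p (Metric.ball 0 1)) (fun w _ => ?_) ?_ ?_ hfin hzero
  · rw [hE]
    exact gagliardoOn_mono (subset_univ _) _
  · refine exists_extension_of_foldToward (fun w w' h => ?_) (fun w w' h => ?_) ?_
    · rw [hE, hE]
      exact gagliardoOn_congr_ae h
    · exact gagliardoOn_congr_ae (by rwa [Measure.restrict_univ])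
    · obtain ⟨C, hC⟩ := exists_foldToward_gagliardoOn_le (N := N) hm hσ hp0
      exact ⟨C, fun w hw _ _ => by rw [hE]; exact hC w hw⟩
  · refine exists_transition_of_logCutoff hm hp hσ hpath hloc hN ?_
    obtain ⟨C, hC⟩ := exists_gagliardoOn_logCutoff_le (m := m) hm hσ
      (by nlinarith : s * p < p)
    refine ⟨C, fun K γ L hL hγ => (gagliardoOn_comp_lipschitz_le hγ hp0.le _ _).trans ?_⟩
    rw [mul_left_comm]
    exact mul_le_mul_right (hC L hL) _

/-- The nonlinear uniform boundedness principle for the first-order energy of `ι ∘ u`, with values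
in a space in which nearby points are joined by short paths. -/
theorem uniform_boundedness_dirichletEnergy [SecondCountableTopology N] (hm : 0 < m) {p : ℝ}
    (hp : 1 ≤ p) {ν : ℕ} {ι : N → EuclideanSpace ℝ (Fin ν)} (hι : LipschitzWith 1 ι)
    (hpath : ∀ c b : N, ∃ (K : ℝ≥0) (γ : ℝ → N), LipschitzWith K γ ∧ (∀ t ≤ 0, γ t = c) ∧
      ∀ t, 1 ≤ t → γ t = b)
    (hloc : ∀ (b : N) (K : ℝ≥0), 0 < K → ∀ᶠ c in 𝓝 b, ∃ γ : ℝ → N, LipschitzWith K γ ∧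
      (∀ t ≤ 0, γ t = c) ∧ ∀ t, 1 ≤ t → γ t = b)
    (hN : (p < m ∨ (p = m ∧ 1 < p)) ∨ CompactSpace N)
    {G : MapEnergy m N} (hsuper : G.Superadditive) (hscale : G.ScalesWith ((m : ℝ) - p))
    (hfin : ∀ u : Metric.ball (0 : EuclideanSpace ℝ (Fin m)) 1 → N, NullMeasurable u volume →
      dirichletEnergy p (Metric.ball 0 1) (ι ∘ u) < ⊤ → G.toFun (Metric.ball 0 1) u < ⊤)
    (hzero : ∀ u : Metric.ball (0 : EuclideanSpace ℝ (Fin m)) 1 → N, NullMeasurable u volume →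
      dirichletEnergy p (Metric.ball 0 1) (ι ∘ u) = 0 → G.toFun (Metric.ball 0 1) u = 0) :
    ∃ C : ℝ≥0, ∀ u : Metric.ball (0 : EuclideanSpace ℝ (Fin m)) 1 → N, NullMeasurable u volume →
      (0 < (m : ℝ) - p ∨ dirichletEnergy p (Metric.ball 0 1) (ι ∘ u) ≤ (C : ℝ≥0∞)⁻¹) →
        G.toFun (Metric.ball 0 1) u ≤ C * dirichletEnergy p (Metric.ball 0 1) (ι ∘ u) := by
  have hp0 : 0 < p := by linarith
  obtain ⟨c, hc⟩ : ∃ c : ℝ≥0, (c : ℝ≥0∞) = (m : ℝ≥0∞) ^ (p / 2) :=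
    ⟨(m : ℝ≥0) ^ (p / 2), by rw [ENNReal.coe_rpow_of_nonneg _ (by positivity), ENNReal.coe_natCast]⟩
  refine uniform_boundedness_of_gluing hm (by linarith)
    ((isGluingEnergy_weakEnergy hm hp ι).const_mul c) hsuper hscale
    (fun u => dirichletEnergy p (Metric.ball 0 1) (ι ∘ u)) (fun w _ => ?_) ?_ ?_ hfin hzero
  · rw [hc]
    exact dirichletEnergy_le_weakEnergy hm measurableSet_ball hp0.le (ι ∘ w)
  · refine exists_extension_of_foldToward (fun w w' h => ?_) (fun w w' h => ?_) ?_
    · refine dirichletEnergy_congr_ae p ?_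
      exact ((ae_restrict_iff_subtype measurableSet_ball).1 h).mono fun x hx => by
        simp only [Function.comp_apply, hx]
    · rw [weakEnergy_congr_ae p (h.fun_comp ι)]
    · obtain ⟨C, hC⟩ := exists_foldToward_weakEnergy_le_dirichletEnergy (m := m) hι.continuous hp
      refine ⟨c * C, fun w hw h0 ht => ?_⟩
      obtain ⟨a, ha, hle⟩ := hC w hw h0 ht
      refine ⟨a, ha, ?_⟩
      rw [ENNReal.coe_mul, mul_assoc]
      exact mul_le_mul_right hle _
  · refine exists_transition_of_logCutoff hm hp hp0 hpath hloc hN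
      ⟨c * (2 ^ p : ℝ).toNNReal, fun K γ L hL hγ => ?_⟩
    rw [ENNReal.coe_mul, mul_assoc]
    have hιγ : LipschitzWith K (ι ∘ γ) := by simpa using hι.comp hγ
    exact mul_le_mul_right (weakEnergy_comp_logCutoff_le hm hp0 hL hιγ) _

end SobolevEnergies

theorem mainTheorem1 {m d ν : ℕ} (hm : 0 < m) {s p : ℝ} (hs0 : 0 < s) (hs1 : s ≤ 1) (hp : 1 ≤ p)
    {N : Type*} [EMetricSpace N] [SecondCountableTopology N] [ConnectedSpace N]
    [MeasurableSpace N] [BorelSpace N]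
    [ChartedSpace (EuclideanSpace ℝ (Fin d)) N] [IsManifold (𝓡 d) ∞ N]
    [RiemannianBundle (fun x : N => TangentSpace (𝓡 d) x)]
    [IsContMDiffRiemannianBundle (𝓡 d) ∞ (EuclideanSpace ℝ (Fin d))
      (fun x : N => TangentSpace (𝓡 d) x)]
    [IsRiemannianManifold (𝓡 d) N]
    (hN : ((m : ℝ) < s * p ∨ (s = 1 ∧ p = 1 ∧ m = 1)) → CompactSpace N)
    (ι : N → EuclideanSpace ℝ (Fin ν)) (hι : s = 1 → IsIsometricEmbedding (d := d) ι)
    (G : MapEnergy m N) (hsuper : G.Superadditive) (hscale : G.ScalesWith ((m : ℝ) - s * p))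
    (hfin : ∀ u : Metric.ball (0 : EuclideanSpace ℝ (Fin m)) 1 → N, NullMeasurable u volume →
      sobolevEnergy ι s p (Metric.ball 0 1) u < ⊤ → G.toFun (Metric.ball 0 1) u < ⊤)
    (hzero : ∀ u : Metric.ball (0 : EuclideanSpace ℝ (Fin m)) 1 → N, NullMeasurable u volume →
      sobolevEnergy ι s p (Metric.ball 0 1) u = 0 → G.toFun (Metric.ball 0 1) u = 0) :
    ∃ C : ℝ≥0, ∀ u : Metric.ball (0 : EuclideanSpace ℝ (Fin m)) 1 → N, NullMeasurable u volume →
      (s * p < m ∨ sobolevEnergy ι s p (Metric.ball 0 1) u ≤ (C : ℝ≥0∞)⁻¹) →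
        G.toFun (Metric.ball 0 1) u ≤ C * sobolevEnergy ι s p (Metric.ball 0 1) u := by
  have hp0 : 0 < p := by linarith
  have hN' : (s * p < m ∨ (s * p = m ∧ 1 < p)) ∨ CompactSpace N := by
    rcases lt_trichotomy (s * p) m with h | h | h
    · exact Or.inl (Or.inl h)
    · rcases hp.eq_or_lt with h1 | h1
      -- if `p = 1`, then `m = s ≤ 1`, hence `m = s = 1`
      · subst h1
        rw [mul_one] at h
        have hm1 : m = 1 := le_antisymm (by exact_mod_cast h ▸ hs1) hm
        subst hm1
        exact Or.inr (hN (Or.inr ⟨by exact_mod_cast h, rfl, rfl⟩))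
      · exact Or.inl (Or.inr ⟨h, h1⟩)
    · exact Or.inr (hN (Or.inl h))
  have hpath := exists_lipschitzWith_path (d := d) (N := N)
  have hloc := fun (b : N) (K : ℝ≥0) (hK : 0 < K) =>
    eventually_exists_lipschitzWith_path (d := d) b hK
  rw [show (s * p < m) ↔ 0 < (m : ℝ) - s * p from sub_pos.symm]
  by_cases hs : s = 1
  · subst hs
    simp only [sobolevEnergy, if_true, one_mul] at hfin hzero hscale hN' ⊢
    exact uniform_boundedness_dirichletEnergy hm hp (lipschitzWith_one_of_norm_mfderiv (hι rfl))
      hpath hloc hN' hsuper hscale hfin hzero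
  · simp only [sobolevEnergy, if_neg hs] at hfin hzero ⊢
    exact uniform_boundedness_gagliardoEnergy hm hs0 (lt_of_le_of_ne hs1 hs) hp hpath hloc hN'
      hsuper hscale hfin hzero
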